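/- Let $k$ be an algebraically closed field of characteristic zero. Let $\widetilde A$ be a unital associative $k$-algebra with an exhaustive filtration $F^0\widetilde A\subseteq F^1\widetilde A\subseteq\cdots$ by $k$-subspaces, $\widetilde A=\bigcup_{n\ge 0}F^n\widetilde A$, with $1\in F^0\widetilde A$ and $F^m\widetilde A\cdot F^n\widetilde A\subseteq F^{m+n}\widetilde A$. Put $F^{n}\widetilde A=0$ for $n<0$, and suppose that the associated graded algebra $A_0=\operatorname{gr}\widetilde A=\bigoplus_{n\ge 0}F^n\widetilde A/F^{n-1}\widetilde A$ is a commutative domain. Equip $A_0$ with the induced Poisson bracket: for $a\in F^m\widetilde A$ and $b\in F^n\widetilde A$ with classes $\bar a\in F^m\widetilde A/F^{m-1}\widetilde A$ and $\bar b\in F^n\widetilde A/F^{n-1}\widetilde A$, the bracket $\{\bar a,\bar b\}$ is the class of $ab-ba$ in $F^{m+n-1}\widetilde A/F^{m+n-2}\widetilde A$. Extend it (uniquely) to a biderivation on the fraction field $Q(A_0)$. Let $H$ be a finite dimensional Hopf algebra over $k$ acting on $\widetilde A$ (that is, $\widetilde A$ is a left $H$-module algebra) in such a way that $H\cdot F^n\widetilde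 A\subseteq F^n\widetilde A$ for all $n\ge 0$. Suppose that the Poisson center of $Q(A_0)$ is trivial, i.e. if $f\in Q(A_0)$ satisfies $\{f,g\}=0$ for all $g\in Q(A_0)$, then $f\in k$. Then the action of $H$ on $\widetilde A$ factors through a group action: there are a finite group $G$ acting on $\widetilde A$ by $k$-algebra automorphisms and a surjective homomorphism of Hopf algebras $\varphi\colon H\to k[G]$ such that $h\cdot a=\varphi(h)\cdot a$ for all $h\in H$ and $a\in\widetilde A$, where $k[G]$ acts on $\widetilde A$ by linear extension of the action of $G$. -/

import Mathlib

open scoped DirectSum TensorProduct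

/-! ### Filtered algebras and their associated graded algebras -/

/-- An exhaustive `ℕ`-filtration `F⁰ ⊆ F¹ ⊆ ⋯` of a unital associative `k`-algebra `A`, with
`1 ∈ F⁰` and `Fᵐ Fⁿ ⊆ Fᵐ⁺ⁿ`. -/
structure AlgFiltration (k A : Type*) [Field k] [Ring A] [Algebra k A] where
  /-- the `n`-th filtered piece -/
  level : ℕ → Submodule k A
  mono : Monotone level
  one_mem : (1 : A) ∈ level 0
  mul_mem : ∀ {m n : ℕ} {a b : A}, a ∈ level m → b ∈ level n → a * b ∈ level (m + n)
  exhaustive : ∀ a : A, ∃ n, a ∈ level n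

namespace AlgFiltration

section Graded

variable {k A : Type*} [Field k] [Ring A] [Algebra k A] (F : AlgFiltration k A)

/-- `Fⁿ⁻¹`, with the convention `F⁻¹ = 0`. -/
def below : ℕ → Submodule k A
  | 0 => ⊥
  | n + 1 => F.level n

theorem below_le (n : ℕ) : F.below n ≤ F.level n := by
  cases n with
  | zero => exact bot_le
  | succ n => exact F.mono (Nat.le_succ n)

theorem mul_mem_below {m n : ℕ} {a b : A} (ha : a ∈ F.level m) (hb : b ∈ F.below n) :
    a * b ∈ F.below (m + n) := by
  cases n with
  | zero =>
    have hb0 : b = 0 := (Submodule.mem_bot k).1 hb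
    rw [hb0, mul_zero]; exact Submodule.zero_mem _
  | succ n => exact F.mul_mem ha hb

theorem below_mul_mem {m n : ℕ} {a b : A} (ha : a ∈ F.below m) (hb : b ∈ F.level n) :
    a * b ∈ F.below (m + n) := by
  cases m with
  | zero =>
    have ha0 : a = 0 := (Submodule.mem_bot k).1 ha
    rw [ha0, zero_mul]; exact Submodule.zero_mem _
  | succ m =>
    have h : m + 1 + n = (m + n) + 1 := by omega
    rw [h]; exact F.mul_mem ha hb

/-- The graded piece `Fⁿ / Fⁿ⁻¹`. -/
def Piece (n : ℕ) : Type _ := F.level n ⧸ (F.below n).submoduleOf (F.level n)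

instance (n : ℕ) : AddCommGroup (F.Piece n) :=
  inferInstanceAs (AddCommGroup (F.level n ⧸ (F.below n).submoduleOf (F.level n)))

instance (n : ℕ) : Module k (F.Piece n) :=
  inferInstanceAs (Module k (F.level n ⧸ (F.below n).submoduleOf (F.level n)))

/-- The class of `a ∈ Fⁿ` in `Fⁿ / Fⁿ⁻¹`. -/
def toPiece (n : ℕ) : F.level n →ₗ[k] F.Piece n :=
  ((F.below n).submoduleOf (F.level n)).mkQ

variable {F} in
theorem toPiece_surjective {n : ℕ} (x : F.Piece n) :
    ∃ (a : A) (h : a ∈ F.level n), F.toPiece n ⟨a, h⟩ = x := by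
  obtain ⟨⟨a, h⟩, rfl⟩ := Submodule.mkQ_surjective _ x
  exact ⟨a, h, rfl⟩

theorem toPiece_eq_zero {n : ℕ} (a : F.level n) (h : (a : A) ∈ F.below n) :
    F.toPiece n a = 0 :=
  (Submodule.Quotient.mk_eq_zero _).2 h

/-- The multiplication `Fᵐ × Fⁿ → Fᵐ⁺ⁿ / Fᵐ⁺ⁿ⁻¹`. -/
def levelMul (m n : ℕ) : F.level m →ₗ[k] F.level n →ₗ[k] F.Piece (m + n) :=
  LinearMap.mk₂ k (fun a b => F.toPiece (m + n) ⟨a.1 * b.1, F.mul_mem a.2 b.2⟩)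
    (fun a a' b => by
      rw [← map_add]; congr 1; ext; simp [add_mul])
    (fun c a b => by
      rw [← map_smul]; congr 1; ext; simp)
    (fun a b b' => by
      rw [← map_add]; congr 1; ext; simp [mul_add])
    (fun c a b => by
      rw [← map_smul]; congr 1; ext; simp)

/-- The induced multiplication `Fᵐ/Fᵐ⁻¹ × Fⁿ/Fⁿ⁻¹ → Fᵐ⁺ⁿ/Fᵐ⁺ⁿ⁻¹`. -/
def pieceMul (m n : ℕ) : F.Piece m →ₗ[k] F.Piece n →ₗ[k] F.Piece (m + n) :=
  (F.levelMul m n).liftQ₂ _ _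
    (fun _ ha => LinearMap.ext fun b => F.toPiece_eq_zero _ (F.below_mul_mem ha b.2))
    (fun _ hb => LinearMap.ext fun a => F.toPiece_eq_zero _ (F.mul_mem_below a.2 hb))

theorem pieceMul_toPiece {m n : ℕ} (a : F.level m) (b : F.level n) :
    F.pieceMul m n (F.toPiece m a) (F.toPiece n b) =
      F.toPiece (m + n) ⟨a.1 * b.1, F.mul_mem a.2 b.2⟩ := rfl

theorem mk_toPiece_congr {m n : ℕ} (h : m = n) {a b : A} (hab : a = b)
    (ha : a ∈ F.level m) (hb : b ∈ F.level n) :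
    (GradedMonoid.mk m (F.toPiece m ⟨a, ha⟩) : GradedMonoid F.Piece) =
      GradedMonoid.mk n (F.toPiece n ⟨b, hb⟩) := by
  subst h; subst hab; rfl

instance gMul : GradedMonoid.GMul F.Piece where
  mul {m n} x y := F.pieceMul m n x y

instance gOne : GradedMonoid.GOne F.Piece where
  one := F.toPiece 0 ⟨1, F.one_mem⟩

instance gRing : DirectSum.GRing F.Piece where
  mul_zero x := map_zero (F.pieceMul _ _ x)
  zero_mul y := by
    change F.pieceMul _ _ 0 y = 0
    rw [map_zero, LinearMap.zero_apply]
  mul_add x y z := map_add (F.pieceMul _ _ x) y z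
  add_mul x y z := by
    change F.pieceMul _ _ (x + y) z = F.pieceMul _ _ x z + F.pieceMul _ _ y z
    rw [map_add, LinearMap.add_apply]
  one_mul := by
    rintro ⟨n, x⟩
    obtain ⟨a, ha, rfl⟩ := toPiece_surjective x
    exact F.mk_toPiece_congr (zero_add n) (one_mul a) _ _
  mul_one := by
    rintro ⟨n, x⟩
    obtain ⟨a, ha, rfl⟩ := toPiece_surjective x
    exact F.mk_toPiece_congr (add_zero n) (mul_one a) _ _
  mul_assoc := by
    rintro ⟨m, x⟩ ⟨n, y⟩ ⟨p, z⟩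
    obtain ⟨a, ha, rfl⟩ := toPiece_surjective x
    obtain ⟨b, hb, rfl⟩ := toPiece_surjective y
    obtain ⟨c, hc, rfl⟩ := toPiece_surjective z
    exact F.mk_toPiece_congr (add_assoc m n p) (mul_assoc a b c) _ _
  natCast r := (r : k) • F.toPiece 0 ⟨1, F.one_mem⟩
  natCast_zero := by simp
  natCast_succ r := by
    rw [Nat.cast_succ, add_smul, one_smul]; rfl
  intCast r := (r : k) • F.toPiece 0 ⟨1, F.one_mem⟩
  intCast_ofNat r := by simp
  intCast_negSucc_ofNat r := by
    rw [Int.cast_negSucc, neg_smul]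

instance gAlgebra : DirectSum.GAlgebra k F.Piece where
  toFun := ((LinearMap.id : k →ₗ[k] k).smulRight (F.toPiece 0 ⟨1, F.one_mem⟩)).toAddMonoidHom
  map_one := one_smul k (F.toPiece 0 ⟨1, F.one_mem⟩)
  map_mul r s := by
    change GradedMonoid.mk 0 ((r * s) • F.toPiece 0 ⟨1, F.one_mem⟩) =
      GradedMonoid.mk (0 + 0) (F.pieceMul 0 0 (r • F.toPiece 0 ⟨1, F.one_mem⟩)
        (s • F.toPiece 0 ⟨1, F.one_mem⟩))
    simp only [← map_smul, pieceMul_toPiece]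
    refine F.mk_toPiece_congr (zero_add 0).symm ?_ _ _
    simp [mul_smul, smul_comm r s]
  commutes r := by
    rintro ⟨n, x⟩
    obtain ⟨a, ha, rfl⟩ := toPiece_surjective x
    change GradedMonoid.mk (0 + n) (F.pieceMul 0 n (r • F.toPiece 0 ⟨1, F.one_mem⟩) _) =
      GradedMonoid.mk (n + 0) (F.pieceMul n 0 _ (r • F.toPiece 0 ⟨1, F.one_mem⟩))
    simp only [← map_smul, pieceMul_toPiece]
    refine F.mk_toPiece_congr (by omega) ?_ _ _
    simp
  smul_def r := by
    rintro ⟨n, x⟩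
    obtain ⟨a, ha, rfl⟩ := toPiece_surjective x
    change GradedMonoid.mk n (r • F.toPiece n ⟨a, ha⟩) =
      GradedMonoid.mk (0 + n) (F.pieceMul 0 n (r • F.toPiece 0 ⟨1, F.one_mem⟩) _)
    simp only [← map_smul, pieceMul_toPiece]
    refine F.mk_toPiece_congr (by omega) ?_ _ _
    simp

/-- The associated graded algebra `gr A = ⨁ₙ Fⁿ / Fⁿ⁻¹`. -/
def Gr : Type _ := ⨁ n, F.Piece n

instance : Ring F.Gr := inferInstanceAs (Ring (⨁ n, F.Piece n))

instance : Algebra k F.Gr := inferInstanceAs (Algebra k (⨁ n, F.Piece n))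

/-- The class in `gr A`, homogeneous of degree `n`, of an element of `Fⁿ`. -/
def sym (n : ℕ) : F.level n →ₗ[k] F.Gr :=
  (DirectSum.lof k ℕ F.Piece n).comp (F.toPiece n)

theorem sym_mul_sym {m n : ℕ} (a : F.level m) (b : F.level n) :
    F.sym m a * F.sym n b = F.sym (m + n) ⟨a.1 * b.1, F.mul_mem a.2 b.2⟩ :=
  DirectSum.of_mul_of (A := F.Piece) (F.toPiece m a) (F.toPiece n b)

theorem sym_congr {m n : ℕ} (h : m = n) {a b : A} (hab : a = b)
    (ha : a ∈ F.level m) (hb : b ∈ F.level n) : F.sym m ⟨a, ha⟩ = F.sym n ⟨b, hb⟩ := by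
  subst h; subst hab; rfl

theorem mem_below_of_sym_eq_zero {n : ℕ} (a : F.level n) (h : F.sym n a = 0) :
    (a : A) ∈ F.below n := by
  have h0 : F.toPiece n a = 0 :=
    DirectSum.of_injective (β := F.Piece) n (h.trans (map_zero (DirectSum.of F.Piece n)).symm)
  exact (Submodule.Quotient.mk_eq_zero ((F.below n).submoduleOf (F.level n))).1 h0

variable {F} in
theorem gr_induction {P : F.Gr → Prop} (h0 : P 0) (hs : ∀ n a, P (F.sym n a))
    (hadd : ∀ x y, P x → P y → P (x + y)) (x : F.Gr) : P x := by
  refine DirectSum.induction_on (β := F.Piece) (motive := P) x h0 (fun n y => ?_) hadd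
  obtain ⟨a, ha, rfl⟩ := toPiece_surjective y
  exact hs n ⟨a, ha⟩

/-- Linear maps out of `gr A` are given by linear maps out of the graded pieces. -/
def ofPieces {N : Type*} [AddCommGroup N] [Module k N] (f : ∀ n, F.Piece n →ₗ[k] N) :
    F.Gr →ₗ[k] N :=
  DirectSum.toModule k ℕ N f

theorem ofPieces_sym {N : Type*} [AddCommGroup N] [Module k N] (f : ∀ n, F.Piece n →ₗ[k] N)
    (n : ℕ) (a : F.level n) : F.ofPieces f (F.sym n a) = f n (F.toPiece n a) :=
  DirectSum.toModule_lof k n (F.toPiece n a)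

/-- For `a ∈ Fⁿ⁻¹`, the class of `a` in `gr A`, homogeneous of degree `n - 1`
(zero if `n = 0`). -/
def symPred : (n : ℕ) → F.below n →ₗ[k] F.Gr
  | 0 => 0
  | n + 1 => F.sym n

theorem symPred_congr {m n : ℕ} (h : m = n) {a b : A} (hab : a = b)
    (ha : a ∈ F.below m) (hb : b ∈ F.below n) :
    F.symPred m ⟨a, ha⟩ = F.symPred n ⟨b, hb⟩ := by
  subst h; subst hab; rfl

theorem sym_mul_symPred {m n : ℕ} (a : F.level m) (b : F.below n) :
    F.sym m a * F.symPred n b = F.symPred (m + n) ⟨a.1 * b.1, F.mul_mem_below a.2 b.2⟩ := by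
  cases n with
  | zero =>
    have hb0 : b.1 = 0 := (Submodule.mem_bot k).1 b.2
    have : (⟨a.1 * b.1, F.mul_mem_below a.2 b.2⟩ : F.below (m + 0)) = 0 := by
      ext; simp [hb0]
    rw [this, map_zero]
    exact mul_zero _
  | succ n => exact F.sym_mul_sym a b

theorem symPred_mul_sym {m n : ℕ} (a : F.below m) (b : F.level n) :
    F.symPred m a * F.sym n b = F.symPred (m + n) ⟨a.1 * b.1, F.below_mul_mem a.2 b.2⟩ := by
  cases m with
  | zero =>
    have ha0 : a.1 = 0 := (Submodule.mem_bot k).1 a.2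
    have : (⟨a.1 * b.1, F.below_mul_mem a.2 b.2⟩ : F.below (0 + n)) = 0 := by
      ext; simp [ha0]
    rw [this, map_zero]
    exact zero_mul _
  | succ m =>
    refine (F.sym_mul_sym a b).trans ?_
    exact F.symPred_congr (m := m + n + 1) (n := m + 1 + n) (by omega) rfl
      (F.mul_mem (m := m) a.2 b.2) _

theorem symPred_eq_zero {n : ℕ} (a : F.below n)
    (h : ∀ m, n = m + 1 → (a : A) ∈ F.below m) : F.symPred n a = 0 := by
  cases n with
  | zero => rfl
  | succ n =>
    change DirectSum.lof k ℕ F.Piece n (F.toPiece n a) = 0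
    rw [F.toPiece_eq_zero a (h n rfl), map_zero]

end Graded

/-! ### The Poisson bracket on a commutative associated graded algebra -/

section Bracket

variable {k A : Type*} [Field k] [Ring A] [Algebra k A] (F : AlgFiltration k A)
  [IsMulCommutative F.Gr]

instance : CommRing F.Gr where
  mul_comm := isMulCommutative_iff.1 inferInstance

theorem commutator_mem {m n : ℕ} {a b : A} (ha : a ∈ F.level m) (hb : b ∈ F.level n) :
    a * b - b * a ∈ F.below (m + n) := by
  have hba : b * a ∈ F.level (m + n) := by
    rw [add_comm]; exact F.mul_mem hb ha
  refine F.mem_below_of_sym_eq_zero ⟨a * b - b * a, sub_mem (F.mul_mem ha hb) hba⟩ ?_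
  have h := mul_comm (F.sym m ⟨a, ha⟩) (F.sym n ⟨b, hb⟩)
  rw [sym_mul_sym, sym_mul_sym,
    F.sym_congr (add_comm n m) rfl (F.mul_mem hb ha) hba] at h
  rw [← sub_eq_zero, ← map_sub] at h
  exact h

/-- For `a ∈ Fᵐ` and `b ∈ Fⁿ`, the class of `ab - ba` in `Fᵐ⁺ⁿ⁻¹ / Fᵐ⁺ⁿ⁻²`. -/
def levelBracket (m n : ℕ) : F.level m →ₗ[k] F.level n →ₗ[k] F.Gr :=
  LinearMap.mk₂ k
    (fun a b => F.symPred (m + n) ⟨a.1 * b.1 - b.1 * a.1, F.commutator_mem a.2 b.2⟩)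
    (fun a a' b => by
      rw [← map_add]; congr 1; ext; simp only [Submodule.coe_add]; noncomm_ring)
    (fun c a b => by
      rw [← map_smul]; congr 1; ext; simp [smul_sub])
    (fun a b b' => by
      rw [← map_add]; congr 1; ext; simp only [Submodule.coe_add]; noncomm_ring)
    (fun c a b => by
      rw [← map_smul]; congr 1; ext; simp [smul_sub])

theorem levelBracket_left {m n : ℕ} (a : F.level m) (b : F.level n)
    (h : (a : A) ∈ F.below m) : F.levelBracket m n a b = 0 := by
  refine F.symPred_eq_zero _ fun p hp => ?_
  cases m with
  | zero =>
    have h0 : (a : A) = 0 := (Submodule.mem_bot k).1 h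
    simp [h0]
  | succ m =>
    obtain rfl : p = m + n := by omega
    exact F.commutator_mem h b.2

theorem levelBracket_right {m n : ℕ} (a : F.level m) (b : F.level n)
    (h : (b : A) ∈ F.below n) : F.levelBracket m n a b = 0 := by
  refine F.symPred_eq_zero _ fun p hp => ?_
  cases n with
  | zero =>
    have h0 : (b : A) = 0 := (Submodule.mem_bot k).1 h
    simp [h0]
  | succ n =>
    obtain rfl : p = m + n := by omega
    exact F.commutator_mem a.2 h

/-- The bracket on homogeneous elements of `gr A`. -/
def pieceBracket (m n : ℕ) : F.Piece m →ₗ[k] F.Piece n →ₗ[k] F.Gr :=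
  (F.levelBracket m n).liftQ₂ _ _
    (fun a ha => LinearMap.ext fun b => F.levelBracket_left a b ha)
    (fun b hb => LinearMap.ext fun a => F.levelBracket_right a b hb)

/-- The bracket on `gr A`, as a bilinear map. -/
def grBracket : F.Gr →ₗ[k] F.Gr →ₗ[k] F.Gr :=
  F.ofPieces fun m => (F.ofPieces fun n => (F.pieceBracket m n).flip).flip

theorem grBracket_sym {m n : ℕ} (a : F.level m) (b : F.level n) :
    F.grBracket (F.sym m a) (F.sym n b) =
      F.symPred (m + n) ⟨a.1 * b.1 - b.1 * a.1, F.commutator_mem a.2 b.2⟩ := by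
  rw [grBracket, ofPieces_sym, LinearMap.flip_apply, ofPieces_sym]
  rfl

theorem grBracket_skew (x y : F.Gr) : F.grBracket x y = - F.grBracket y x := by
  induction x using gr_induction with
  | h0 => simp
  | hadd x x' hx hx' => rw [map_add, map_add, LinearMap.add_apply, hx, hx', neg_add]
  | hs m a =>
    induction y using gr_induction with
    | h0 => simp
    | hadd y y' hy hy' => rw [map_add, map_add, LinearMap.add_apply, hy, hy', neg_add]
    | hs n b =>
      rw [grBracket_sym, grBracket_sym, ← map_neg]
      exact F.symPred_congr (add_comm m n) (neg_sub _ _).symm _ _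

theorem grBracket_mul (x y z : F.Gr) :
    F.grBracket x (y * z) = y * F.grBracket x z + z * F.grBracket x y := by
  induction x using gr_induction with
  | h0 => simp
  | hadd x x' hx hx' =>
    rw [map_add, LinearMap.add_apply, LinearMap.add_apply, LinearMap.add_apply, hx, hx']; ring
  | hs m a =>
    induction y using gr_induction with
    | h0 => simp
    | hadd y y' hy hy' => rw [add_mul, map_add, map_add, hy, hy']; ring
    | hs n b =>
      induction z using gr_induction with
      | h0 => simp
      | hadd z z' hz hz' => rw [mul_add, map_add, map_add, hz, hz']; ring
      | hs p c =>
        rw [mul_comm (F.sym p c) (F.grBracket _ _), sym_mul_sym, grBracket_sym, grBracket_sym,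
          grBracket_sym, sym_mul_symPred, symPred_mul_sym]
        have e1 : n + (m + p) = m + (n + p) := by omega
        have e2 : m + n + p = m + (n + p) := by omega
        have h1 := F.mul_mem_below b.2 (F.commutator_mem a.2 c.2)
        have h2 := F.below_mul_mem (F.commutator_mem a.2 b.2) c.2
        rw [F.symPred_congr e1 rfl h1 (e1 ▸ h1), F.symPred_congr e2 rfl h2 (e2 ▸ h2),
          ← map_add]
        refine F.symPred_congr rfl ?_ _ _
        simp only
        noncomm_ring

/-- The induced Poisson bracket on a commutative `gr A`, as a biderivation. On homogeneous
elements it sends the classes of `a ∈ Fᵐ` and `b ∈ Fⁿ` to the class of `ab - ba` in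
`Fᵐ⁺ⁿ⁻¹ / Fᵐ⁺ⁿ⁻²`. -/
def poisson : Derivation k F.Gr (Derivation k F.Gr F.Gr) :=
  Derivation.mk'
    { toFun := fun x => Derivation.mk' (F.grBracket x) (F.grBracket_mul x)
      map_add' := fun x y => by ext z; simp
      map_smul' := fun c x => by ext z; simp }
    (fun x y => by
      ext z
      change F.grBracket (x * y) z = x * F.grBracket y z + y * F.grBracket x z
      rw [F.grBracket_skew, F.grBracket_mul, F.grBracket_skew y z, F.grBracket_skew x z]
      ring)

theorem poisson_sym {m n : ℕ} (a : F.level m) (b : F.level n) :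
    F.poisson (F.sym m a) (F.sym n b) =
      F.symPred (m + n) ⟨a.1 * b.1 - b.1 * a.1, F.commutator_mem a.2 b.2⟩ :=
  F.grBracket_sym a b

end Bracket

end AlgFiltration

/-! ### Extension of biderivations to the fraction field -/

section FractionField

variable {k R K M : Type*} [Field k] [CommRing R] [IsDomain R] [Algebra k R] [Field K]
  [Algebra R K] [IsFractionRing R K] [AddCommGroup M] [Module k M] [Module R M] [Module K M]
  [IsScalarTower R K M]

/-- The value at `x = a / s` of the extension of a derivation `D` to the fraction field: the
quotient rule in the form `s⁻¹ (D a - x D s)`, for a chosen representation of `x`. -/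
noncomputable def fracDerivFun (D : Derivation k R M) (x : K) : M :=
  (algebraMap R K (IsLocalization.sec (nonZeroDivisors R) x).2)⁻¹ •
    (D (IsLocalization.sec (nonZeroDivisors R) x).1 -
      x • D (IsLocalization.sec (nonZeroDivisors R) x).2)

/-- The value does not depend on the representation. -/
theorem fracDerivFun_eq (D : Derivation k R M) {x : K} {a s : R} (hs : s ≠ 0)
    (h : x * algebraMap R K s = algebraMap R K a) :
    fracDerivFun D x = (algebraMap R K s)⁻¹ • (D a - x • D s) := by
  have hspec := IsLocalization.sec_spec (nonZeroDivisors R) x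
  have ht0 : ((IsLocalization.sec (nonZeroDivisors R) x).2 : R) ≠ 0 :=
    nonZeroDivisors.ne_zero (IsLocalization.sec (nonZeroDivisors R) x).2.2
  unfold fracDerivFun
  generalize (IsLocalization.sec (nonZeroDivisors R) x).1 = b at *
  generalize ((IsLocalization.sec (nonZeroDivisors R) x).2 : R) = t at *
  have hinj := IsFractionRing.injective R K
  have hs' : algebraMap R K s ≠ 0 := (map_ne_zero_iff _ hinj).2 hs
  have ht' : algebraMap R K t ≠ 0 := (map_ne_zero_iff _ hinj).2 ht0
  have hab : b * s = a * t := hinj (by rw [map_mul, map_mul, ← hspec, ← h]; ring)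
  have hD := congrArg D hab
  rw [D.leibniz, D.leibniz] at hD
  simp only [← algebraMap_smul K (_ : R) (_ : M), ← h, ← hspec] at hD
  rw [inv_smul_eq_iff₀ ht', smul_comm, eq_inv_smul_iff₀ hs', smul_sub, smul_sub, smul_smul,
    smul_smul, mul_comm _ x, mul_comm _ x, sub_eq_sub_iff_add_eq_add, add_comm, hD, add_comm]

variable (R) in
theorem exists_common_denominator (x y : K) : ∃ a b s : R, s ≠ 0 ∧
    x * algebraMap R K s = algebraMap R K a ∧ y * algebraMap R K s = algebraMap R K b := by
  obtain ⟨⟨a, s⟩, hx⟩ := IsLocalization.surj (nonZeroDivisors R) x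
  obtain ⟨⟨b, t⟩, hy⟩ := IsLocalization.surj (nonZeroDivisors R) y
  refine ⟨a * t, b * s, s * t, mul_ne_zero (nonZeroDivisors.ne_zero s.2)
    (nonZeroDivisors.ne_zero t.2), ?_, ?_⟩
  · simp only at hx
    rw [map_mul, map_mul, ← hx]; ring
  · simp only at hy
    rw [map_mul, map_mul, ← hy]; ring

variable [Algebra k K] [IsScalarTower k R K] [IsScalarTower k R M] [IsScalarTower k K M]

/-- The unique extension of a derivation of a domain to its fraction field. -/
noncomputable def fracDeriv (D : Derivation k R M) : Derivation k K M :=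
  Derivation.mk'
    { toFun := fracDerivFun D
      map_add' := fun x y => by
        obtain ⟨a, b, s, hs, hx, hy⟩ := exists_common_denominator R x y
        rw [fracDerivFun_eq D hs hx, fracDerivFun_eq D hs hy,
          fracDerivFun_eq D (a := a + b) hs (by rw [add_mul, hx, hy, map_add]), map_add]
        module
      map_smul' := fun c x => by
        obtain ⟨a, _, s, hs, hx, _⟩ := exists_common_denominator R x x
        rw [fracDerivFun_eq D hs hx, fracDerivFun_eq D (a := c • a) hs
          (by rw [smul_mul_assoc, hx]; exact (map_smul (IsScalarTower.toAlgHom k R K) c a).symm),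
          Derivation.map_smul, RingHom.id_apply, smul_assoc, ← smul_sub, smul_comm] }
    fun x y => by
      obtain ⟨a, b, s, hs, hx, hy⟩ := exists_common_denominator R x y
      have hs' : algebraMap R K s ≠ 0 := (map_ne_zero_iff _ (IsFractionRing.injective R K)).2 hs
      change fracDerivFun D (x * y) = x • fracDerivFun D y + y • fracDerivFun D x
      rw [fracDerivFun_eq D hs hx, fracDerivFun_eq D hs hy,
        fracDerivFun_eq D (a := a * b) (mul_ne_zero hs hs)
          (by rw [map_mul, map_mul, ← hx, ← hy]; ring)]
      rw [D.leibniz, D.leibniz, inv_smul_eq_iff₀ (by rw [map_mul]; exact mul_ne_zero hs' hs')]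
      simp only [← algebraMap_smul K (_ : R) (_ : M), ← hx, ← hy, map_mul]
      match_scalars <;> field_simp
      ring

theorem fracDeriv_eq (D : Derivation k R M) {x : K} {a s : R} (hs : s ≠ 0)
    (h : x * algebraMap R K s = algebraMap R K a) :
    fracDeriv D x = (algebraMap R K s)⁻¹ • (D a - x • D s) :=
  fracDerivFun_eq D hs h

theorem fracDeriv_algebraMap (D : Derivation k R M) (a : R) :
    fracDeriv D (algebraMap R K a) = D a := by
  rw [fracDeriv_eq D (a := a) one_ne_zero (by rw [map_one, mul_one])]
  simp

variable (K) in
/-- The unique extension to the fraction field `K` of a biderivation of a domain `R`. -/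
noncomputable def fracBiderivation (B : Derivation k R (Derivation k R R)) :
    Derivation k K (Derivation k K K) :=
  fracDeriv <| Derivation.mk'
    { toFun := fun a => fracDeriv ((Algebra.linearMap R K).compDer (B a))
      map_add' := fun a b => by
        ext x
        obtain ⟨c, _, s, hs, hx, _⟩ := exists_common_denominator R x x
        simp only [Derivation.add_apply, fracDeriv_eq _ hs hx, map_add]
        module
      map_smul' := fun r a => by
        ext x
        obtain ⟨c, _, s, hs, hx, _⟩ := exists_common_denominator R x x
        have h : ∀ y : R, (Algebra.linearMap R K).compDer (B (r • a)) y =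
            r • (Algebra.linearMap R K).compDer (B a) y := fun y => by
          rw [Derivation.map_smul]
          exact map_smul (IsScalarTower.toAlgHom k R K) r (B a y)
        rw [RingHom.id_apply, Derivation.smul_apply, fracDeriv_eq _ hs hx, fracDeriv_eq _ hs hx,
          h, h, smul_comm x r, ← smul_sub, smul_comm] }
    fun a b => by
      ext x
      obtain ⟨c, _, s, hs, hx, _⟩ := exists_common_denominator R x x
      change fracDeriv ((Algebra.linearMap R K).compDer (B (a * b))) x =
        a • fracDeriv ((Algebra.linearMap R K).compDer (B b)) x +
        b • fracDeriv ((Algebra.linearMap R K).compDer (B a)) x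
      simp only [fracDeriv_eq _ hs hx, B.leibniz, map_add, map_smul, Derivation.add_apply,
        Derivation.smul_apply]
      module

theorem fracBiderivation_algebraMap (B : Derivation k R (Derivation k R R)) (a b : R) :
    fracBiderivation K B (algebraMap R K a) (algebraMap R K b) = algebraMap R K (B a b) := by
  unfold fracBiderivation
  rw [fracDeriv_algebraMap]
  exact fracDeriv_algebraMap _ b

end FractionField

namespace AlgFiltration

variable {k A : Type*} [Field k] [Ring A] [Algebra k A] (F : AlgFiltration k A)

/-- The Poisson center of the fraction field `Q(gr A)` is trivial: every `f ∈ Q(gr A)` with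
`{f, g} = 0` for all `g ∈ Q(gr A)` lies in `k`. -/
def PoissonCenterTrivial [IsMulCommutative F.Gr] [IsDomain F.Gr] : Prop :=
  ∀ f : FractionRing F.Gr,
    (∀ g : FractionRing F.Gr, fracBiderivation (FractionRing F.Gr) F.poisson f g = 0) →
      ∃ c : k, f = algebraMap k (FractionRing F.Gr) c

end AlgFiltration

/-! ### Hopf actions -/

section HopfAction

variable (k H A : Type*) [Field k] [Ring H] [HopfAlgebra k H] [Ring A] [Algebra k A]
  [Module H A] [IsScalarTower k H A]

/-- `A` is a left `H`-module algebra: `h · (ab) = ∑ (h₁ · a)(h₂ · b)`, `h · 1 = ε(h) 1`. -/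
structure IsModuleAlgebra : Prop where
  smul_mul : ∀ (h : H) (a b : A), h • (a * b) =
    LinearMap.mul' k A (TensorProduct.map
      ((LinearMap.toSpanSingleton H A a).restrictScalars k)
      ((LinearMap.toSpanSingleton H A b).restrictScalars k)
      (Coalgebra.comul (R := k) h))
  smul_one : ∀ h : H, h • (1 : A) = algebraMap k A (Coalgebra.counit h)

/-- The action of `H` on `A` factors through a group action: there are a finite group `G` acting
on `A` by `k`-algebra automorphisms and a surjective homomorphism of Hopf algebras `H → k[G]`
through which the action of `H` is obtained from the one of `G`. -/
def FactorsThroughGroupAction : Prop :=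
  ∃ (G : Type) (_ : Group G) (_ : Finite G) (ρ : G →* (A ≃ₐ[k] A))
    (φ : H →ₐc[k] MonoidAlgebra k G), Function.Surjective φ ∧
      ∀ (h : H) (a : A), h • a = (φ h).coeff.sum fun g c => c • ρ g a

end HopfAction

/-! Write A₀ for gr A and Q for its fraction field. The Rees algebra `F.rees` is a flat deformation
of A₀ with parameter ℏ = X. The Hopf algebra H acts on it coefficientwise and fixes ℏ, and the
Poisson bracket of A₀ is the commutator divided by ℏ, reduced modulo ℏ. Modulo each power of ℏ the
elements with nonzero reduction form an Ore set. Inverting them and passing to the limit gives a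
deformation L of the field Q in which every nonzero element is a power of ℏ times a unit. The action
extends to L because the coaction sends the denominators to units of a convolution algebra.

An Artin-type argument in L shows that Q is algebraic over the reductions of the H-invariants of L
(`isAlgebraic_redInvariants`). If z is such a reduction, then {z, ·} commutes with the induced
action of H on Q, because z has an invariant lift (`act_bracket`). In characteristic zero a
derivation that kills all these z is zero, so an element of Q that Poisson commutes with all of them
is Poisson central, hence a constant. A second Artin-type argument then shows that operators from H
that are independent over k are independent over Q (`linearIndependent_of_commute`).

This independence makes the action on Q Galois: the space of operators through which H acts has
dimension [Q : Q^H]. The scalar functions on that space embed in the commutative ring Q ⊗ Q over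
Q^H, which is reduced by separability. Characters therefore separate them, each character is an
automorphism of Q over Q^H, and these automorphisms span the operators (`span_autOperator`). Hence H
acts on Q through k[G] with G = Aut(Q/Q^H), by a surjection φ of Hopf algebras.

It remains to see that ker φ kills all of A and not only Q. Suppose that ker φ maps L into ℏⁿL. The
leading symbol of x ∈ ker φ is a Q^H-linear operator on Q commuting with the brackets {z, ·}, so by
the independence above it is itself the operator of some h ∈ H (`act_mem_hbarPow`). On the Rees
algebra x preserves the degree while division by ℏⁿ lowers it by n; the operator of h preserves the
degree, so the symbol is zero. Thus ker φ maps L into every ℏⁿL, and it acts as zero on the Rees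
algebra and on A. -/

/-! ### Module algebras, with the action as an algebra homomorphism -/

section ModuleAlgebra

open Coalgebra WithConv

/-- A left `H`-module algebra structure on `A`, with the action given as a homomorphism. -/
structure HopfAct (k H A : Type*) [Field k] [Ring H] [HopfAlgebra k H] [Ring A]
    [Algebra k A] where
  /-- the action -/
  act : H →ₐ[k] Module.End k A
  act_mul' : ∀ (h : H) (a b : A), act h (a * b) =
    LinearMap.mul' k A (TensorProduct.map (act.toLinearMap.flip a) (act.toLinearMap.flip b)
      (comul (R := k) h))
  act_one : ∀ h : H, act h 1 = algebraMap k A (counit (R := k) h)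

/-- Composition with an algebra homomorphism, on convolution algebras. -/
noncomputable def convPostcomp {k : Type*} (C : Type*) {A B : Type*} [CommRing k] [AddCommGroup C] [Module k C]
    [Coalgebra k C] [Ring A] [Algebra k A] [Ring B] [Algebra k B] (f : A →ₐ[k] B) :
    WithConv (C →ₗ[k] A) →ₐ[k] WithConv (C →ₗ[k] B) :=
  AlgHom.ofLinearMap
    { toFun := fun u => toConv (f.toLinearMap ∘ₗ u.ofConv)
      map_add' := fun u v => by ext; simp
      map_smul' := fun c u => by ext; simp }
    (by ext; simp)
    (fun u v => by
      ext x
      simp [(ℛ k x).convMul_apply, map_sum, -LinearMap.convMul_apply])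

theorem convPostcomp_apply {k C A B : Type*} [CommRing k] [AddCommGroup C] [Module k C]
    [Coalgebra k C] [Ring A] [Algebra k A] [Ring B] [Algebra k B] (f : A →ₐ[k] B)
    (u : WithConv (C →ₗ[k] A)) (x : C) : convPostcomp C f u x = f (u x) := rfl

theorem Coalgebra.sum_smul_counit {k C ι : Type*} [CommRing k] [AddCommGroup C] [Module k C]
    [Coalgebra k C] {g : C} (r : Coalgebra.Repr k g ι) :
    ∑ i ∈ r.index, counit (R := k) (r.right i) • r.left i = g := by
  have := congrArg (TensorProduct.lift (LinearMap.lsmul k C).flip) (sum_tmul_counit_eq r)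
  simpa only [map_sum, TensorProduct.lift.tmul, LinearMap.flip_apply, LinearMap.lsmul_apply,
    one_smul] using this

namespace HopfAct

variable {k H A : Type*} [Field k] [Ring H] [HopfAlgebra k H] [Ring A] [Algebra k A]
  (α : HopfAct k H A)

/-- The coaction `a ↦ (h ↦ h · a)`, as a homomorphism to the convolution algebra. -/
noncomputable def coact : A →ₐ[k] WithConv (H →ₗ[k] A) :=
  AlgHom.ofLinearMap
    { toFun := fun a => toConv (α.act.toLinearMap.flip a)
      map_add' := fun a b => by ext; simp
      map_smul' := fun c a => by ext; simp }
    (by ext h; simp [α.act_one])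
    (fun a b => by ext h; exact α.act_mul' h a b)

theorem coact_apply (a : A) (h : H) : α.coact a h = α.act h a := rfl

theorem act_mul {ι : Type*} {h : H} (r : Coalgebra.Repr k h ι) (a b : A) :
    α.act h (a * b) = ∑ i ∈ r.index, α.act (r.left i) a * α.act (r.right i) b := by
  have := congrArg (fun u : WithConv (H →ₗ[k] A) => u h) (map_mul α.coact a b)
  rwa [r.convMul_apply] at this

/-- The module algebra structure defined by a coaction. -/
noncomputable def ofCoact (ρ : A →ₐ[k] WithConv (H →ₗ[k] A)) (h1 : ∀ a, ρ a 1 = a)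
    (hmul : ∀ a g h, ρ a (g * h) = ρ (ρ a h) g) : HopfAct k H A where
  act := AlgHom.ofLinearMap
    { toFun := fun h => 
        { toFun := fun a => ρ a h
          map_add' := fun a b => by simp
          map_smul' := fun c a => by simp }
      map_add' := fun g h => by ext; simp
      map_smul' := fun c h => by ext; simp }
    (by ext a; exact h1 a) (fun g h => by ext a; exact hmul a g h)
  act_mul' h a b := by
    change ρ (a * b) h = _
    rw [map_mul]
    rfl
  act_one h := by
    change ρ 1 h = _
    rw [map_one]
    rfl

/-- The module algebra structure on a quotient algebra by an `H`-stable ideal. -/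
theorem exists_descend {B : Type*} [Ring B] [Algebra k B] (f : A →ₐ[k] B)
    (hf : Function.Surjective f) (hker : ∀ h a, f a = 0 → f (α.act h a) = 0) :
    ∃ β : HopfAct k H B, ∀ h a, β.act h (f a) = f (α.act h a) := by
  have key : ∀ h a b, f a = f b → f (α.act h a) = f (α.act h b) := fun h a b hab => by
    have := hker h (a - b) (by rw [map_sub, hab, sub_self])
    rwa [map_sub, map_sub, sub_eq_zero] at this
  let s := Function.surjInv hf
  have hs : ∀ b, f (s b) = b := Function.surjInv_eq hf
  have hs' : ∀ h a, f (α.act h (s (f a))) = f (α.act h a) := fun h a => key h _ _ (hs _)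
  -- The section `s` is merely a set-theoretic one; by `key` every choice of preimage gives the same
  -- value, so additivity and multiplicativity can be checked upstairs.
  let ρ : B →ₐ[k] WithConv (H →ₗ[k] B) := AlgHom.ofLinearMap
    { toFun := fun b => convPostcomp H f (α.coact (s b))
      map_add' := fun a b => by
        ext h
        change f (α.act h _) = f (α.act h _) + f (α.act h _)
        rw [← map_add f, ← map_add (α.act h)]
        exact key _ _ _ (by rw [map_add, hs, hs, hs])
      map_smul' := fun c b => by
        ext h
        change f (α.act h _) = c • f (α.act h _)
        rw [← map_smul f, ← map_smul (α.act h)]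
        exact key _ _ _ (by rw [map_smul, hs, hs]) }
    (by
      rw [← map_one (convPostcomp H f), ← map_one α.coact]
      ext h
      exact key _ _ _ (by rw [hs, map_one]))
    (fun a b => by
      change convPostcomp H f (α.coact _) =
        convPostcomp H f (α.coact _) * convPostcomp H f (α.coact _)
      rw [← map_mul, ← map_mul]
      ext h
      exact key _ _ _ (by rw [hs, map_mul, hs, hs]))
  have hρ : ∀ a h, ρ (f a) h = f (α.act h a) := fun a h => hs' h a
  refine ⟨ofCoact ρ (fun b => ?_) (fun b g h => ?_), fun h a => hρ a h⟩
  · obtain ⟨a, rfl⟩ := hf b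
    rw [hρ, map_one]; rfl
  · obtain ⟨a, rfl⟩ := hf b
    rw [hρ, hρ, hρ, map_mul]; rfl

/-- In the convolution algebra of maps `H → End A`, the map `h ↦ (h · c) ·` is the conjugate of
multiplication by `c` by the action. -/
theorem act_mul_eq_sum {ι : Type*} {g : H} (r : Coalgebra.Repr k g ι) (c y : A) :
    α.act g c * y =
      ∑ i ∈ r.index, α.act (r.left i) (c * α.act (HopfAlgebra.antipode k (r.right i)) y) := by
  have h1 : ∀ i, α.act (r.left i) (c * α.act (HopfAlgebra.antipode k (r.right i)) y) =
      ∑ j ∈ (ℛ k (r.left i)).index, α.act ((ℛ k (r.left i)).left j) c *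
        α.act ((ℛ k (r.left i)).right j * HopfAlgebra.antipode k (r.right i)) y := fun i => by
    rw [α.act_mul (ℛ k (r.left i))]
    simp
  -- Φ sends u ⊗ v ⊗ w to (u · c)((v S(w)) · y). The two bracketings of the iterated coproduct give
  -- the two sides of the identity, once g₂S(g₃) collapses to the counit.
  let Φ : H ⊗[k] (H ⊗[k] H) →ₗ[k] A := LinearMap.mul' k A ∘ₗ TensorProduct.map
    (α.act.toLinearMap.flip c) (α.act.toLinearMap.flip y ∘ₗ LinearMap.mul' k H ∘ₗ
      TensorProduct.map LinearMap.id (HopfAlgebra.antipode k))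
  have h2 := congrArg Φ (sum_tmul_tmul_eq r (fun i => ℛ k (r.left i)) (fun i => ℛ k (r.right i)))
  simp only [map_sum] at h2
  simp only [h1]
  refine Eq.trans ?_ h2.symm
  have h3 : ∀ i, ∑ j ∈ (ℛ k (r.right i)).index, Φ (r.left i ⊗ₜ[k]
      ((ℛ k (r.right i)).left j ⊗ₜ[k] (ℛ k (r.right i)).right j)) =
      α.act (r.left i) c * (counit (R := k) (r.right i) • y) := fun i => by
    simp only [Φ, LinearMap.comp_apply, TensorProduct.map_tmul, LinearMap.mul'_apply,
      ← Finset.mul_sum, ← map_sum, LinearMap.id_apply,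
      HopfAlgebra.sum_mul_antipode_eq_algebraMap_counit]
    simp [Module.algebraMap_end_apply]
  simp only [h3]
  have h5 := sum_smul_counit r
  conv_lhs => rw [← h5]
  simp [Finset.sum_mul]

/-- A linear relation between orbit maps stays one when an element of `H` is applied to its
coefficients. -/
theorem sum_act_mul_eq_zero {ι : Type*} (s : Finset ι) (c b : ι → A)
    (h : ∀ h, ∑ i ∈ s, c i * α.act h (b i) = 0) (g h' : H) :
    ∑ i ∈ s, α.act g (c i) * α.act h' (b i) = 0 := by
  simp only [α.act_mul_eq_sum (ℛ k g)]
  rw [Finset.sum_comm]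
  refine Finset.sum_eq_zero fun j _ => ?_
  rw [← map_sum]
  -- After moving g outside, the inner sum is the given relation evaluated at S(g₂)h'.
  have := h (HopfAlgebra.antipode k ((ℛ k g).right j) * h')
  simp only [map_mul, Module.End.mul_apply] at this
  rw [this, map_zero]

/-- The invariants. -/
noncomputable def invariants : Subalgebra k A where
  carrier := {z | ∀ h, α.act h z = counit (R := k) h • z}
  mul_mem' {a b} ha hb h := by
    rw [α.act_mul (ℛ k h)]
    simp only [Set.mem_ofPred_eq] at ha hb
    simp only [ha, hb, smul_mul_smul_comm, ← Finset.sum_smul]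
    congr 1
    have := congrArg (counit (R := k)) (sum_counit_smul (R := k) (ℛ k h))
    simpa using this
  add_mem' {a b} ha hb h := by
    simp only [Set.mem_ofPred_eq] at ha hb
    rw [map_add, ha, hb, smul_add]
  algebraMap_mem' c h := by
    rw [Algebra.algebraMap_eq_smul_one, map_smul, α.act_one, Algebra.algebraMap_eq_smul_one,
      smul_comm]

theorem mem_invariants {z : A} :
    z ∈ α.invariants ↔ ∀ h, α.act h z = counit (R := k) h • z := Iff.rfl

theorem act_invariant_mul {z : A} (hz : z ∈ α.invariants) (h : H) (a : A) :
    α.act h (z * a) = z * α.act h a := by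
  rw [α.act_mul (ℛ k h)]
  simp only [α.mem_invariants.1 hz, smul_mul_assoc, ← mul_smul_comm, ← Finset.mul_sum]
  congr 1
  have := congrArg (fun g => α.act g a) (sum_counit_smul (R := k) (ℛ k h))
  simpa using this

theorem act_mul_invariant {z : A} (hz : z ∈ α.invariants) (h : H) (a : A) :
    α.act h (a * z) = α.act h a * z := by
  rw [α.act_mul (ℛ k h)]
  simp only [α.mem_invariants.1 hz, mul_smul_comm, ← smul_mul_assoc, ← Finset.sum_mul]
  congr 1
  have h5 := sum_smul_counit (ℛ k h)
  have := congrArg (fun g => α.act g a) h5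
  simpa using this

end HopfAct

end ModuleAlgebra

/-! ### Deformations and their truncated localizations -/

/-- A flat one-parameter deformation of the commutative algebra `A₀`: an algebra `R` with a
central regular element `ℏ` and an isomorphism `R / ℏR ≃ A₀`. -/
structure Deformation (k R A₀ : Type*) [Field k] [Ring R] [Algebra k R] [CommRing A₀]
    [Algebra k A₀] where
  /-- the deformation parameter -/
  hbar : R
  comm : ∀ x, hbar * x = x * hbar
  reg : ∀ x, hbar * x = 0 → x = 0
  /-- the reduction -/
  red : R →ₐ[k] A₀
  red_surjective : Function.Surjective red
  red_eq_zero : ∀ x, red x = 0 ↔ ∃ y, x = hbar * y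

namespace Deformation

variable {k R A₀ : Type*} [Field k] [Ring R] [Algebra k R] [CommRing A₀]
  [Algebra k A₀] (D : Deformation k R A₀)

theorem hbar_pow_comm (n : ℕ) (x : R) : D.hbar ^ n * x = x * D.hbar ^ n :=
  (Commute.pow_left (D.comm x) n).eq

theorem hbar_pow_reg (n : ℕ) (x : R) (h : D.hbar ^ n * x = 0) : x = 0 := by
  induction n with
  | zero => simpa using h
  | succ n ih => exact ih (D.reg _ (by rw [← mul_assoc, ← pow_succ', h]))

theorem hbar_pow_cancel {n : ℕ} {x y : R} (h : D.hbar ^ n * x = D.hbar ^ n * y) : x = y :=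
  sub_eq_zero.1 (D.hbar_pow_reg n _ (by rw [mul_sub, h, sub_self]))

theorem red_hbar : D.red D.hbar = 0 := (D.red_eq_zero _).2 ⟨1, (mul_one _).symm⟩

theorem exists_commutator (x y : R) : ∃ w, x * y - y * x = D.hbar * w :=
  (D.red_eq_zero _).1 (by rw [map_sub, map_mul, map_mul, mul_comm, sub_self])

variable [IsDomain A₀]

/-- Since A₀ is a domain, an element with nonzero reduction is regular modulo ℏ; regularity of ℏ
then allows one factor of ℏ to be split off at a time. This makes the denominators regular modulo
every power of ℏ. -/
theorem dvd_of_mul_dvd {s r : R} (hs : D.red s ≠ 0) (n : ℕ) {y : R}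
    (h : s * r = D.hbar ^ n * y) : ∃ y', r = D.hbar ^ n * y' := by
  induction n generalizing y with
  | zero => exact ⟨r, by simp⟩
  | succ n ih =>
    obtain ⟨z, rfl⟩ := ih (y := D.hbar * y) (by rw [h, pow_succ, mul_assoc])
    have h1 : s * z = D.hbar * y := by
      refine D.hbar_pow_cancel (n := n) ?_
      rw [← mul_assoc, ← mul_assoc, D.hbar_pow_comm, mul_assoc, h, pow_succ]
    have h2 : D.red z = 0 := by
      have := congrArg D.red h1
      rw [map_mul, map_mul, D.red_hbar, zero_mul] at this
      exact (mul_eq_zero.1 this).resolve_left hs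
    obtain ⟨w, rfl⟩ := (D.red_eq_zero _).1 h2
    exact ⟨w, by rw [pow_succ, mul_assoc]⟩

theorem dvd_of_dvd_mul {s r : R} (hs : D.red s ≠ 0) (n : ℕ) {y : R}
    (h : r * s = D.hbar ^ n * y) : ∃ y', r = D.hbar ^ n * y' := by
  induction n generalizing y with
  | zero => exact ⟨r, by simp⟩
  | succ n ih =>
    obtain ⟨z, rfl⟩ := ih (y := D.hbar * y) (by rw [h, pow_succ, mul_assoc])
    have h1 : z * s = D.hbar * y := by
      refine D.hbar_pow_cancel (n := n) ?_
      rw [← mul_assoc, h, pow_succ, mul_assoc]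
    have h2 : D.red z = 0 := by
      have := congrArg D.red h1
      rw [map_mul, map_mul, D.red_hbar, zero_mul] at this
      exact (mul_eq_zero.1 this).resolve_right hs
    obtain ⟨w, rfl⟩ := (D.red_eq_zero _).1 h2
    exact ⟨w, by rw [pow_succ, mul_assoc]⟩

-- Moving s past an error term creates a commutator, which costs a factor ℏ. After n moves the error
-- lies in ℏⁿR, which is how the Ore condition arises in the truncations.
omit [IsDomain A₀] in
theorem exists_pow_mul_eq (r s : R) (n : ℕ) :
    ∃ r' e, s ^ n * r = r' * s + D.hbar ^ n * e := by
  induction n with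
  | zero => exact ⟨0, r, by simp⟩
  | succ n ih =>
    obtain ⟨r', e, h⟩ := ih
    obtain ⟨w, hw⟩ := D.exists_commutator s e
    refine ⟨s * r' + D.hbar ^ n * e, w, ?_⟩
    have h1 : s * e = e * s + D.hbar * w := by rw [← hw]; abel
    rw [pow_succ', mul_assoc, h, mul_add, ← mul_assoc s (D.hbar ^ n), ← D.hbar_pow_comm,
      mul_assoc _ s e, h1, add_mul, mul_add, pow_succ]
    simp only [mul_assoc]
    abel

/-- The ideal generated by `ℏⁿ⁺¹`. -/
def powIdeal (n : ℕ) : Ideal R := Ideal.span {D.hbar ^ (n + 1)}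

omit [IsDomain A₀] in
theorem mem_powIdeal {n : ℕ} {x : R} : x ∈ D.powIdeal n ↔ ∃ y, x = D.hbar ^ (n + 1) * y := by
  rw [powIdeal, Ideal.mem_span_singleton']
  exact ⟨fun ⟨a, h⟩ => ⟨a, by rw [hbar_pow_comm, h]⟩, fun ⟨a, h⟩ => ⟨a, by rw [h, hbar_pow_comm]⟩⟩

instance (n : ℕ) : (D.powIdeal n).IsTwoSided where
  mul_mem_of_left b ha := by
    obtain ⟨y, rfl⟩ := D.mem_powIdeal.1 ha
    exact D.mem_powIdeal.2 ⟨y * b, mul_assoc _ _ _⟩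

/-- The elements with nonzero reduction, modulo `ℏⁿ⁺¹`. -/
def denominators (n : ℕ) : Submonoid (R ⧸ D.powIdeal n) :=
  ((nonZeroDivisors A₀).comap D.red).map (Ideal.Quotient.mk (D.powIdeal n))

theorem mem_denominators {n : ℕ} {s : R ⧸ D.powIdeal n} :
    s ∈ D.denominators n ↔ ∃ s', D.red s' ≠ 0 ∧ Ideal.Quotient.mk (D.powIdeal n) s' = s := by
  simp [denominators, Submonoid.mem_map, mem_nonZeroDivisors_iff_ne_zero]

theorem exists_ore (n : ℕ) (r : R ⧸ D.powIdeal n) (s : D.denominators n) :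
    ∃ (r' : R ⧸ D.powIdeal n) (s' : D.denominators n), s' * r = r' * s := by
  obtain ⟨r, rfl⟩ := Ideal.Quotient.mk_surjective r
  obtain ⟨s, hs⟩ := s
  obtain ⟨s, hs0, rfl⟩ := D.mem_denominators.1 hs
  obtain ⟨r', e, h⟩ := D.exists_pow_mul_eq r s (n + 1)
  refine ⟨Ideal.Quotient.mk _ r', ⟨Ideal.Quotient.mk _ (s ^ (n + 1)),
    D.mem_denominators.2 ⟨_, ?_, rfl⟩⟩, ?_⟩
  · rw [map_pow]
    exact pow_ne_zero _ hs0
  · change Ideal.Quotient.mk _ (s ^ (n + 1)) * _ = _ * Ideal.Quotient.mk _ s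
    rw [← map_mul, ← map_mul, Ideal.Quotient.mk_eq_mk_iff_sub_mem, h, add_sub_cancel_left]
    exact D.mem_powIdeal.2 ⟨e, rfl⟩

noncomputable instance (n : ℕ) : OreLocalization.OreSet (D.denominators n) where
  ore_right_cancel r₁ r₂ s h := by
    refine ⟨1, ?_⟩
    obtain ⟨r₁, rfl⟩ := Ideal.Quotient.mk_surjective r₁
    obtain ⟨r₂, rfl⟩ := Ideal.Quotient.mk_surjective r₂
    obtain ⟨s, hs⟩ := s
    obtain ⟨s, hs0, rfl⟩ := D.mem_denominators.1 hs
    simp only at h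
    rw [← map_mul, ← map_mul, Ideal.Quotient.mk_eq_mk_iff_sub_mem, ← sub_mul] at h
    obtain ⟨y, hy⟩ := D.mem_powIdeal.1 h
    congr 1
    exact Ideal.Quotient.mk_eq_mk_iff_sub_mem _ _ |>.2
      (D.mem_powIdeal.2 (D.dvd_of_dvd_mul hs0 _ hy))
  oreNum r s := (D.exists_ore n r s).choose
  oreDenom r s := (D.exists_ore n r s).choose_spec.choose
  ore_eq r s := (D.exists_ore n r s).choose_spec.choose_spec

/-- The localization of `R / ℏⁿ⁺¹` at the elements with nonzero reduction. -/
def Loc (n : ℕ) : Type _ := OreLocalization (D.denominators n) (R ⧸ D.powIdeal n)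

noncomputable instance (n : ℕ) : Ring (D.Loc n) :=
  inferInstanceAs (Ring (OreLocalization (D.denominators n) (R ⧸ D.powIdeal n)))

noncomputable instance (n : ℕ) : Algebra k (D.Loc n) :=
  inferInstanceAs (Algebra k (OreLocalization (D.denominators n) (R ⧸ D.powIdeal n)))

/-- The canonical map from `R` to its truncated localization. -/
noncomputable def toLoc (n : ℕ) : R →ₐ[k] D.Loc n where
  toRingHom := (OreLocalization.numeratorRingHom (S := D.denominators n)).comp
    (Ideal.Quotient.mk (D.powIdeal n))
  commutes' _ := rfl

theorem toLoc_apply (n : ℕ) (r : R) : D.toLoc n r =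
    OreLocalization.oreDiv (Ideal.Quotient.mk (D.powIdeal n) r) (1 : D.denominators n) := rfl

theorem isUnit_toLoc {n : ℕ} {s : R} (hs : D.red s ≠ 0) : IsUnit (D.toLoc n s) :=
  OreLocalization.numerator_isUnit
    (⟨Ideal.Quotient.mk _ s, D.mem_denominators.2 ⟨s, hs, rfl⟩⟩ : D.denominators n)

theorem exists_toLoc_mul_eq {n : ℕ} (x : D.Loc n) :
    ∃ s r, D.red s ≠ 0 ∧ D.toLoc n s * x = D.toLoc n r := by
  induction x using OreLocalization.ind with
  | _ r s =>
    obtain ⟨r, rfl⟩ := Ideal.Quotient.mk_surjective r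
    obtain ⟨s, hs⟩ := s
    obtain ⟨s, hs0, rfl⟩ := D.mem_denominators.1 hs
    refine ⟨s, r, hs0, ?_⟩
    exact OreLocalization.mul_cancel (S := D.denominators n)
      (s := ⟨Ideal.Quotient.mk _ s, hs⟩) (t := 1)

/-- The denominators are already regular in the quotient by ℏⁿ⁺¹, so localizing enlarges no kernel.
The index is shifted: level 0 is the localization of R/ℏ. -/
theorem toLoc_eq_zero {n : ℕ} {r : R} :
    D.toLoc n r = 0 ↔ ∃ y, r = D.hbar ^ (n + 1) * y := by
  rw [← D.mem_powIdeal, ← Ideal.Quotient.eq_zero_iff_mem]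
  refine ⟨fun h => ?_, fun h => ?_⟩
  · have h0 : OreLocalization.oreDiv (Ideal.Quotient.mk (D.powIdeal n) r)
        (1 : D.denominators n) = OreLocalization.oreDiv 0 1 := by
      rw [OreLocalization.zero_oreDiv]; exact h
    obtain ⟨u, v, h1, h2⟩ := OreLocalization.oreDiv_eq_iff.1 h0
    obtain ⟨u, hu⟩ := u
    obtain ⟨u, hu0, rfl⟩ := D.mem_denominators.1 hu
    simp only [smul_zero, OneMemClass.coe_one, mul_one] at h1 h2
    rw [← h2] at h1
    change _ = Ideal.Quotient.mk _ u * _ at h1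
    rw [← map_mul, eq_comm, Ideal.Quotient.eq_zero_iff_mem] at h1
    obtain ⟨y, hy⟩ := D.mem_powIdeal.1 h1
    exact Ideal.Quotient.eq_zero_iff_mem.2 (D.mem_powIdeal.2 (D.dvd_of_mul_dvd hu0 _ hy))
  · rw [toLoc_apply, h]
    exact OreLocalization.zero_oreDiv _

/-- The universal property of the truncated localization. -/
theorem exists_locLift {B : Type*} [Ring B] [Algebra k B] {n : ℕ} (f : R →ₐ[k] B)
    (h0 : f (D.hbar ^ (n + 1)) = 0) (hu : ∀ s, D.red s ≠ 0 → IsUnit (f s)) :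
    ∃ g : D.Loc n →ₐ[k] B, ∀ r, g (D.toLoc n r) = f r := by
  have hI : ∀ a ∈ D.powIdeal n, (f : R →+* B) a = 0 := fun a ha => by
    obtain ⟨y, rfl⟩ := D.mem_powIdeal.1 ha
    rw [map_mul]
    exact mul_eq_zero_of_left h0 _
  let f' : R ⧸ D.powIdeal n →+* B := Ideal.Quotient.lift (D.powIdeal n) (f : R →+* B) hI
  have hu' : ∀ s : D.denominators n, IsUnit ((f' : _ →* B).comp (D.denominators n).subtype s) := by
    rintro ⟨s, hs⟩
    obtain ⟨s, hs0, rfl⟩ := D.mem_denominators.1 hs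
    exact hu s hs0
  let g : D.Loc n →+* B := OreLocalization.universalHom f' (IsUnit.liftRight _ hu')
    (fun s => (IsUnit.coe_liftRight _ hu' s).symm)
  have hg : ∀ r, g (D.toLoc n r) = f r := fun r =>
    OreLocalization.universalHom_commutes f' _ _ 
  refine ⟨{ g with commutes' := fun c => ?_ }, hg⟩
  change g (algebraMap k (D.Loc n) c) = _
  rw [← (D.toLoc n).commutes c, hg, AlgHom.commutes]

theorem loc_hom_ext {B : Type*} [Ring B] [Algebra k B] {n : ℕ} {f g : D.Loc n →ₐ[k] B}
    (h : ∀ r, f (D.toLoc n r) = g (D.toLoc n r)) : f = g := by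
  ext x
  obtain ⟨s, r, hs, hx⟩ := D.exists_toLoc_mul_eq x
  refine ((D.isUnit_toLoc (n := n) hs).map f).mul_left_cancel ?_
  rw [← map_mul, hx, h, h, ← map_mul, hx]

end Deformation

/-! ### Extending a Hopf action to the truncated localizations -/

section ConvolutionLemmas

open Coalgebra WithConv

variable {k H B : Type*} [Field k] [Ring H] [HopfAlgebra k H] [Ring B] [Algebra k B]

/-- The map `f ↦ (h ↦ g ↦ f (g h))` on convolution algebras. -/
noncomputable def convMulMap (k H B : Type*) [Field k] [Ring H] [HopfAlgebra k H] [Ring B]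
    [Algebra k B] :
    WithConv (H →ₗ[k] B) →ₐ[k] WithConv (H →ₗ[k] WithConv (H →ₗ[k] B)) :=
  AlgHom.ofLinearMap
    { toFun := fun f => toConv
        { toFun := fun h => toConv (f.ofConv ∘ₗ LinearMap.mulRight k h)
          map_add' := fun g h => by ext; simp [mul_add]
          map_smul' := fun c h => by ext; simp }
      map_add' := fun f g => by ext; simp
      map_smul' := fun c h => by ext; simp }
    (by
      ext h g
      change algebraMap k B (counit (R := k) (g * h)) =
        counit (R := k) h • algebraMap k B (counit (R := k) g)
      rw [Bialgebra.counit_mul, mul_comm, map_mul, Algebra.smul_def])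
    (fun u v => by
      ext h g
      change (u * v) (g * h) = (_ * _ : WithConv (H →ₗ[k] WithConv (H →ₗ[k] B))) h g
      rw [(ℛ k h).convMul_apply, LinearMap.convMul_apply, Bialgebra.comul_mul, ← (ℛ k h).eq,
        ← (ℛ k g).eq, Finset.sum_mul_sum, Finset.sum_comm]
      simp only [map_sum, Algebra.TensorProduct.tmul_mul_tmul, TensorProduct.map_tmul,
        LinearMap.mul'_apply, WithConv.ofConv_sum, LinearMap.sum_apply]
      refine Finset.sum_congr rfl fun j _ => ?_
      exact ((ℛ k g).convMul_apply (toConv (u.ofConv ∘ₗ LinearMap.mulRight k ((ℛ k h).left j)))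
        (toConv (v.ofConv ∘ₗ LinearMap.mulRight k ((ℛ k h).right j)))).symm)

/-- If y lifts the inverse, then xy and yx are each 1 plus a nilpotent, so x has inverses on both
sides. -/
theorem isUnit_of_map_isUnit {B C : Type*} [Ring B] [Ring C] (f : B →+* C)
    (hf : Function.Surjective f) (hker : ∀ x, f x = 0 → IsNilpotent x) {x : B}
    (hx : IsUnit (f x)) : IsUnit x := by
  obtain ⟨u, hu⟩ := hx
  obtain ⟨y, hy⟩ := hf (↑u⁻¹ : C)
  have h1 : IsUnit (x * y) := by
    have := (hker (x * y - 1) (by simp [hy, ← hu])).isUnit_add_one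
    simpa using this
  have h2 : IsUnit (y * x) := by
    have := (hker (y * x - 1) (by simp [hy, ← hu])).isUnit_add_one
    simpa using this
  obtain ⟨a, ha⟩ := h1.exists_right_inv
  obtain ⟨b, hb⟩ := h2.exists_left_inv
  exact isUnit_iff_exists_and_exists.2 ⟨⟨y * a, by rw [← mul_assoc, ha]⟩,
    ⟨b * y, by rw [mul_assoc, hb]⟩⟩

end ConvolutionLemmas

/-! ### Invertibility of coactions of denominators -/

namespace HopfAct

open Coalgebra WithConv

variable {k H A : Type*} [Field k] [Ring H] [HopfAlgebra k H] [Ring A] [Algebra k A]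
  (α : HopfAct k H A)

/-- If `s` is left regular in `A` then so is its image under the coaction. -/
theorem coact_mul_eq_zero {s : A} (hs : ∀ x, s * x = 0 → x = 0) {u : WithConv (H →ₗ[k] A)}
    (hu : α.coact s * u = 0) : u = 0 := by
  let M : A →ₐ[k] Module.End k A := Algebra.lmul k A
  let ℓ : WithConv (H →ₗ[k] A) →ₐ[k] WithConv (H →ₗ[k] Module.End k A) := convPostcomp H M
  let a : WithConv (H →ₗ[k] Module.End k A) := convPostcomp H α.act (toConv LinearMap.id)
  let a' : WithConv (H →ₗ[k] Module.End k A) :=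
    convPostcomp H α.act (toConv (HopfAlgebra.antipode k))
  let c : WithConv (H →ₗ[k] Module.End k A) :=
    toConv ((LinearMap.toSpanSingleton k _ (M s)) ∘ₗ counit)
  have haa : a * a' = 1 := by
    rw [← map_mul, LinearMap.id_mul_antipode, map_one]
  have haa' : a' * a = 1 := by
    rw [← map_mul, LinearMap.antipode_mul_id, map_one]
  -- Multiplication by the coaction of s is conjugate, through the action itself (a convolution unit
  -- with inverse the action composed with the antipode), to the constant function `c` given by
  -- multiplication by s. Regularity of s thus passes to its coaction.
  have hconj : ℓ (α.coact s) * a = a * c := by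
    ext h x
    rw [(ℛ k h).convMul_apply, (ℛ k h).convMul_apply]
    have h1 : ∀ i, (a ((ℛ k h).left i) * c ((ℛ k h).right i)) =
        α.act (counit (R := k) ((ℛ k h).right i) • (ℛ k h).left i) * M s := fun i => by
      change α.act ((ℛ k h).left i) * (counit (R := k) ((ℛ k h).right i) • M s) = _
      rw [map_smul α.act, smul_mul_assoc, mul_smul_comm]
    simp only [h1, ← Finset.sum_mul, ← map_sum, sum_smul_counit]
    rw [Module.End.mul_apply]
    change _ = α.act h (s * x)
    rw [α.act_mul (ℛ k h), LinearMap.sum_apply]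
    rfl
  have h1 : ℓ (α.coact s) = a * c * a' := by rw [← hconj, mul_assoc, haa, mul_one]
  have h2 : c * (a' * ℓ u) = 0 := by
    have h3 := congrArg ℓ hu
    rw [map_mul, h1, map_zero] at h3
    have := congrArg (a' * ·) h3
    simp only [mul_zero] at this
    rw [← mul_assoc, ← mul_assoc, ← mul_assoc, haa', one_mul, mul_assoc] at this
    exact this
  have h3 : a' * ℓ u = 0 := by
    ext h x
    refine hs _ ?_
    have h4 : (c * (a' * ℓ u)) h x = 0 := by rw [h2]; rfl
    rw [(ℛ k h).convMul_apply] at h4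
    have h5 : ∀ i, c ((ℛ k h).left i) * (a' * ℓ u) ((ℛ k h).right i) =
        M s * (a' * ℓ u) (counit (R := k) ((ℛ k h).left i) • (ℛ k h).right i) := fun i => by
      change (counit (R := k) ((ℛ k h).left i) • M s) * (a' * ℓ u).ofConv ((ℛ k h).right i) = _
      rw [map_smul (a' * ℓ u).ofConv, smul_mul_assoc, mul_smul_comm]
    simp only [h5, ← Finset.mul_sum, ← map_sum, sum_counit_smul] at h4
    exact h4
  have h4 : ℓ u = 0 := by
    rw [← one_mul (ℓ u), ← haa, mul_assoc, h3, mul_zero]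
  ext h
  have := congrArg (fun v : WithConv (H →ₗ[k] Module.End k A) => v h 1) h4
  simpa [ℓ, convPostcomp_apply, M] using this

/-- There is no action on Q yet, so left regularity is proved over A₀ and carried to Q by clearing
the denominators of a function on the finite dimensional H. An injective endomorphism of a finite
dimensional Q-space is surjective, which provides a right inverse; regularity makes it two-sided. -/
theorem isUnit_coact {A₀ Q : Type*} [CommRing A₀] [IsDomain A₀] [Algebra k A₀] [Field Q]
    [Algebra A₀ Q] [IsFractionRing A₀ Q] [Algebra k Q] [IsScalarTower k A₀ Q]
    [FiniteDimensional k H] (β : HopfAct k H A₀) {s : A₀} (hs : s ≠ 0) :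
    IsUnit (convPostcomp H (IsScalarTower.toAlgHom k A₀ Q) (β.coact s)) := by
  set ι := IsScalarTower.toAlgHom k A₀ Q
  have hι : Function.Injective ι := IsFractionRing.injective A₀ Q
  set ρ := convPostcomp H ι (β.coact s)
  have hreg : ∀ u : WithConv (H →ₗ[k] Q), ρ * u = 0 → u = 0 := fun u hu => by
    let b := Module.finBasis k H
    obtain ⟨⟨t, ht⟩, hb⟩ := IsLocalization.exist_integer_multiples_of_finite
      (nonZeroDivisors A₀) (fun i => u (b i))
    choose v hv using hb
    let u' : WithConv (H →ₗ[k] A₀) := toConv (b.constr k v)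
    have hu' : convPostcomp H ι u' = ι t • u := by
      ext h
      have : (ι.toLinearMap ∘ₗ b.constr k v) = ι t • u.ofConv := b.ext fun i => by
        rw [LinearMap.comp_apply, Module.Basis.constr_basis]
        exact (hv i).trans (Algebra.smul_def _ _)
      exact congrArg (fun f => f h) this
    have h0 : u' = 0 := by
      refine β.coact_mul_eq_zero (fun x hx => (mul_eq_zero.1 hx).resolve_left hs) ?_
      have : convPostcomp H ι (β.coact s * u') = 0 := by
        rw [map_mul, hu', mul_smul_comm]
        exact (congrArg _ hu).trans (smul_zero _)
      ext h
      refine hι ?_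
      exact (congrArg (fun v : WithConv (H →ₗ[k] Q) => v h) this).trans (map_zero ι).symm
    rw [h0, map_zero] at hu'
    refine (smul_eq_zero.1 hu'.symm).resolve_left ?_
    rw [← map_zero ι]
    exact fun h => nonZeroDivisors.ne_zero ht (hι h)
  have : Module.Finite Q (WithConv (H →ₗ[k] Q)) :=
    Module.Finite.equiv (WithConv.linearEquiv Q (H →ₗ[k] Q)).symm
  have hinj : Function.Injective (LinearMap.mulLeft Q ρ) :=
    (injective_iff_map_eq_zero _).2 hreg
  obtain ⟨v, hv⟩ := LinearMap.surjective_of_injective hinj 1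
  simp only [LinearMap.mulLeft_apply] at hv
  refine isUnit_iff_exists.2 ⟨v, hv, ?_⟩
  rw [← sub_eq_zero]
  refine hreg _ ?_
  rw [mul_sub, ← mul_assoc, hv, one_mul, mul_one, sub_self]

end HopfAct

/-! ### Truncated localizations over the fraction field and the extended action -/

namespace Deformation

open Coalgebra WithConv

variable {k R A₀ : Type*} [Field k] [Ring R] [Algebra k R] [CommRing A₀]
  [Algebra k A₀] (D : Deformation k R A₀) [IsDomain A₀]
  (Q : Type*) [Field Q] [Algebra A₀ Q] [IsFractionRing A₀ Q] [Algebra k Q] [IsScalarTower k A₀ Q]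

theorem toLoc_hbar_pow (n : ℕ) : D.toLoc n D.hbar ^ (n + 1) = 0 := by
  rw [← map_pow]
  exact D.toLoc_eq_zero.2 ⟨1, (mul_one _).symm⟩

theorem toLoc_hbar_comm {n : ℕ} (x : D.Loc n) : D.toLoc n D.hbar * x = x * D.toLoc n D.hbar := by
  obtain ⟨s, r, hs, hx⟩ := D.exists_toLoc_mul_eq x
  refine (D.isUnit_toLoc (n := n) hs).mul_left_cancel ?_
  rw [← mul_assoc, ← mul_assoc, hx, ← map_mul, ← D.comm, map_mul, mul_assoc, hx, ← map_mul,
    D.comm, map_mul]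

theorem exists_locRed (n : ℕ) : ∃ f : D.Loc n →ₐ[k] Q,
    ∀ r, f (D.toLoc n r) = algebraMap A₀ Q (D.red r) := by
  obtain ⟨f, hf⟩ := D.exists_locLift (n := n) ((IsScalarTower.toAlgHom k A₀ Q).comp D.red)
    (by rw [map_pow]; simp [D.red_hbar]) (fun s hs => by
      refine IsUnit.mk0 _ ?_
      exact (map_ne_zero_iff _ (IsFractionRing.injective A₀ Q)).2 hs)
  exact ⟨f, hf⟩

/-- The reduction of the truncated localization. -/
noncomputable def locRed (n : ℕ) : D.Loc n →ₐ[k] Q := (D.exists_locRed Q n).choose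

theorem locRed_toLoc {n : ℕ} (r : R) :
    D.locRed Q n (D.toLoc n r) = algebraMap A₀ Q (D.red r) := (D.exists_locRed Q n).choose_spec r

theorem locRed_surjective (n : ℕ) : Function.Surjective (D.locRed Q n) := fun q => by
  obtain ⟨a, s, hs, rfl⟩ := IsFractionRing.div_surjective (A := A₀) q
  obtain ⟨a, rfl⟩ := D.red_surjective a
  obtain ⟨s, rfl⟩ := D.red_surjective s
  have hs0 : D.red s ≠ 0 := nonZeroDivisors.ne_zero hs
  obtain ⟨u, hu⟩ := D.isUnit_toLoc (n := n) hs0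
  refine ⟨↑u⁻¹ * D.toLoc n a, ?_⟩
  rw [eq_div_iff ((map_ne_zero_iff _ (IsFractionRing.injective A₀ Q)).2 hs0), ← D.locRed_toLoc,
    ← D.locRed_toLoc, mul_comm, ← map_mul, ← mul_assoc, ← hu, Units.mul_inv, one_mul]

theorem locRed_eq_zero {n : ℕ} {x : D.Loc n} (hx : D.locRed Q n x = 0) :
    ∃ y, x = D.toLoc n D.hbar * y := by
  obtain ⟨s, r, hs, h⟩ := D.exists_toLoc_mul_eq x
  have h0 : D.red r = 0 := by
    refine IsFractionRing.injective A₀ Q ?_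
    rw [← D.locRed_toLoc, ← h, map_mul, hx, mul_zero, map_zero]
  obtain ⟨r, rfl⟩ := (D.red_eq_zero r).1 h0
  obtain ⟨u, hu⟩ := D.isUnit_toLoc (n := n) hs
  refine ⟨↑u⁻¹ * D.toLoc n r, u.isUnit.mul_left_cancel ?_⟩
  rw [hu, h, map_mul, ← mul_assoc, ← toLoc_hbar_comm, mul_assoc, ← hu, Units.mul_inv_cancel_left]

/-- The kernel of the reduction is generated by the central nilpotent ℏ, so units of Q lift. -/
theorem isUnit_of_locRed_ne_zero {n : ℕ} {x : D.Loc n} (hx : D.locRed Q n x ≠ 0) : IsUnit x := by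
  refine isUnit_of_map_isUnit (D.locRed Q n : D.Loc n →+* Q) (D.locRed_surjective Q n)
    (fun y hy => ?_) (IsUnit.mk0 _ hx)
  obtain ⟨z, rfl⟩ := D.locRed_eq_zero Q hy
  refine ⟨n + 1, ?_⟩
  rw [Commute.mul_pow (D.toLoc_hbar_comm z), toLoc_hbar_pow, zero_mul]

variable {H : Type*} [Ring H] [HopfAlgebra k H] (α : HopfAct k H R)

section

variable {α} 

/-- Reduction modulo ℏ turns this coaction into that of a nonzero element of A₀, a unit by
`isUnit_coact`. Functions with zero reduction are nilpotent for convolution, so the unit lifts. -/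
theorem isUnit_coact_toLoc [FiniteDimensional k H] (hα : D.hbar ∈ α.invariants) {n : ℕ} {s : R}
    (hs : D.red s ≠ 0) : IsUnit (convPostcomp H (D.toLoc n) (α.coact s)) := by
  obtain ⟨β, hβ⟩ := α.exists_descend D.red D.red_surjective (fun h a ha => by
    obtain ⟨y, rfl⟩ := (D.red_eq_zero a).1 ha
    rw [α.act_invariant_mul hα]
    exact (D.red_eq_zero _).2 ⟨_, rfl⟩)
  have hu := β.isUnit_coact (Q := FractionRing A₀) hs
  let f := convPostcomp H (D.locRed (FractionRing A₀) n)
  have hf : f (convPostcomp H (D.toLoc n) (α.coact s)) =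
      convPostcomp H (IsScalarTower.toAlgHom k A₀ (FractionRing A₀)) (β.coact (D.red s)) := by
    ext h
    change D.locRed _ n (D.toLoc n (α.act h s)) = algebraMap _ _ (β.act h (D.red s))
    rw [locRed_toLoc, hβ]
  refine isUnit_of_map_isUnit f.toRingHom (fun v => ?_) (fun u hu => ?_)
    (show IsUnit (f _) from hf ▸ hu)
  · obtain ⟨g, hg⟩ := (D.locRed (FractionRing A₀) n).toLinearMap.exists_rightInverse_of_surjective
      (LinearMap.range_eq_top.2 (D.locRed_surjective (FractionRing A₀) n))
    refine ⟨toConv (g ∘ₗ v.ofConv), ?_⟩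
    ext h
    exact congrArg (fun f => f (v h)) hg
  · have h1 : ∀ h, ∃ y, u h = D.toLoc n D.hbar * y := fun h =>
      D.locRed_eq_zero (FractionRing A₀)
        (congrArg (fun v : WithConv (H →ₗ[k] FractionRing A₀) => v h) hu)
    -- Each value of u is divisible by the central ℏ, so each value of its m-th convolution power is
    -- divisible by ℏᵐ.
    have h2 : ∀ m h, ∃ y, (u ^ m) h = D.toLoc n D.hbar ^ m * y := fun m => by
      induction m with
      | zero => exact fun h => ⟨(u ^ 0) h, by simp⟩
      | succ m ih =>
        intro h
        choose y hy using h1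
        choose z hz using ih
        refine ⟨∑ i ∈ (ℛ k h).index, z ((ℛ k h).left i) * y ((ℛ k h).right i), ?_⟩
        rw [pow_succ, (ℛ k h).convMul_apply, Finset.mul_sum]
        refine Finset.sum_congr rfl fun i _ => ?_
        rw [hy, hz, mul_assoc, ← mul_assoc (z _), ← toLoc_hbar_comm, pow_succ]
        simp only [mul_assoc]
    refine ⟨n + 1, ?_⟩
    ext h
    obtain ⟨y, hy⟩ := h2 (n + 1) h
    rw [hy, toLoc_hbar_pow, zero_mul]
    rfl

/-- The action of `H` extends to the truncated localizations. -/
theorem exists_locAct [FiniteDimensional k H] (hα : D.hbar ∈ α.invariants) (n : ℕ) :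
    ∃ β : HopfAct k H (D.Loc n), ∀ h r, β.act h (D.toLoc n r) = D.toLoc n (α.act h r) := by
  obtain ⟨ρ, hρ⟩ := D.exists_locLift (n := n) ((convPostcomp H (D.toLoc n)).comp α.coact)
    (by
      ext h
      change D.toLoc n (α.act h (D.hbar ^ (n + 1))) = 0
      rw [α.mem_invariants.1 (pow_mem hα _), map_smul, map_pow, toLoc_hbar_pow, smul_zero])
    (fun s hs => D.isUnit_coact_toLoc hα hs)
  have hρ' : ∀ r h, ρ (D.toLoc n r) h = D.toLoc n (α.act h r) := fun r h =>
    congrArg (fun v : WithConv (H →ₗ[k] D.Loc n) => v h) (hρ r)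
  refine ⟨HopfAct.ofCoact ρ (fun x => ?_) (fun x g h => ?_), fun h r => hρ' r h⟩
  · obtain ⟨s, r, hs, hx⟩ := D.exists_toLoc_mul_eq x
    refine (D.isUnit_toLoc (n := n) hs).mul_left_cancel ?_
    have h1 : ∀ x y, ρ (x * y) 1 = ρ x 1 * ρ y 1 := fun x y => by
      rw [map_mul, LinearMap.convMul_apply, Bialgebra.comul_one, Algebra.TensorProduct.one_def,
        TensorProduct.map_tmul, LinearMap.mul'_apply]
    have h2 : ∀ r, ρ (D.toLoc n r) 1 = D.toLoc n r := fun r => by rw [hρ', map_one]; rfl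
    have h3 := h1 (D.toLoc n s) x
    rw [hx, h2, h2] at h3
    rw [hx, ← h3]
  -- Associativity of the action is stated as equality of two algebra homomorphisms out of the
  -- localization, so it needs checking only on the image of R.
  · have : (convMulMap k H (D.Loc n)).comp ρ = (convPostcomp H ρ).comp ρ :=
      D.loc_hom_ext fun r => by
        ext h g
        change ρ (D.toLoc n r) (g * h) = ρ (ρ (D.toLoc n r) h) g
        rw [hρ', hρ', hρ', map_mul]
        rfl
    exact congrArg (fun f : D.Loc n →ₐ[k] WithConv (H →ₗ[k] WithConv (H →ₗ[k] D.Loc n)) =>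
      f x h g) this

end

end Deformation

/-! ### The completed localization -/

namespace HopfAct

open Coalgebra WithConv

variable {k H A : Type*} [Field k] [Ring H] [HopfAlgebra k H] [Ring A] [Algebra k A]

/-- The action on a subalgebra of a product of module algebras. -/
theorem exists_act_of_pi {J : Type*} {B : J → Type*} [∀ j, Ring (B j)] [∀ j, Algebra k (B j)]
    (β : ∀ j, HopfAct k H (B j)) (L : Subalgebra k (∀ j, B j))
    (hL : ∀ h, ∀ x ∈ L, (fun j => (β j).act h (x j)) ∈ L) :
    ∃ γ : HopfAct k H L, ∀ h x j, (γ.act h x : ∀ j, B j) j = (β j).act h (x.1 j) := by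
  let act : H →ₐ[k] Module.End k L := AlgHom.ofLinearMap
    { toFun := fun h =>
        { toFun := fun x => ⟨fun j => (β j).act h (x.1 j), hL h _ x.2⟩
          map_add' := fun x y => by ext j; simp
          map_smul' := fun c x => by ext j; simp }
      map_add' := fun g h => by ext x j; simp
      map_smul' := fun c h => by ext x j; simp }
    (by ext x j; simp) (fun g h => by ext x j; simp)
  refine ⟨⟨act, fun h x y => ?_, fun h => ?_⟩, fun h x j => rfl⟩
  · rw [← (ℛ k h).eq]
    simp only [map_sum, TensorProduct.map_tmul, LinearMap.mul'_apply]
    ext j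
    rw [AddSubmonoidClass.coe_finsetSum, Finset.sum_apply]
    exact (β j).act_mul (ℛ k h) _ _
  · ext j
    exact (β j).act_one h

end HopfAct

namespace Deformation

variable {k R A₀ : Type*} [Field k] [Ring R] [Algebra k R] [CommRing A₀]
  [Algebra k A₀] (D : Deformation k R A₀) [IsDomain A₀]
  (Q : Type*) [Field Q] [Algebra A₀ Q] [IsFractionRing A₀ Q] [Algebra k Q] [IsScalarTower k A₀ Q]

theorem exists_locTrans (n : ℕ) : ∃ f : D.Loc (n + 1) →ₐ[k] D.Loc n,
    ∀ r, f (D.toLoc (n + 1) r) = D.toLoc n r := by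
  refine D.exists_locLift (D.toLoc n) ?_ (fun s hs => D.isUnit_toLoc hs)
  rw [map_pow, pow_succ, toLoc_hbar_pow, zero_mul]

/-- The transition map between truncated localizations. -/
noncomputable def locTrans (n : ℕ) : D.Loc (n + 1) →ₐ[k] D.Loc n := (D.exists_locTrans n).choose

theorem locTrans_toLoc {n : ℕ} (r : R) : D.locTrans n (D.toLoc (n + 1) r) = D.toLoc n r :=
  (D.exists_locTrans n).choose_spec r

theorem locTrans_surjective (n : ℕ) : Function.Surjective (D.locTrans n) := fun x => by
  obtain ⟨s, r, hs, hx⟩ := D.exists_toLoc_mul_eq x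
  obtain ⟨u, hu⟩ := D.isUnit_toLoc (n := n + 1) hs
  refine ⟨↑u⁻¹ * D.toLoc (n + 1) r, (D.isUnit_toLoc (n := n) hs).mul_left_cancel ?_⟩
  rw [hx, ← D.locTrans_toLoc s, ← map_mul, ← hu, Units.mul_inv_cancel_left, locTrans_toLoc]

/-- In a truncation ℏ is a zero divisor, but only by one level: what it annihilates disappears one
step down. This becomes regularity of ℏ in the limit. -/
theorem locTrans_eq_zero {n : ℕ} {x : D.Loc (n + 1)} (hx : D.toLoc (n + 1) D.hbar * x = 0) :
    D.locTrans n x = 0 := by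
  obtain ⟨s, r, hs, h⟩ := D.exists_toLoc_mul_eq x
  have h1 : D.toLoc (n + 1) (D.hbar * r) = 0 := by
    rw [map_mul, ← h, ← mul_assoc, D.toLoc_hbar_comm, mul_assoc, hx, mul_zero]
  obtain ⟨y, hy⟩ := D.toLoc_eq_zero.1 h1
  have h2 : D.toLoc n r = 0 := D.toLoc_eq_zero.2
    ⟨y, D.hbar_pow_cancel (n := 1) (by rw [pow_one, hy, ← mul_assoc, ← pow_succ'])⟩
  refine (D.isUnit_toLoc (n := n) hs).mul_left_cancel ?_
  rw [mul_zero, ← D.locTrans_toLoc s, ← map_mul, h, locTrans_toLoc, h2]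

theorem locRed_locTrans {n : ℕ} (x : D.Loc (n + 1)) :
    D.locRed Q n (D.locTrans n x) = D.locRed Q (n + 1) x := by
  have : (D.locRed Q n).comp (D.locTrans n) = D.locRed Q (n + 1) := D.loc_hom_ext fun r => by
    rw [AlgHom.comp_apply, locTrans_toLoc, locRed_toLoc, locRed_toLoc]
  exact congrArg (fun f : D.Loc (n + 1) →ₐ[k] Q => f x) this

/-- The inverse limit of the truncated localizations. -/
noncomputable def completion : Subalgebra k (∀ n, D.Loc n) where
  carrier := {x | ∀ n, D.locTrans n (x (n + 1)) = x n}
  mul_mem' hx hy n := by rw [Pi.mul_apply, map_mul, hx, hy]; rfl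
  add_mem' hx hy n := by rw [Pi.add_apply, map_add, hx, hy]; rfl
  algebraMap_mem' c n := by simp

/-- The canonical map to the completed localization. -/
noncomputable def toCompletion : R →ₐ[k] D.completion :=
  (AlgHom.pi fun n => D.toLoc n).codRestrict D.completion fun _ _ => D.locTrans_toLoc _

theorem locRed_completion (x : D.completion) (n : ℕ) :
    D.locRed Q n (x.1 n) = D.locRed Q 0 (x.1 0) := by
  induction n with
  | zero => rfl
  | succ n ih => rw [← ih, ← locRed_locTrans, x.2]

theorem completion_hbar_mul_apply (x : D.completion) (n : ℕ) :
    (D.toCompletion D.hbar * x).1 n = D.toLoc n D.hbar * x.1 n := rfl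

theorem exists_completion_of_locRed (q : Q) :
    ∃ x : D.completion, D.locRed Q 0 (x.1 0) = q := by
  obtain ⟨x0, hx0⟩ := D.locRed_surjective Q 0 q
  let f : ∀ n, D.Loc n := fun n => Nat.rec (motive := fun n => D.Loc n) x0
    (fun n x => Function.surjInv (D.locTrans_surjective n) x) n
  exact ⟨⟨f, fun n => Function.surjInv_eq (D.locTrans_surjective n) (f n)⟩, hx0⟩

/-- The completed localization is a deformation of the fraction field. -/
noncomputable def completionDeformation : Deformation k D.completion Q where
  hbar := D.toCompletion D.hbar
  comm x := by
    ext n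
    exact D.toLoc_hbar_comm (x.1 n)
  reg x hx := by
    ext n
    have := D.locTrans_eq_zero (n := n) (x := x.1 (n + 1))
      (congrArg (fun y : D.completion => y.1 (n + 1)) hx)
    rw [x.2] at this
    exact this
  red := ((D.locRed Q 0).comp (Pi.evalAlgHom k _ 0)).comp D.completion.val
  red_surjective := D.exists_completion_of_locRed Q
  red_eq_zero x := by
    constructor
    · intro hx
      have h1 : ∀ n, ∃ y, x.1 n = D.toLoc n D.hbar * y := fun n =>
        D.locRed_eq_zero Q (by rw [locRed_completion]; exact hx)
      choose y hy using h1
      -- The quotients by ℏ chosen at the various levels need not be compatible, as each is unique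
      -- only up to the annihilator of ℏ. Pushing each one level down removes the ambiguity.
      refine ⟨⟨fun n => D.locTrans n (y (n + 1)), fun n => ?_⟩, ?_⟩
      · rw [← sub_eq_zero, ← map_sub]
        refine D.locTrans_eq_zero ?_
        rw [mul_sub, ← D.locTrans_toLoc, ← map_mul, ← hy, x.2, hy, locTrans_toLoc, sub_self]
      · ext n
        rw [completion_hbar_mul_apply, ← D.locTrans_toLoc, ← map_mul, ← hy, x.2]
    · rintro ⟨y, rfl⟩
      change D.locRed Q 0 (D.toLoc 0 D.hbar * y.1 0) = 0
      rw [map_mul, locRed_toLoc, red_hbar, map_zero, zero_mul]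

theorem completion_red_apply (x : D.completion) (n : ℕ) :
    (D.completionDeformation Q).red x = D.locRed Q n (x.1 n) := (D.locRed_completion Q x n).symm

theorem completion_red_toCompletion (r : R) :
    (D.completionDeformation Q).red (D.toCompletion r) = algebraMap A₀ Q (D.red r) :=
  D.locRed_toLoc Q r

theorem completion_isUnit {x : D.completion} (hx : (D.completionDeformation Q).red x ≠ 0) :
    IsUnit x := by
  have h1 : ∀ n, IsUnit (x.1 n) := fun n => D.isUnit_of_locRed_ne_zero Q (by
    rw [← completion_red_apply]; exact hx)
  choose u hu using h1
  have h2 : ∀ n, D.locTrans n ↑(u (n + 1))⁻¹ = (↑(u n)⁻¹ : D.Loc n) := fun n => by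
    refine (u n).isUnit.mul_left_cancel ?_
    rw [Units.mul_inv, hu, ← x.2, ← map_mul, ← hu, Units.mul_inv, map_one]
  refine isUnit_iff_exists.2 ⟨⟨fun n => ↑(u n)⁻¹, h2⟩, ?_, ?_⟩
  · ext n
    change x.1 n * ↑(u n)⁻¹ = 1
    rw [← hu, Units.mul_inv]
  · ext n
    change ↑(u n)⁻¹ * x.1 n = 1
    rw [← hu, Units.inv_mul]

/-- An element divisible by every power of ℏ vanishes in each truncation, so the ℏ-adic valuation of
a nonzero element is finite. -/
theorem completion_exists_pow_mul {x : D.completion} (hx : x ≠ 0) :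
    ∃ n y, x = (D.completionDeformation Q).hbar ^ n * y ∧
      (D.completionDeformation Q).red y ≠ 0 := by
  by_contra! h
  have h1 : ∀ n, ∃ y, x = (D.completionDeformation Q).hbar ^ n * y := fun n => by
    induction n with
    | zero => exact ⟨x, by simp⟩
    | succ n ih =>
      obtain ⟨y, hy⟩ := ih
      obtain ⟨z, rfl⟩ := ((D.completionDeformation Q).red_eq_zero y).1 (h n y hy)
      exact ⟨z, by rw [hy, pow_succ, mul_assoc]⟩
  refine hx ?_
  ext n
  obtain ⟨y, rfl⟩ := h1 (n + 1)
  change D.toLoc n D.hbar ^ (n + 1) * y.1 n = 0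
  rw [toLoc_hbar_pow, zero_mul]

/-- Divisibility by ℏⁿ⁺¹ is visible in the truncation of index n, where the kernel from R is exactly
ℏⁿ⁺¹R. This brings divisibility found in the completion back to R. -/
theorem exists_of_toCompletion_eq {r : R} {n : ℕ} {y : D.completion}
    (h : D.toCompletion r = (D.completionDeformation Q).hbar ^ n * y) :
    ∃ y', r = D.hbar ^ n * y' := by
  cases n with
  | zero => exact ⟨r, by simp⟩
  | succ n =>
    refine D.toLoc_eq_zero.1 ?_
    have := congrArg (fun z : D.completion => z.1 n) h
    refine this.trans ?_
    change D.toLoc n D.hbar ^ (n + 1) * y.1 n = 0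
    rw [toLoc_hbar_pow, zero_mul]

variable {H : Type*} [Ring H] [HopfAlgebra k H] {α : HopfAct k H R}

theorem exists_completionAct [FiniteDimensional k H] (hα : D.hbar ∈ α.invariants) :
    ∃ γ : HopfAct k H D.completion,
      ∀ h r, γ.act h (D.toCompletion r) = D.toCompletion (α.act h r) := by
  choose β hβ using D.exists_locAct hα
  obtain ⟨γ, hγ⟩ := HopfAct.exists_act_of_pi β D.completion (fun h x hx n => by
    -- Compatibility of the actions with the transition maps is again an equality of algebra
    -- homomorphisms, tested on R.
    have : (convPostcomp H (D.locTrans n)).comp (β (n + 1)).coact =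
        (β n).coact.comp (D.locTrans n) := D.loc_hom_ext fun r => by
      ext h
      change D.locTrans n ((β (n + 1)).act h _) = (β n).act h (D.locTrans n _)
      rw [hβ, locTrans_toLoc, locTrans_toLoc, hβ]
    have h2 := congrArg (fun f : D.Loc (n + 1) →ₐ[k] WithConv (H →ₗ[k] D.Loc n) =>
      f (x (n + 1)) h) this
    exact h2.trans (congrArg ((β n).act h) (hx n)))
  refine ⟨γ, fun h r => ?_⟩
  ext n
  rw [hγ]
  exact hβ n h r

end Deformation

/-! ### Invariants of a Hopf action on a deformation of a field -/

/-- For a polynomial p of least degree with p(a) = 0, one gets p'(a) δ(a) = 0, and p'(a) ≠ 0 by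
minimality and characteristic zero. As E is only a ring, a least degree replaces the minimal
polynomial. -/
theorem derivation_eq_zero_of_isAlgebraic {E C Q : Type*} [CommRing E] [CommRing C] [IsDomain C]
    [Algebra E C] [Field Q] [CharZero Q] [Algebra C Q] [Algebra E Q] [IsScalarTower E C Q]
    [FaithfulSMul E Q] [FaithfulSMul C Q] [Algebra.IsAlgebraic E C] (δ : Derivation E C Q) :
    δ = 0 := by
  have hEQ := FaithfulSMul.algebraMap_injective E Q
  have hCQ := FaithfulSMul.algebraMap_injective C Q
  have hE : CharZero E := ⟨fun m n h => by
    have := congrArg (algebraMap E Q) h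
    simpa using this⟩
  have : IsDomain E := (hEQ.isDomain (algebraMap E Q))
  ext a
  let S : Set ℕ := {n | ∃ p : Polynomial E, p ≠ 0 ∧ Polynomial.aeval a p = 0 ∧ p.natDegree = n}
  have hS : S.Nonempty := by
    obtain ⟨p, h0, hp⟩ := Algebra.IsAlgebraic.isAlgebraic (R := E) a
    exact ⟨_, p, h0, hp, rfl⟩
  obtain ⟨p, hp0, hpa, hpn⟩ := Nat.sInf_mem hS
  have hmin : ∀ q : Polynomial E, q ≠ 0 → Polynomial.aeval a q = 0 → p.natDegree ≤ q.natDegree :=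
    fun q hq hqa => hpn ▸ Nat.sInf_le ⟨q, hq, hqa, rfl⟩
  have hdeg : p.natDegree ≠ 0 := fun h => by
    rw [Polynomial.eq_C_of_natDegree_eq_zero h, Polynomial.aeval_C] at hpa
    refine hp0 ?_
    rw [Polynomial.eq_C_of_natDegree_eq_zero h]
    have : algebraMap E Q (p.coeff 0) = 0 := by
      rw [IsScalarTower.algebraMap_apply E C Q, hpa, map_zero]
    rw [(map_eq_zero_iff _ hEQ).1 this, map_zero]
  have hder : Polynomial.aeval a (Polynomial.derivative p) ≠ 0 := fun h => by
    have h1 := Polynomial.natDegree_derivative_lt hdeg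
    refine absurd (hmin _ (fun h0 => hdeg ?_) h) (not_le.2 h1)
    exact Polynomial.derivative_eq_zero.1 h0
  have h1 := δ.map_aeval p a
  rw [hpa, map_zero, Algebra.smul_def, eq_comm, mul_eq_zero] at h1
  exact h1.resolve_left ((map_ne_zero_iff _ hCQ).2 hder)

namespace Deformation

open Coalgebra

variable {k L Q : Type*} [Field k] [Ring L] [Algebra k L] [Field Q] [Algebra k Q]
  (D : Deformation k L Q)

/-- A deformation of a field that is separated and local is a left principal ideal ring. -/
theorem isPrincipalIdealRing
    (hval : ∀ x, x ≠ 0 → ∃ n y, x = D.hbar ^ n * y ∧ D.red y ≠ 0)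
    (hunit : ∀ x, D.red x ≠ 0 → IsUnit x) : IsPrincipalIdealRing L where
  principal I := by
    by_cases hI : I = ⊥
    · rw [hI]; exact bot_isPrincipal
    let S : Set ℕ := {n | D.hbar ^ n ∈ I}
    have hmem : ∀ n y, D.hbar ^ n * y ∈ I → D.red y ≠ 0 → n ∈ S := fun n y h hy => by
      obtain ⟨u, rfl⟩ := hunit y hy
      have := I.mul_mem_left (↑u⁻¹ : L) h
      rwa [D.hbar_pow_comm, ← mul_assoc, Units.inv_mul, one_mul] at this
    have hS : S.Nonempty := by
      obtain ⟨x, hx, hx0⟩ := Submodule.exists_mem_ne_zero_of_ne_bot hI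
      obtain ⟨n, y, rfl, hy⟩ := hval x hx0
      exact ⟨n, hmem n y hx hy⟩
    refine ⟨D.hbar ^ sInf S, le_antisymm (fun x hx => ?_) ?_⟩
    · by_cases hx0 : x = 0
      · rw [hx0]; exact zero_mem _
      obtain ⟨n, y, rfl, hy⟩ := hval x hx0
      have hn := Nat.sInf_le (hmem n y hx hy)
      rw [Submodule.mem_span_singleton]
      refine ⟨D.hbar ^ (n - sInf S) * y, ?_⟩
      rw [smul_eq_mul, ← D.hbar_pow_comm, ← mul_assoc, ← pow_add, Nat.add_sub_cancel' hn]
    · rw [Submodule.span_singleton_le_iff_mem]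
      exact Nat.sInf_mem hS

variable {H : Type*} [Ring H] [HopfAlgebra k H] (γ : HopfAct k H L)

theorem mem_invariants_of_hbar_pow_mul {γ : HopfAct k H L} (hγ : D.hbar ∈ γ.invariants) {n : ℕ}
    {x : L} (hx : D.hbar ^ n * x ∈ γ.invariants) : x ∈ γ.invariants := fun h => by
  have := γ.mem_invariants.1 hx h
  rw [γ.act_invariant_mul (pow_mem hγ n), ← mul_smul_comm] at this
  exact D.hbar_pow_cancel this

/-- The reductions of the invariants. -/
noncomputable def redInvariants : Subalgebra k Q := γ.invariants.map D.red

/-- The entry ℏᵈ bounds the power of ℏ dividing the whole family, so a largest common power can be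
removed, leaving some entry with nonzero reduction. -/
theorem exists_primitive_family {r d : ℕ} (c : Fin (r + 1) → L)
    (hc : c (Fin.last r) = D.hbar ^ d) :
    ∃ (n : ℕ) (c' : Fin (r + 1) → L), (∀ i, c i = D.hbar ^ n * c' i) ∧
      ∃ i, D.red (c' i) ≠ 0 := by
  by_contra! h
  have h1 : ∀ n, ∃ c' : Fin (r + 1) → L, ∀ i, c i = D.hbar ^ n * c' i := fun n => by
    induction n with
    | zero => exact ⟨c, by simp⟩
    | succ n ih =>
      obtain ⟨c', hc'⟩ := ih
      have h2 := fun i => (D.red_eq_zero _).1 (h n c' hc' i)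
      choose c'' hc'' using h2
      exact ⟨c'', fun i => by rw [hc', hc'', pow_succ, mul_assoc]⟩
  obtain ⟨c', hc'⟩ := h1 (d + 1)
  have h3 := hc' (Fin.last r)
  rw [hc, pow_succ, mul_assoc] at h3
  have h4 : (1 : L) = D.hbar * c' (Fin.last r) :=
    D.hbar_pow_cancel (n := d) (by rw [mul_one]; exact h3)
  have h5 := congrArg D.red h4
  rw [map_one, map_mul, D.red_hbar, zero_mul] at h5
  exact one_ne_zero h5

/-- Lift q to b. The orbit maps of 1, b, b², … live in a free module of rank dim H over L, hence are
dependent. In a shortest relation, normalized so that its last coefficient is a power of ℏ, all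
coefficients are invariant. After removal of the common power of ℏ, its value at 1 ∈ H reduces to a
nontrivial polynomial equation for q. -/
theorem isAlgebraic_redInvariants [FiniteDimensional k H] (hγ : D.hbar ∈ γ.invariants)
    (hval : ∀ x, x ≠ 0 → ∃ n y, x = D.hbar ^ n * y ∧ D.red y ≠ 0)
    (hunit : ∀ x, D.red x ≠ 0 → IsUnit x) :
    Algebra.IsAlgebraic (D.redInvariants γ) Q where
  isAlgebraic q := by
    -- Principal left ideals make the noncommutative ring L Noetherian, so independent families in
    -- Lᴺ have at most N members.
    have : IsPrincipalIdealRing L := D.isPrincipalIdealRing hval hunit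
    have : Nontrivial L := D.red.toRingHom.domain_nontrivial
    obtain ⟨b, rfl⟩ := D.red_surjective q
    let N := Module.finrank k H
    let e := Module.finBasis k H
    let v : ℕ → (Fin N → L) := fun i j => γ.act (e j) (b ^ i)
    have hv : ∀ (r : ℕ) (c : Fin r → L), ∑ i, c i • v i = 0 →
        ∀ h, ∑ i : Fin r, c i * γ.act h (b ^ (i : ℕ)) = 0 := fun r c hc h => by
      let f : H →ₗ[k] L := ∑ i : Fin r, LinearMap.mulLeft k (c i) ∘ₗ
        γ.act.toLinearMap.flip (b ^ (i : ℕ))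
      have hf : f = 0 := e.ext fun j => by
        have := congrFun hc j
        simpa [f, v] using this
      have := congrArg (fun f => f h) hf
      simpa [f] using this
    have hex : ∃ r, ¬ LinearIndependent L (fun i : Fin (r + 1) => v i) := by
      refine ⟨N, fun h => ?_⟩
      have := h.fintype_card_le_finrank
      rw [Module.finrank_fin_fun, Fintype.card_fin] at this
      omega
    classical
    let r := Nat.find hex
    have hr : ¬ LinearIndependent L (fun i : Fin (r + 1) => v i) := Nat.find_spec hex
    have hind : LinearIndependent L (fun i : Fin r => v i) := by
      rcases Nat.eq_zero_or_pos r with h0 | h0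
      · have : IsEmpty (Fin r) := by rw [h0]; infer_instance
        exact linearIndependent_empty_type
      · have := Nat.find_min hex (m := r - 1) (by omega)
        rw [not_not] at this
        have h1 : r - 1 + 1 = r := by omega
        rwa [h1] at this
    have hind' : ∀ c : Fin r → L, ∑ i, c i • v i = 0 → ∀ i, c i = 0 :=
      Fintype.linearIndependent_iff.1 hind
    obtain ⟨c, hc, i₀, hi₀⟩ := Fintype.not_linearIndependent_iff.1 hr
    have hlast : c (Fin.last r) ≠ 0 := fun h0 => by
      rw [Fin.sum_univ_castSucc, h0, zero_smul, add_zero] at hc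
      have := hind' _ hc
      refine hi₀ ?_
      induction i₀ using Fin.lastCases with
      | last => exact h0
      | cast i => exact this i
    obtain ⟨d, y, hy, hy0⟩ := hval _ hlast
    obtain ⟨u, rfl⟩ := hunit y hy0
    have hc' : ∑ i : Fin (r + 1), (↑u⁻¹ * c i) • v i = 0 := by
      simp only [mul_smul, ← Finset.smul_sum, hc, smul_zero]
    have hlast' : ↑u⁻¹ * c (Fin.last r) = D.hbar ^ d := by
      rw [hy, D.hbar_pow_comm, ← mul_assoc, Units.inv_mul, one_mul]
    generalize hcc : (fun i => (↑u⁻¹ : L) * c i) = c₁ at *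
    replace hc' : ∑ i, c₁ i • v i = 0 := by rw [← hcc]; exact hc'
    replace hlast' : c₁ (Fin.last r) = D.hbar ^ d := by rw [← hcc]; exact hlast'
    have hinv : ∀ i, c₁ i ∈ γ.invariants := fun i => by
      induction i using Fin.lastCases with
      | last => rw [hlast']; exact pow_mem hγ d
      | cast i =>
        intro g
        have h1 := γ.sum_act_mul_eq_zero Finset.univ c₁ (fun i => b ^ (i : ℕ)) (hv _ _ hc') g
        -- Applying g to the coefficients and subtracting the counit multiple gives another
        -- relation. Its last coefficient vanishes because ℏᵈ is invariant, so minimality of r makes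
        -- all the others vanish.
        have h2 : ∑ i : Fin (r + 1), (γ.act g (c₁ i) - counit (R := k) g • c₁ i) • v i = 0 := by
          ext j
          simp only [sub_smul, Finset.sum_sub_distrib, smul_assoc, ← Finset.smul_sum, hc',
            smul_zero, sub_zero]
          have := h1 (e j)
          simpa [v] using this
        rw [Fin.sum_univ_castSucc, hlast', γ.mem_invariants.1 (pow_mem hγ d) g, sub_self,
          zero_smul, add_zero] at h2
        exact sub_eq_zero.1 (hind' _ h2 i)
    obtain ⟨n, c', hcc', i₁, hi₁⟩ := D.exists_primitive_family c₁ hlast'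
    have hinv' : ∀ i, c' i ∈ γ.invariants := fun i =>
      D.mem_invariants_of_hbar_pow_mul hγ (n := n) (hcc' i ▸ hinv i)
    have hrel : ∑ i : Fin (r + 1), D.red (c' i) * D.red b ^ (i : ℕ) = 0 := by
      have h1 := hv _ _ hc' 1
      simp only [map_one, Module.End.one_apply, hcc', mul_assoc, ← Finset.mul_sum] at h1
      have h2 := congrArg D.red (D.hbar_pow_reg _ _ h1)
      simpa using h2
    let p : Polynomial (D.redInvariants γ) :=
      ∑ i : Fin (r + 1), Polynomial.monomial (i : ℕ) ⟨D.red (c' i), ⟨_, hinv' i, rfl⟩⟩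
    have hp : ∀ i : Fin (r + 1), (p.coeff i : Q) = D.red (c' i) := fun i => by
      simp only [p, Polynomial.finsetSum_coeff, Polynomial.coeff_monomial, Fin.val_inj]
      simp
    refine ⟨p, fun h0 => hi₁ ?_, ?_⟩
    · rw [← hp, h0]; rfl
    · simp only [p, map_sum, Polynomial.aeval_monomial]
      exact hrel

variable [CharZero k] (P : Derivation k Q (Derivation k Q Q))

/-- A derivation vanishing on the reductions of the invariants is zero. -/
theorem derivation_eq_zero [Algebra.IsAlgebraic (D.redInvariants γ) Q] (δ : Derivation k Q Q)
    (h : ∀ z ∈ D.redInvariants γ, δ z = 0) : δ = 0 := by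
  have : CharZero Q := charZero_of_injective_algebraMap (algebraMap k Q).injective
  let δ' : Derivation (D.redInvariants γ) Q Q := Derivation.mk'
    { toFun := δ
      map_add' := map_add δ
      map_smul' := fun z x => by
        have h1 : δ (algebraMap (D.redInvariants γ) Q z) = 0 := h _ z.2
        rw [Algebra.smul_def, δ.leibniz, h1, smul_zero, add_zero]
        rfl }
    (fun x y => δ.leibniz x y)
  have h1 := derivation_eq_zero_of_isAlgebraic δ'
  ext x
  exact congrArg (fun d : Derivation (D.redInvariants γ) Q Q => d x) h1

/-- The derivation {f, ·} vanishes on a subalgebra over which Q is algebraic, hence everywhere, so f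
is Poisson central. -/
theorem exists_algebraMap_of_bracket_eq_zero [Algebra.IsAlgebraic (D.redInvariants γ) Q]
    (hcenter : ∀ f, (∀ g, P f g = 0) → ∃ c : k, f = algebraMap k Q c)
    {f : Q} (hf : ∀ z ∈ D.redInvariants γ, P f z = 0) : ∃ c : k, f = algebraMap k Q c := by
  refine hcenter f fun g => ?_
  rw [D.derivation_eq_zero γ (P f) hf]
  rfl

/-- Operators that are linearly independent over `k` and commute with the Hamiltonian
derivations of the reductions of invariants are linearly independent over `Q`. -/
theorem linearIndependent_of_commute [Algebra.IsAlgebraic (D.redInvariants γ) Q]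
    (hskew : ∀ f g, P f g = - P g f)
    (hcenter : ∀ f, (∀ g, P f g = 0) → ∃ c : k, f = algebraMap k Q c)
    {ι : Type*} (T : ι → Q →ₗ[k] Q) (hT : LinearIndependent k T)
    (hc : ∀ i, ∀ z ∈ D.redInvariants γ, ∀ q, T i (P z q) = P z (T i q)) :
    LinearIndependent Q T := by
  classical
  rw [linearIndependent_iff']
  intro s
  induction s using Finset.induction_on with
  | empty => simp
  | insert a s ha ih =>
    intro q hq
    have hqa : q a = 0 := by
      by_contra hqa
      generalize hq' : (fun i => (q a)⁻¹ * q i) = q' at *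
      have ha1 : q' a = 1 := by rw [← hq']; exact inv_mul_cancel₀ hqa
      have h1 : ∑ i ∈ insert a s, q' i • T i = 0 := by
        simp only [← hq', mul_smul, ← Finset.smul_sum, hq, smul_zero]
      -- Bracketing the relation with z and subtracting the relation evaluated at {z, b} leaves
      -- coefficients {z, q'ᵢ}. The one at `a` is {z, 1} = 0, so the induction hypothesis kills the
      -- rest, and each q'ᵢ is a constant.
      have h2 : ∀ i ∈ s, ∀ z ∈ D.redInvariants γ, P z (q' i) = 0 := fun i hi z hz => by
        refine ih (fun i => P z (q' i)) ?_ i hi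
        ext b
        have h3 := congrArg (fun f : Q →ₗ[k] Q => P z (f b)) h1
        have h4 := congrArg (fun f : Q →ₗ[k] Q => f (P z b)) h1
        simp only [LinearMap.sum_apply, LinearMap.smul_apply, smul_eq_mul, map_sum,
          Derivation.leibniz, hc _ z hz, LinearMap.zero_apply, map_zero,
          Finset.sum_add_distrib] at h3 h4
        rw [h4, zero_add, Finset.sum_insert ha, ha1, Derivation.map_one_eq_zero, mul_zero,
          zero_add] at h3
        simpa [mul_comm] using h3
      have h5 : ∀ i ∈ s, ∃ c : k, q' i = algebraMap k Q c := fun i hi =>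
        D.exists_algebraMap_of_bracket_eq_zero γ P hcenter (fun z hz => by
          rw [hskew, h2 i hi z hz, neg_zero])
      have h6 : ∀ i, ∃ c : k, i ∈ insert a s → q' i = algebraMap k Q c := fun i => by
        by_cases hi : i ∈ insert a s
        · rcases Finset.mem_insert.1 hi with rfl | hi
          · exact ⟨1, fun _ => by rw [ha1, map_one]⟩
          · obtain ⟨c, hc⟩ := h5 i hi
            exact ⟨c, fun _ => hc⟩
        · exact ⟨0, fun h => absurd h hi⟩
      choose c hcq using h6
      have h7 : ∑ i ∈ insert a s, c i • T i = 0 := by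
        rw [← h1]
        refine Finset.sum_congr rfl fun i hi => ?_
        rw [hcq i hi, algebraMap_smul]
      have h8 := linearIndependent_iff'.1 hT _ c h7 a (Finset.mem_insert_self a s)
      have h9 := hcq a (Finset.mem_insert_self a s)
      rw [h8, map_zero, ha1] at h9
      exact one_ne_zero h9
    rw [Finset.sum_insert ha, hqa, zero_smul, zero_add] at hq
    intro i hi
    rcases Finset.mem_insert.1 hi with rfl | hi
    · exact hqa
    · exact ih q hq i hi

end Deformation

/-! ### Hopf actions on fields -/

theorem Submodule.linearIndependent_coe_basis {k V ι : Type*} [Field k] [AddCommMonoid V]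
    [Module k V] (S : Submodule k V) (b : Module.Basis ι k S) :
    LinearIndependent k fun i => (b i : V) :=
  LinearIndependent.map_injOn b.linearIndependent S.subtype S.subtype_injective.injOn

section FiniteDimensional

variable (k V Q : Type*) [Field k] [Field Q] [Algebra k Q] [AddCommGroup V] [Module k V]
  [FiniteDimensional k V]

theorem Module.Finite.linearMap_field : Module.Finite Q (V →ₗ[k] Q) := inferInstance

theorem Module.finrank_linearMap_field :
    Module.finrank Q (V →ₗ[k] Q) = Module.finrank k V :=
  Module.finrank_linearMap_self k Q V

end FiniteDimensional

namespace HopfAct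

open Coalgebra WithConv Module

variable {k H Q : Type*} [Field k] [Ring H] [HopfAlgebra k H] [Field Q] [Algebra k Q]
  (β : HopfAct k H Q)

/-- The field of invariants. -/
noncomputable def fixedField : IntermediateField k Q where
  __ := β.invariants
  inv_mem' x hx h := by
    change x ∈ β.invariants at hx
    by_cases h0 : x = 0
    · rw [h0, inv_zero, map_zero, smul_zero]
    · refine mul_left_cancel₀ h0 ?_
      rw [← β.act_invariant_mul hx, mul_smul_comm, mul_inv_cancel₀ h0, β.act_one,
        Algebra.algebraMap_eq_smul_one]

/-- Elements linearly independent over the invariants have linearly independent orbit maps. -/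
theorem linearIndependent_coact {ι : Type*} {b : ι → Q} (hb : LinearIndependent β.fixedField b) :
    LinearIndependent Q fun i => β.coact (b i) := by
  classical
  rw [linearIndependent_iff']
  intro s
  induction s using Finset.induction_on with
  | empty => simp
  | insert a s ha ih =>
    intro q hq
    have hqa : q a = 0 := by
      by_contra hqa
      generalize hq' : (fun i => (q a)⁻¹ * q i) = q' at *
      have ha1 : q' a = 1 := by rw [← hq']; exact inv_mul_cancel₀ hqa
      have h1 : ∑ i ∈ insert a s, q' i • β.coact (b i) = 0 := by
        simp only [← hq', mul_smul, ← Finset.smul_sum, hq, smul_zero]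
      have h1' : ∀ h, ∑ i ∈ insert a s, q' i * β.act h (b i) = 0 := fun h => by
        have h3 := congrArg (fun u : WithConv (H →ₗ[k] Q) => u h) h1
        simpa [coact_apply] using h3
      -- The differences g · q'ᵢ − ε(g) q'ᵢ form a relation without the index `a`, whose coefficient
      -- is 1; the induction hypothesis then makes every q'ᵢ invariant.
      have h2 : ∀ i ∈ s, q' i ∈ β.invariants := fun i hi g => by
        have h3 := β.sum_act_mul_eq_zero _ q' b h1' g
        have h4 := ih (fun i => β.act g (q' i) - counit (R := k) g • q' i) (by
          ext h
          have h5 : ∑ i ∈ insert a s, (β.act g (q' i) - counit (R := k) g • q' i) *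
              β.act h (b i) = 0 := by
            simp only [sub_mul, Finset.sum_sub_distrib, smul_mul_assoc, ← Finset.smul_sum, h1',
              h3, smul_zero, sub_zero]
          rw [Finset.sum_insert ha, ha1, β.act_one, Algebra.algebraMap_eq_smul_one, sub_self,
            zero_mul, zero_add] at h5
          simpa [coact_apply] using h5) i hi
        exact sub_eq_zero.1 h4
      have h6 : ∀ i ∈ insert a s, q' i ∈ β.fixedField := fun i hi => by
        rcases Finset.mem_insert.1 hi with rfl | hi
        · rw [ha1]; exact one_mem _
        · exact h2 i hi
      let c : ι → β.fixedField := fun i => if h : i ∈ insert a s then ⟨q' i, h6 i h⟩ else 0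
      have h7 : ∑ i ∈ insert a s, c i • b i = 0 := by
        have h8 := h1' 1
        simp only [map_one, Module.End.one_apply] at h8
        rw [← h8]
        refine Finset.sum_congr rfl fun i hi => ?_
        simp only [c, dif_pos hi]
        rfl
      have h9 := linearIndependent_iff'.1 hb _ c h7 a (Finset.mem_insert_self a s)
      simp only [c, dif_pos (Finset.mem_insert_self a s)] at h9
      have h10 := congrArg (fun z : β.fixedField => (z : Q)) h9
      simp only [ha1] at h10
      exact one_ne_zero h10
    rw [Finset.sum_insert ha, hqa, zero_smul, zero_add] at hq
    intro i hi
    rcases Finset.mem_insert.1 hi with rfl | hi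
    · exact hqa
    · exact ih q hq i hi

/-- The space of operators through which `H` acts. -/
noncomputable def operators : Submodule k (Q →ₗ[k] Q) := LinearMap.range β.act.toLinearMap

theorem act_mem_operators (h : H) : β.act h ∈ β.operators := ⟨h, rfl⟩

instance [FiniteDimensional k H] : FiniteDimensional k β.operators :=
  inferInstanceAs (FiniteDimensional k (LinearMap.range β.act.toLinearMap))

theorem operators_fixedField {t : Q →ₗ[k] Q} (ht : t ∈ β.operators) {c : Q}
    (hc : c ∈ β.fixedField) (q : Q) : t (c * q) = c * t q := by
  obtain ⟨h, rfl⟩ := ht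
  exact β.act_invariant_mul hc h q

/-- Functions on the space of operators, as functions on `H`. -/
noncomputable def pullback : (β.operators →ₗ[k] Q) →ₗ[Q] WithConv (H →ₗ[k] Q) where
  toFun f := toConv (f ∘ₗ β.act.toLinearMap.rangeRestrict)
  map_add' f g := by ext; rfl
  map_smul' c f := by ext; rfl

/-- Evaluation of operators. -/
noncomputable def evalOperators (b : Q) : β.operators →ₗ[k] Q :=
  (LinearMap.applyₗ b : (Q →ₗ[k] Q) →ₗ[k] Q) ∘ₗ β.operators.subtype

theorem pullback_evalOperators (b : Q) : β.pullback (β.evalOperators b) = β.coact b := rfl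

theorem linearIndependent_evalOperators {ι : Type*} {b : ι → Q}
    (hb : LinearIndependent β.fixedField b) :
    LinearIndependent Q fun i => β.evalOperators (b i) :=
  LinearIndependent.of_comp β.pullback (β.linearIndependent_coact hb)

variable [FiniteDimensional k H]

instance : Module.Finite Q (β.operators →ₗ[k] Q) :=
  Module.Finite.linearMap_field k β.operators Q

instance : Module.Free k β.operators := Module.Free.of_divisionRing k β.operators

theorem finrank_linearMap_operators :
    finrank Q (β.operators →ₗ[k] Q) = finrank k β.operators :=
  Module.finrank_linearMap_field k β.operators Q

/-- A basis over the invariants gives independent evaluations in a finite dimensional Q-space of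
functions on the operators, so it is finite. -/
instance : FiniteDimensional β.fixedField Q := by
  let b := Basis.ofVectorSpace β.fixedField Q
  have := (β.linearIndependent_evalOperators b.linearIndependent).finite_of_isNoetherian
  exact Module.Finite.of_basis b

theorem finrank_linearMap_fixedField :
    finrank Q (Q →ₗ[β.fixedField] Q) = finrank β.fixedField Q :=
  Module.finrank_linearMap_field β.fixedField Q Q

/-- An operator in the image of `H`, as a linear map over the invariants. -/
noncomputable def operatorLinear (t : β.operators) : Q →ₗ[β.fixedField] Q where
  toFun := t.1
  map_add' := map_add t.1
  map_smul' c q := β.operators_fixedField t.2 c.2 q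

/-- Restriction of scalars from the invariants to the ground field. -/
noncomputable def restrictFixed : (Q →ₗ[β.fixedField] Q) →ₗ[Q] (Q →ₗ[k] Q) where
  toFun f := f.restrictScalars k
  map_add' _ _ := rfl
  map_smul' _ _ := rfl

/-- The operators are independent over the field: the Galois-type condition. -/
def OperatorsIndependent : Prop :=
  ∀ (n : ℕ) (T : Fin n → Q →ₗ[k] Q), (∀ i, T i ∈ β.operators) → LinearIndependent k T →
    LinearIndependent Q T

variable {β} (hβ : β.OperatorsIndependent)

include hβ

theorem OperatorsIndependent.linearIndependent_operatorLinear :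
    LinearIndependent Q fun i => β.operatorLinear (finBasis k β.operators i) := by
  refine LinearIndependent.of_comp β.restrictFixed
    (hβ _ (fun i => (finBasis k β.operators i : Q →ₗ[k] Q)) (fun i => Subtype.prop _) ?_)
  exact Submodule.linearIndependent_coe_basis _ (finBasis k β.operators)

/-- Two independent families bound the dimensions against each other: operators inside the
endomorphisms of Q over the invariants, and evaluations at a basis of Q inside the functions on the
operators. -/
theorem OperatorsIndependent.finrank_eq :
    finrank k β.operators = finrank β.fixedField Q := by
  refine le_antisymm ?_ ?_
  · have h1 := Module.Finite.linearMap_field β.fixedField Q Q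
    have h2 := LinearIndependent.fintype_card_le_finrank hβ.linearIndependent_operatorLinear
    rwa [Fintype.card_fin, finrank_linearMap_fixedField] at h2
  · have := (β.linearIndependent_evalOperators
      (finBasis β.fixedField Q).linearIndependent).fintype_card_le_finrank
    rwa [Fintype.card_fin, finrank_linearMap_operators] at this

/-- Every operator linear over the invariants is a combination of operators from `H`. -/
theorem OperatorsIndependent.exists_eq_sum (τ : Q →ₗ[k] Q)
    (hτ : ∀ c ∈ β.fixedField, ∀ q, τ (c * q) = c * τ q) :
    ∃ q : Fin (finrank k β.operators) → Q,
      τ = ∑ i, q i • (finBasis k β.operators i : Q →ₗ[k] Q) := by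
  have h1 := hβ.linearIndependent_operatorLinear.span_eq_top_of_card_eq_finrank'
    (by rw [Fintype.card_fin, finrank_linearMap_fixedField, hβ.finrank_eq])
  let τ' : Q →ₗ[β.fixedField] Q :=
    { toFun := τ, map_add' := map_add τ, map_smul' := fun c q => hτ c c.2 q }
  have h2 : τ' ∈ Submodule.span Q (Set.range fun i =>
      β.operatorLinear (finBasis k β.operators i)) := h1 ▸ Submodule.mem_top
  obtain ⟨q, hq⟩ := (Submodule.mem_span_range_iff_exists_fun Q).1 h2
  refine ⟨q, ?_⟩
  have h3 := congrArg β.restrictFixed hq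
  rw [map_sum] at h3
  exact h3.symm

/-- Every function on the operators is a combination of evaluations. -/
theorem OperatorsIndependent.span_evalOperators :
    Submodule.span Q (Set.range fun i => β.evalOperators (finBasis β.fixedField Q i)) = ⊤ :=
  (β.linearIndependent_evalOperators
    (finBasis β.fixedField Q).linearIndependent).span_eq_top_of_card_eq_finrank'
    (by rw [Fintype.card_fin, finrank_linearMap_operators, hβ.finrank_eq])

end HopfAct

/-! ### The group of a Galois-type Hopf action on a field -/

/-- Characters separate the points of a reduced commutative finite dimensional algebra. -/
theorem exists_character_ne_zero {k K : Type*} [Field k] [IsAlgClosed k] [CommRing K]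
    [Algebra k K] [FiniteDimensional k K] [IsReduced K] {f : K} (hf : f ≠ 0) :
    ∃ χ : K →ₐ[k] k, χ f ≠ 0 := by
  have : IsArtinianRing K := .of_finite k K
  -- The Jacobson radical of an Artinian ring is nilpotent, hence zero in a reduced one. Some
  -- maximal ideal therefore misses f, and its residue field is k.
  have h1 : (Ideal.jacobson (⊥ : Ideal K)) = ⊥ := by
    obtain ⟨n, hn⟩ := IsArtinianRing.isNilpotent_jacobson_bot (R := K)
    refine (Submodule.eq_bot_iff _).2 fun x hx => ?_
    have h2 : x ^ n ∈ (Ideal.jacobson (⊥ : Ideal K)) ^ n := Ideal.pow_mem_pow hx n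
    rw [hn] at h2
    exact eq_zero_of_pow_eq_zero h2
  have h2 : f ∉ Ideal.jacobson (⊥ : Ideal K) := by rwa [h1, Submodule.mem_bot]
  rw [Ideal.jacobson, Submodule.mem_sInf] at h2
  push Not at h2
  obtain ⟨m, ⟨-, hm⟩, hfm⟩ := h2
  let := Ideal.Quotient.field m
  have h3 := IsAlgClosed.algebraMap_bijective_of_isIntegral (k := k) (K := K ⧸ m)
  let e : k ≃ₐ[k] (K ⧸ m) := AlgEquiv.ofBijective (Algebra.ofId k (K ⧸ m)) h3
  refine ⟨e.symm.toAlgHom.comp (Ideal.Quotient.mkₐ k m), fun h => hfm ?_⟩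
  exact Ideal.Quotient.eq_zero_iff_mem.1 ((map_eq_zero_iff e.symm e.symm.injective).1 h)

/-- Variant for a noncommutative ring structure whose multiplication happens to commute. -/
theorem exists_character_ne_zero_of_commute {k K : Type*} [Field k] [IsAlgClosed k] [Ring K]
    [Algebra k K] [FiniteDimensional k K] [IsReduced K] (hcomm : ∀ x y : K, x * y = y * x)
    {f : K} (hf : f ≠ 0) : ∃ χ : K →ₐ[k] k, χ f ≠ 0 := by
  let : CommRing K := { (inferInstance : Ring K) with mul_comm := hcomm }
  exact exists_character_ne_zero hf

namespace HopfAct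

open Coalgebra WithConv Module

variable {k H Q : Type*} [Field k] [Ring H] [HopfAlgebra k H] [Field Q] [Algebra k Q]
  (β : HopfAct k H Q)

/-- The coaction, linear over the invariants. -/
noncomputable def coactFixed : Q →ₐ[β.fixedField] WithConv (H →ₗ[k] Q) where
  __ := β.coact
  commutes' c := by
    change β.coact c.1 = algebraMap Q (WithConv (H →ₗ[k] Q)) c.1
    rw [Algebra.algebraMap_eq_smul_one]
    ext h
    have h1 : β.act h c.1 = counit (R := k) h • c.1 := c.2 h
    change β.act h c.1 = c.1 * algebraMap k Q (counit (R := k) h)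
    rw [h1, Algebra.smul_def, mul_comm]

/-- The Galois map `Q ⊗ Q → Hom(H, Q)`. -/
noncomputable def galoisMap : Q ⊗[β.fixedField] Q →ₐ[Q] WithConv (H →ₗ[k] Q) :=
  Algebra.TensorProduct.lift (Algebra.ofId Q _) β.coactFixed
    fun x _ => Algebra.commutes x _

theorem galoisMap_tmul (a b : Q) : β.galoisMap (a ⊗ₜ b) = a • β.coact b := by
  rw [Algebra.smul_def]
  exact Algebra.TensorProduct.lift_tmul _ _ _ _ _

/-- A basis of Q over the invariants induces a left Q-basis of the tensor product, and its coactions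
are independent over Q. -/
theorem galoisMap_injective : Function.Injective β.galoisMap := by
  let b := Basis.ofVectorSpace β.fixedField Q
  refine LinearMap.injective_of_linearIndependent (f := β.galoisMap.toLinearMap)
    (Algebra.TensorProduct.basis Q b).span_eq ?_
  have h1 := β.linearIndependent_coact b.linearIndependent
  have h2 : (fun i => β.coact (b i)) =
      β.galoisMap.toLinearMap ∘ Algebra.TensorProduct.basis Q b := by
    ext1 i
    simp [Algebra.TensorProduct.basis_apply, galoisMap_tmul]
  rw [h2] at h1
  exact h1

/-- In characteristic zero the finite extension Q of the invariants is separable, so its base change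
to Q is reduced. -/
theorem isReduced_tensor [FiniteDimensional k H] [CharZero k] :
    IsReduced (Q ⊗[β.fixedField] Q) := by
  have : CharZero β.fixedField := algebraRat.charZero _
  have : Algebra.FormallyUnramified β.fixedField Q := .of_isSeparable _ _
  exact Algebra.FormallyUnramified.isReduced_of_field Q _

instance : IsScalarTower k Q (WithConv (H →ₗ[k] Q)) :=
  ⟨fun c q u => by ext h; exact smul_assoc c q (u h)⟩

/-- The functions on `H` which lie in the image of the Galois map. -/
noncomputable def functions : Subalgebra k (WithConv (H →ₗ[k] k)) :=
  (β.galoisMap.range.restrictScalars k).comap (convPostcomp H (Algebra.ofId k Q))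

theorem mem_functions {f : WithConv (H →ₗ[k] k)} :
    f ∈ β.functions ↔ ∃ ξ, β.galoisMap ξ = convPostcomp H (Algebra.ofId k Q) f := Iff.rfl

theorem convPostcomp_ofId_injective :
    Function.Injective (convPostcomp H (Algebra.ofId k Q)) := fun f g hfg => by
  ext h
  have := congrArg (fun u : WithConv (H →ₗ[k] Q) => u h) hfg
  exact (algebraMap k Q).injective this

/-- The convolution algebra need not be commutative, but these functions come from the commutative
ring Q ⊗ Q. -/
theorem functions_mul_comm (f g : β.functions) : f * g = g * f := by
  obtain ⟨ξ, hξ⟩ := f.2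
  obtain ⟨η, hη⟩ := g.2
  apply Subtype.ext
  apply convPostcomp_ofId_injective (Q := Q)
  change convPostcomp H _ (f.1 * g.1) = convPostcomp H _ (g.1 * f.1)
  rw [map_mul, map_mul]
  change β.galoisMap ξ = convPostcomp H _ f.1 at hξ
  change β.galoisMap η = convPostcomp H _ g.1 at hη
  rw [← hξ, ← hη, ← map_mul, ← map_mul, mul_comm]

theorem isReduced_functions [FiniteDimensional k H] [CharZero k] : IsReduced β.functions := by
  have := β.isReduced_tensor
  refine ⟨fun f ⟨n, hf⟩ => ?_⟩
  obtain ⟨ξ, hξ⟩ := f.2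
  change β.galoisMap ξ = convPostcomp H _ f.1 at hξ
  have h1 : ξ ^ n = 0 := by
    apply β.galoisMap_injective
    have h2 : f.1 ^ n = 0 := congrArg Subtype.val hf
    rw [map_pow, hξ, ← map_pow, h2, map_zero, map_zero]
  have h2 : ξ = 0 := eq_zero_of_pow_eq_zero h1
  apply Subtype.ext
  apply convPostcomp_ofId_injective (Q := Q)
  rw [← hξ, h2, map_zero]
  exact (map_zero _).symm

end HopfAct

theorem Submodule.exists_dual_ne_zero {k V : Type*} [Field k] [AddCommGroup V] [Module k V]
    (S : Submodule k V) (T : Set S) (hT : ¬ Submodule.span k T = ⊤) :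
    ∃ l : Module.Dual k S, l ≠ 0 ∧ ∀ t ∈ T, l t = 0 := by
  obtain ⟨l, hl, hle⟩ := Submodule.exists_le_ker_of_lt_top _ (lt_top_iff_ne_top.2 hT)
  exact ⟨l, hl, fun t ht => hle (Submodule.subset_span ht)⟩

namespace HopfAct

open Coalgebra WithConv Module

variable {k H Q : Type*} [Field k] [Ring H] [HopfAlgebra k H] [Field Q] [Algebra k Q]
  {β : HopfAct k H Q}

/-- The function on `H` attached to a functional on the operators. -/
noncomputable def functionOf (β : HopfAct k H Q) (l : Dual k β.operators) : WithConv (H →ₗ[k] k) :=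
  toConv (l ∘ₗ β.act.toLinearMap.rangeRestrict)

/-- Evaluation at an element of `H`. -/
noncomputable def evalAt (h : H) : WithConv (H →ₗ[k] Q) →ₗ[Q] Q where
  toFun u := u h
  map_add' _ _ := rfl
  map_smul' _ _ := rfl

variable [FiniteDimensional k H]

/-- Evaluations at a basis bᵢ span all functions on the operators. If a functional equals ∑ qᵢ evᵢ,
then the function it defines on H is the image of ∑ qᵢ ⊗ bᵢ. -/
theorem OperatorsIndependent.functionOf_mem (hβ : β.OperatorsIndependent)
    (l : Dual k β.operators) : β.functionOf l ∈ β.functions := by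
  let F : β.operators →ₗ[k] Q := Algebra.linearMap k Q ∘ₗ l
  have h1 : F ∈ Submodule.span Q (Set.range fun i =>
      β.evalOperators (finBasis β.fixedField Q i)) := hβ.span_evalOperators ▸ Submodule.mem_top
  obtain ⟨q, hq⟩ := (Submodule.mem_span_range_iff_exists_fun Q).1 h1
  refine β.mem_functions.2 ⟨∑ i, q i ⊗ₜ finBasis β.fixedField Q i, ?_⟩
  have h2 := congrArg β.pullback hq
  rw [map_sum] at h2
  rw [map_sum]
  refine Eq.trans (Finset.sum_congr rfl fun i _ => ?_) h2
  rw [galoisMap_tmul, map_smul, pullback_evalOperators]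

/-- An orbit map is a combination of scalar functions. -/
theorem OperatorsIndependent.coact_eq_sum (hβ : β.OperatorsIndependent) (b : Q) :
    ∃ (n : ℕ) (q : Fin n → Q) (f : Fin n → β.functions),
      β.coact b = ∑ i, q i • convPostcomp H (Algebra.ofId k Q) (f i).1 := by
  let e := finBasis k β.operators
  refine ⟨_, fun i => (e i).1 b, fun i => ⟨_, hβ.functionOf_mem (e.coord i)⟩, ?_⟩
  ext h
  change β.act h b = evalAt h (∑ i, (e i).1 b • convPostcomp H (Algebra.ofId k Q)
    (β.functionOf (e.coord i)))
  have h1 := congrArg (β.evalOperators b) (e.sum_repr ⟨β.act h, β.act_mem_operators h⟩)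
  rw [map_sum] at h1
  rw [map_sum]
  refine (Eq.trans (Finset.sum_congr rfl fun i _ => ?_) h1).symm
  rw [map_smul, map_smul, smul_eq_mul, Algebra.smul_def, mul_comm]
  rfl

/-- A character of the algebra of functions is given by an element acting multiplicatively. -/
theorem OperatorsIndependent.exists_act_eq_algEquiv (hβ : β.OperatorsIndependent)
    (χ : β.functions →ₐ[k] k) : ∃ (h : H) (g : Q ≃ₐ[β.fixedField] Q),
      (∀ q, β.act h q = g q) ∧ ∀ f : β.functions, f.1 h = χ f := by
  -- An arbitrary linear extension of χ to the dual of H is evaluation at some h, by finite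
  -- dimensional duality.
  obtain ⟨χ', hχ'⟩ := LinearMap.exists_extend (p := Subalgebra.toSubmodule β.functions)
    χ.toLinearMap
  let e : Dual k H ≃ₗ[k] WithConv (H →ₗ[k] k) := (WithConv.linearEquiv k _).symm
  obtain ⟨h, hh⟩ := (Module.evalEquiv k H).surjective (χ' ∘ₗ e.toLinearMap)
  have hf : ∀ f : β.functions, f.1 h = χ f := fun f => by
    have h1 := congrArg (fun u => u (ofConv f.1)) hh
    have h2 := congrArg (fun u => u f) hχ'
    exact h1.trans h2
  -- Expanding both orbit maps in scalar functions reduces this to multiplicativity of χ, because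
  -- the coaction is multiplicative for convolution.
  have hmul : ∀ a b, β.act h (a * b) = β.act h a * β.act h b := fun a b => by
    obtain ⟨m, q, f, hq⟩ := hβ.coact_eq_sum a
    obtain ⟨n, r, g, hr⟩ := hβ.coact_eq_sum b
    have h1 : ∀ u : β.functions, evalAt h (convPostcomp H (Algebra.ofId k Q) u.1) =
        algebraMap k Q (χ u) := fun u => congrArg (algebraMap k Q) (hf u)
    have h2 : evalAt h (β.coact a) * evalAt h (β.coact b) =
        evalAt h (β.coact a * β.coact b) := by
      rw [hq, hr, Finset.sum_mul_sum, map_sum, map_sum, map_sum, Finset.sum_mul_sum]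
      refine Finset.sum_congr rfl fun i _ => ?_
      rw [map_sum]
      refine Finset.sum_congr rfl fun j _ => ?_
      rw [smul_mul_smul_comm, ← map_mul (convPostcomp H (Algebra.ofId k Q))]
      have h3 := h1 (f i * g j)
      rw [map_mul, map_mul] at h3
      rw [map_smul, map_smul, map_smul, h1, h1]
      refine Eq.trans ?_ (congrArg ((q i * r j) • ·) h3).symm
      simp only [smul_eq_mul]
      ring
    rw [← map_mul β.coact] at h2
    exact h2.symm
  have hone : β.act h 1 = 1 := by
    have h1 := hf 1
    rw [map_one] at h1
    have h2 : counit (R := k) h = 1 := h1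
    rw [β.act_one, h2, map_one]
  let g : Q →ₐ[β.fixedField] Q :=
    { toFun := β.act h
      map_one' := hone
      map_mul' := hmul
      map_zero' := map_zero _
      map_add' := map_add _
      commutes' := fun c => by
        have h1 := β.act_invariant_mul c.2 h 1
        rw [hone, mul_one] at h1
        exact h1 }
  exact ⟨h, AlgEquiv.ofBijective g g.bijective, fun q => rfl, hf⟩

/-- Automorphisms over the invariants, as operators over the ground field. -/
noncomputable def autOperator (g : Q ≃ₐ[β.fixedField] Q) : Q →ₗ[k] Q :=
  (g.toLinearMap).restrictScalars k

/-- Otherwise a nonzero functional on the operators kills all these automorphisms. It defines a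
nonzero element of a reduced commutative finite dimensional algebra, so some character does not
vanish on it. But a character is evaluation at an element acting by an automorphism, where the
functional is zero. -/
theorem OperatorsIndependent.span_autOperator [IsAlgClosed k] [CharZero k]
    (hβ : β.OperatorsIndependent) : Submodule.span k
      (Set.range fun g : {g : Q ≃ₐ[β.fixedField] Q // autOperator g ∈ β.operators} =>
        (⟨autOperator g.1, g.2⟩ : β.operators)) = ⊤ := by
  by_contra hne
  obtain ⟨l, hl, hle⟩ := Submodule.exists_dual_ne_zero _ _ hne
  have := β.isReduced_functions
  have hf : (⟨β.functionOf l, hβ.functionOf_mem l⟩ : β.functions) ≠ 0 := fun h0 => hl <| by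
    ext ⟨t, h, rfl⟩
    exact congrArg (fun f : β.functions => f.1 h) h0
  have : FiniteDimensional k (WithConv (H →ₗ[k] k)) :=
    Module.Finite.equiv (WithConv.linearEquiv k (H →ₗ[k] k)).symm
  have hfin : FiniteDimensional k β.functions :=
    FiniteDimensional.finiteDimensional_submodule (Subalgebra.toSubmodule β.functions)
  obtain ⟨χ, hχ⟩ := exists_character_ne_zero_of_commute (k := k) (K := β.functions)
    β.functions_mul_comm hf
  obtain ⟨h, g, hg, hfχ⟩ := hβ.exists_act_eq_algEquiv χ
  refine hχ ?_
  rw [← hfχ]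
  have h1 : autOperator g = β.act h := LinearMap.ext fun q => (hg q).symm
  have h2 : autOperator g ∈ β.operators := h1 ▸ β.act_mem_operators h
  have h3 := hle _ ⟨⟨g, h2⟩, rfl⟩
  rw [← h3]
  exact congrArg l (Subtype.ext h1.symm)

/-- A count: the automorphisms that are operators span a space of dimension [Q : Q^H], and there are
at most that many automorphisms altogether. This makes the map onto the group algebra surjective. -/
theorem OperatorsIndependent.autOperator_mem [IsAlgClosed k] [CharZero k]
    (hβ : β.OperatorsIndependent) (g : Q ≃ₐ[β.fixedField] Q) : autOperator g ∈ β.operators := by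
  classical
  have h1 := finrank_range_le_card (R := k)
    fun g : {g : Q ≃ₐ[β.fixedField] Q // autOperator g ∈ β.operators} =>
      (⟨autOperator g.1, g.2⟩ : β.operators)
  have h2 : finrank k β.operators ≤
      Fintype.card {g : Q ≃ₐ[β.fixedField] Q // autOperator g ∈ β.operators} := by
    rwa [Set.finrank, hβ.span_autOperator, finrank_top] at h1
  have h3 : Fintype.card (Q ≃ₐ[β.fixedField] Q) ≤ finrank β.fixedField Q := AlgEquiv.card_le
  rw [← hβ.finrank_eq] at h3
  by_contra hg
  exact absurd (Fintype.card_subtype_lt (x := g) hg) (not_lt.2 (h3.trans h2))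

end HopfAct

/-! ### Group algebras acting on a field -/

section GroupOperator

open Module

variable {k G Q : Type*} [Field k] [Group G] [Field Q] [Algebra k Q]

/-- The operator attached to an element of the group algebra. -/
noncomputable def groupOperator (σ : G →* (Q ≃ₐ[k] Q)) : MonoidAlgebra k G →ₐ[k] End k Q :=
  MonoidAlgebra.lift k (End k Q) G ((AlgEquiv.toLinearMapHom k Q).comp σ)

variable {σ : G →* (Q ≃ₐ[k] Q)}

theorem groupOperator_apply (x : MonoidAlgebra k G) (q : Q) :
    groupOperator σ x q = x.coeff.sum fun g c => c • σ g q := by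
  rw [groupOperator, MonoidAlgebra.lift_apply, Finsupp.sum, LinearMap.sum_apply]
  rfl

theorem groupOperator_single (g : G) (q : Q) :
    groupOperator σ (MonoidAlgebra.single g 1) q = σ g q := by
  rw [groupOperator, MonoidAlgebra.lift_single, one_smul]
  rfl

/-- Independence of automorphisms, tested on any multiplicative set where they differ. -/
theorem linearIndependent_monoidHom_comp {M : Type*} [MulOneClass M] {ι : Type*}
    {f : ι → M →* Q} (hf : Function.Injective f) : LinearIndependent k fun i m => f i m := by
  have h1 := (linearIndependent_monoidHom M Q).comp f hf
  refine LinearIndependent.restrict_scalars' k h1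

theorem groupOperator_injective (hσ : Function.Injective σ) :
    Function.Injective (groupOperator σ) := by
  have h1 : LinearIndependent k fun g (q : Q) => (σ g : Q →* Q) q :=
    linearIndependent_monoidHom_comp fun g g' h => hσ <| AlgEquiv.ext fun q => DFunLike.congr_fun h q
  refine LinearMap.injective_of_linearIndependent (f := (groupOperator σ).toLinearMap)
    (MonoidAlgebra.basis G k).span_eq ?_
  refine LinearIndependent.of_comp (LinearMap.ltoFun k Q Q k) ?_
  have h2 : (fun g (q : Q) => (σ g : Q →* Q) q) = LinearMap.ltoFun k Q Q k ∘
      (groupOperator σ).toLinearMap ∘ MonoidAlgebra.basis G k := by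
    ext g q
    simp [groupOperator_single]
  rw [h2] at h1
  exact h1

/-- The bilinear operator attached to an element of `k[G] ⊗ k[G]`. -/
noncomputable def biOperator (σ : G →* (Q ≃ₐ[k] Q)) :
    MonoidAlgebra k G ⊗[k] MonoidAlgebra k G →ₗ[k] (Q × Q → Q) :=
  LinearMap.pi fun p => LinearMap.mul' k Q ∘ₗ TensorProduct.map
    ((groupOperator σ).toLinearMap.flip p.1) ((groupOperator σ).toLinearMap.flip p.2)

theorem biOperator_apply (t : MonoidAlgebra k G ⊗[k] MonoidAlgebra k G) (a b : Q) :
    biOperator σ t (a, b) = LinearMap.mul' k Q (TensorProduct.map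
    ((groupOperator σ).toLinearMap.flip a) ((groupOperator σ).toLinearMap.flip b) t) := rfl

/-- Dedekind independence for the distinct characters (a, b) ↦ σ_g(a) σ_h(b) of the monoid Q × Q. It
allows coproducts to be compared through their action on products. -/
theorem biOperator_injective (hσ : Function.Injective σ) :
    Function.Injective (biOperator σ) := by
  let f : G × G → Q × Q →* Q := fun p =>
    MonoidHom.coprod (σ p.1 : Q →* Q) (σ p.2 : Q →* Q)
  have h1 : LinearIndependent k fun p (q : Q × Q) => f p q :=
    linearIndependent_monoidHom_comp fun p p' h => by
      have h2 : ∀ a b, σ p.1 a * σ p.2 b = σ p'.1 a * σ p'.2 b :=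
        fun a b => DFunLike.congr_fun h (a, b)
      refine Prod.ext (hσ <| AlgEquiv.ext fun q => ?_) (hσ <| AlgEquiv.ext fun q => ?_)
      · simpa using h2 q 1
      · simpa using h2 1 q
  refine LinearMap.injective_of_linearIndependent
    ((MonoidAlgebra.basis G k).tensorProduct (MonoidAlgebra.basis G k)).span_eq ?_
  have h2 : (fun p (q : Q × Q) => f p q) = biOperator σ ∘
      (MonoidAlgebra.basis G k).tensorProduct (MonoidAlgebra.basis G k) := by
    ext p ⟨a, b⟩
    simp [biOperator_apply, groupOperator_single, f, Module.Basis.tensorProduct_apply']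
  rw [h2] at h1
  exact h1

theorem biOperator_comul (x : MonoidAlgebra k G) (a b : Q) :
    biOperator σ (Coalgebra.comul (R := k) x) (a, b) = groupOperator σ x (a * b) := by
  let l₁ : MonoidAlgebra k G →ₗ[k] Q :=
    LinearMap.proj (a, b) ∘ₗ biOperator σ ∘ₗ Coalgebra.comul (R := k)
  have h1 : l₁ = (groupOperator σ).toLinearMap.flip (a * b) := by
    refine (MonoidAlgebra.basis G k).ext fun g => ?_
    simp [l₁, biOperator_apply, groupOperator_single]
  exact DFunLike.congr_fun h1 x

theorem groupOperator_one (x : MonoidAlgebra k G) :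
    groupOperator σ x 1 = algebraMap k Q (Coalgebra.counit (R := k) x) := by
  have h1 : (groupOperator σ).toLinearMap.flip 1 =
      Algebra.linearMap k Q ∘ₗ Coalgebra.counit (R := k) := by
    refine (MonoidAlgebra.basis G k).ext fun g => ?_
    simp [groupOperator_single]
  exact DFunLike.congr_fun h1 x

/-- A Hopf action through operators of a group action comes from a Hopf algebra homomorphism. -/
theorem HopfAct.exists_bialgHom {H : Type*} [Ring H] [HopfAlgebra k H] (β : HopfAct k H Q)
    (hσ : Function.Injective σ) (hβ : ∀ h, ∃ x, groupOperator σ x = β.act h) :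
    ∃ φ : H →ₐc[k] MonoidAlgebra k G, ∀ h, groupOperator σ (φ h) = β.act h := by
  let e := AlgEquiv.ofInjective (groupOperator σ) (groupOperator_injective hσ)
  let f : H →ₐ[k] MonoidAlgebra k G := e.symm.toAlgHom.comp (β.act.codRestrict _ hβ)
  have hf : ∀ h, groupOperator σ (f h) = β.act h := fun h => by
    have h1 := e.apply_symm_apply (β.act.codRestrict _ hβ h)
    exact congrArg Subtype.val h1
  refine ⟨BialgHom.ofAlgHom f ?_ ?_, hf⟩
  · ext h
    apply (algebraMap k Q).injective
    change algebraMap k Q (Coalgebra.counit (R := k) (f h)) = algebraMap k Q (Coalgebra.counit h)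
    rw [← groupOperator_one (σ := σ), hf, β.act_one]
  · ext h
    -- Both coproducts act on a pair (a, b) as the action of h on ab, by the two module algebra
    -- rules.
    apply biOperator_injective hσ
    ext ⟨a, b⟩
    change biOperator σ (TensorProduct.map f.toLinearMap f.toLinearMap (Coalgebra.comul h)) (a, b)
      = biOperator σ (Coalgebra.comul (f h)) (a, b)
    rw [biOperator_comul, hf, β.act_mul', biOperator_apply, ← LinearMap.comp_apply
      (TensorProduct.map _ _), ← TensorProduct.map_comp]
    have h1 : ∀ a, (groupOperator σ).toLinearMap.flip a ∘ₗ f.toLinearMap =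
        β.act.toLinearMap.flip a := fun a => LinearMap.ext fun h => by
      exact DFunLike.congr_fun (hf h) a
    rw [h1, h1]

end GroupOperator

open Module in
/-- A Hopf action of Galois type on a field factors through a group action. -/
theorem HopfAct.OperatorsIndependent.exists_group {k H Q : Type*} [Field k] [IsAlgClosed k]
    [CharZero k] [Ring H] [HopfAlgebra k H] [FiniteDimensional k H] [Field Q] [Algebra k Q]
    {β : HopfAct k H Q} (hβ : β.OperatorsIndependent) :
    ∃ (G : Type) (_ : Group G) (_ : Finite G) (σ : G →* (Q ≃ₐ[k] Q))
      (φ : H →ₐc[k] MonoidAlgebra k G), Function.Injective σ ∧ Function.Surjective φ ∧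
        ∀ h, groupOperator σ (φ h) = β.act h := by
  -- The automorphism group is finite, so it has a model in the lowest universe.
  let e : Shrink.{0} (Q ≃ₐ[β.fixedField] Q) ≃* (Q ≃ₐ[β.fixedField] Q) := Shrink.mulEquiv
  let σ : Shrink.{0} (Q ≃ₐ[β.fixedField] Q) →* (Q ≃ₐ[k] Q) :=
    (AlgEquiv.restrictScalarsHom k).comp e.toMonoidHom
  have hσ : Function.Injective σ :=
    (AlgEquiv.restrictScalars_injective k).comp e.injective
  have hg : ∀ g, groupOperator σ (MonoidAlgebra.single g 1) = autOperator (e g) := fun g =>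
    LinearMap.ext fun q => groupOperator_single g q
  have h1 : ∀ h, ∃ x, groupOperator σ x = β.act h := fun h => by
    have h2 : (⟨β.act h, β.act_mem_operators h⟩ : β.operators) ∈ Submodule.span k
      (Set.range fun g : {g : Q ≃ₐ[β.fixedField] Q // autOperator g ∈ β.operators} =>
        (⟨autOperator g.1, g.2⟩ : β.operators)) := hβ.span_autOperator ▸ Submodule.mem_top
    have h3 : ∀ t : β.operators, t ∈ Submodule.span k
      (Set.range fun g : {g : Q ≃ₐ[β.fixedField] Q // autOperator g ∈ β.operators} =>
        (⟨autOperator g.1, g.2⟩ : β.operators)) → ∃ x, groupOperator σ x = t.1 := fun t ht => by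
      induction ht using Submodule.span_induction with
      | mem t ht =>
        obtain ⟨g, rfl⟩ := ht
        exact ⟨MonoidAlgebra.single (e.symm g.1) 1, by rw [hg, e.apply_symm_apply]⟩
      | zero => exact ⟨0, map_zero _⟩
      | add t t' _ _ h h' =>
        obtain ⟨x, hx⟩ := h
        obtain ⟨x', hx'⟩ := h'
        exact ⟨x + x', by rw [map_add, hx, hx']; rfl⟩
      | smul c t _ h =>
        obtain ⟨x, hx⟩ := h
        exact ⟨c • x, by rw [map_smul, hx]; rfl⟩
    exact h3 _ h2
  obtain ⟨φ, hφ⟩ := β.exists_bialgHom hσ h1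
  refine ⟨_, inferInstance, inferInstance, σ, φ, hσ, fun x => ?_, hφ⟩
  have h2 : groupOperator σ x ∈ β.operators := by
    have h3 : x ∈ Submodule.comap (groupOperator σ).toLinearMap β.operators := by
      have h4 := (MonoidAlgebra.basis _ k).span_eq.ge (Submodule.mem_top (x := x))
      refine Submodule.span_le.2 ?_ h4
      rintro _ ⟨g, rfl⟩
      rw [MonoidAlgebra.basis_apply]
      change groupOperator σ _ ∈ β.operators
      rw [hg]
      exact hβ.autOperator_mem _
    exact h3
  obtain ⟨h, hh⟩ := h2
  exact ⟨h, groupOperator_injective hσ ((hφ h).trans hh)⟩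

/-! ### Kernels of bialgebra surjections, and descent to group actions -/

section Kernel

variable {k H B : Type*} [Field k] [Ring H] [HopfAlgebra k H] [Ring B] [Bialgebra k B]

/-- For surjective f, the kernel of f ⊗ f is ker f ⊗ H + H ⊗ ker f, so S can be tested on pure
tensors with one factor in ker f. -/
theorem map_mem_of_map_eq_zero {f : H →ₗ[k] B} (hf : Function.Surjective f)
    {W : Type*} [AddCommGroup W] [Module k W] (S : H ⊗[k] H →ₗ[k] W) (N : Submodule k W)
    (h₁ : ∀ u v, f u = 0 → S (u ⊗ₜ v) ∈ N) (h₂ : ∀ u v, f v = 0 → S (u ⊗ₜ v) ∈ N)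
    {t : H ⊗[k] H} (ht : TensorProduct.map f f t = 0) : S t ∈ N := by
  have hex : Function.Exact (LinearMap.ker f).subtype f := LinearMap.exact_subtype_ker_map f
  have h4 : t ∈ LinearMap.ker (TensorProduct.map f f) := ht
  rw [TensorProduct.map_ker hex hf hex hf] at h4
  refine (?_ : _ ≤ N.comap S) h4
  refine sup_le ?_ ?_
  · rintro _ ⟨t, rfl⟩
    induction t with
    | zero => simp
    | add t t' h h' => rw [map_add]; exact add_mem h h'
    | tmul u v => exact h₂ u v.1 v.2
  · rintro _ ⟨t, rfl⟩
    induction t with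
    | zero => simp
    | add t t' h h' => rw [map_add]; exact add_mem h h'
    | tmul u v => exact h₁ u.1 v u.2

/-- The kernel of a surjective homomorphism of bialgebras is a coideal. -/
theorem map_comul_mem_of_ker {φ : H →ₐc[k] B} (hφ : Function.Surjective φ)
    {W : Type*} [AddCommGroup W] [Module k W] (S : H ⊗[k] H →ₗ[k] W) (N : Submodule k W)
    (h₁ : ∀ u v, φ u = 0 → S (u ⊗ₜ v) ∈ N) (h₂ : ∀ u v, φ v = 0 → S (u ⊗ₜ v) ∈ N)
    {x : H} (hx : φ x = 0) : S (Coalgebra.comul (R := k) x) ∈ N := by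
  refine map_mem_of_map_eq_zero (f := φ.toCoalgHom.toLinearMap) hφ S N h₁ h₂ ?_
  refine (DFunLike.congr_fun φ.toCoalgHom.map_comp_comul x).trans ?_
  change Coalgebra.comul (φ x) = 0
  rw [hx, map_zero]

/-- A Hopf action killed by the kernel of a homomorphism onto a group algebra is a group
action. -/
theorem HopfAct.exists_group_act {A G : Type*} [Ring A] [Algebra k A] [Group G]
    (α : HopfAct k H A) {φ : H →ₐc[k] MonoidAlgebra k G} (hφ : Function.Surjective φ)
    (hker : ∀ x, φ x = 0 → α.act x = 0) :
    ∃ ρ : G →* (A ≃ₐ[k] A), ∀ h a, α.act h a = (φ h).coeff.sum fun g c => c • ρ g a := by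
  have heq : ∀ x y, φ x = φ y → α.act x = α.act y := fun x y h => by
    rw [← sub_eq_zero, ← map_sub]
    exact hker _ (by rw [map_sub, h, sub_self])
  choose s hs using fun g => hφ (MonoidAlgebra.single g 1)
  have hmul : ∀ g a b, α.act (s g) (a * b) = α.act (s g) a * α.act (s g) b := fun g a b => by
    let S : H ⊗[k] H →ₗ[k] A := LinearMap.mul' k A ∘ₗ TensorProduct.map
      (α.act.toLinearMap.flip a) (α.act.toLinearMap.flip b)
    -- The preimage `s g` is group-like only modulo the kernel of φ ⊗ φ, which suffices because `S`
    -- vanishes there.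
    have h1 : S (Coalgebra.comul (R := k) (s g) - s g ⊗ₜ s g) ∈ (⊥ : Submodule k A) := by
      refine map_mem_of_map_eq_zero (f := φ.toCoalgHom.toLinearMap) hφ S ⊥ (fun u v h => ?_)
        (fun u v h => ?_) ?_
      · change α.act u a * α.act v b = 0
        rw [hker u h, LinearMap.zero_apply, zero_mul]
      · change α.act u a * α.act v b = 0
        rw [hker v h, LinearMap.zero_apply, mul_zero]
      · rw [map_sub, sub_eq_zero]
        refine (DFunLike.congr_fun φ.toCoalgHom.map_comp_comul (s g)).trans ?_
        change Coalgebra.comul (R := k) (φ (s g)) = φ (s g) ⊗ₜ φ (s g)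
        rw [hs]
        simp
    rw [Submodule.mem_bot, map_sub, sub_eq_zero] at h1
    rw [α.act_mul']
    exact h1
  have hone : ∀ g, α.act (s g) 1 = 1 := fun g => by
    have h1 : Coalgebra.counit (R := k) (s g) = 1 := by
      rw [← CoalgHomClass.counit_comp_apply φ (s g), hs]
      simp
    rw [α.act_one, h1, map_one]
  let m : G → (A →ₐ[k] A) := fun g =>
    AlgHom.ofLinearMap (α.act (s g)) (hone g) (hmul g)
  let M : G →* (A →ₐ[k] A) :=
    { toFun := m
      map_one' := by
        ext a
        change α.act (s 1) a = a
        rw [heq (s 1) 1 (by rw [hs, map_one]; rfl), map_one]; rfl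
      map_mul' := fun g g' => by
        ext a
        change α.act (s (g * g')) a = α.act (s g) (α.act (s g') a)
        rw [heq (s (g * g')) (s g * s g') (by rw [map_mul, hs, hs, hs]; simp), map_mul]; rfl }
  refine ⟨(AlgEquiv.algHomUnitsEquiv k A).toMonoidHom.comp M.toHomUnits, fun h a => ?_⟩
  change _ = (φ h).coeff.sum fun g c => c • α.act (s g) a
  rw [heq h (∑ g ∈ (φ h).coeff.support, (φ h).coeff g • s g) ?_, map_sum, LinearMap.sum_apply,
    Finsupp.sum]
  · simp
  · simp only [map_sum, map_smul, hs, MonoidAlgebra.smul_single', mul_one]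
    exact (MonoidAlgebra.sum_coeff_single _).symm

end Kernel

/-! ### Kernels of reductions of Hopf actions -/

/-- A map satisfying the Leibniz rule on a subalgebra and vanishing on a smaller one over which
everything is algebraic vanishes. -/
theorem leibniz_eq_zero_of_isAlgebraic {k Q : Type*} [Field k] [CharZero k] [Field Q]
    [Algebra k Q] {E C : Subalgebra k Q} (hEC : E ≤ C) [Algebra.IsAlgebraic E Q] (δ : Q →ₗ[k] Q)
    (hδ : ∀ x ∈ C, ∀ y ∈ C, δ (x * y) = x * δ y + y * δ x) (hE : ∀ z ∈ E, δ z = 0) :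
    ∀ x ∈ C, δ x = 0 := by
  have : CharZero Q := charZero_of_injective_algebraMap (algebraMap k Q).injective
  let _ : Algebra E C := (Subalgebra.inclusion hEC).toRingHom.toAlgebra
  have : IsScalarTower E C Q := .of_algebraMap_eq fun _ => rfl
  have : Algebra.IsAlgebraic E C := .tower_bot_of_injective
    (FaithfulSMul.algebraMap_injective C Q)
  let δ' : Derivation E C Q := Derivation.mk'
    { toFun := fun x => δ x
      map_add' := fun x y => map_add δ x.1 y.1
      map_smul' := fun z x => by
        have h1 := hδ z.1 (hEC z.2) x.1 x.2
        rw [hE _ z.2, mul_zero, add_zero] at h1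
        exact h1 }
    (fun x y => hδ _ x.2 _ y.2)
  have h1 := derivation_eq_zero_of_isAlgebraic δ'
  exact fun x hx => congrArg (fun d : Derivation E C Q => d ⟨x, hx⟩) h1

namespace Deformation

open Coalgebra Module

section HbarPow

variable {k L A₀ : Type*} [Field k] [Ring L] [Algebra k L] [CommRing A₀] [Algebra k A₀]
  (D : Deformation k L A₀)

/-- The ideal `ℏⁿ L`. -/
def hbarPow (n : ℕ) : Submodule k L := LinearMap.range (LinearMap.mulLeft k (D.hbar ^ n))

theorem mem_hbarPow {n : ℕ} {x : L} : x ∈ D.hbarPow n ↔ ∃ w, x = D.hbar ^ n * w :=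
  ⟨fun ⟨w, h⟩ => ⟨w, h.symm⟩, fun ⟨w, h⟩ => ⟨w, h.symm⟩⟩

theorem mul_mem_hbarPow {m n : ℕ} {x y : L} (hx : x ∈ D.hbarPow m) (hy : y ∈ D.hbarPow n) :
    x * y ∈ D.hbarPow (m + n) := by
  obtain ⟨w, rfl⟩ := D.mem_hbarPow.1 hx
  obtain ⟨v, rfl⟩ := D.mem_hbarPow.1 hy
  exact D.mem_hbarPow.2 ⟨w * v, by
    rw [pow_add, mul_assoc, ← mul_assoc w, ← D.hbar_pow_comm, mul_assoc, mul_assoc]⟩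

theorem mem_hbarPow_zero (x : L) : x ∈ D.hbarPow 0 := D.mem_hbarPow.2 ⟨x, by simp⟩

theorem mem_hbarPow_one {x : L} : x ∈ D.hbarPow 1 ↔ D.red x = 0 := by
  rw [mem_hbarPow, D.red_eq_zero, pow_one]

theorem hbarPow_mul_mem_succ {n : ℕ} {w : L} :
    D.hbar ^ n * w ∈ D.hbarPow (n + 1) ↔ D.red w = 0 := by
  rw [← mem_hbarPow_one, mem_hbarPow, mem_hbarPow]
  refine exists_congr fun v => ⟨fun h => ?_, fun h => ?_⟩
  · rw [pow_succ, mul_assoc] at h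
    rw [pow_one]
    exact D.hbar_pow_cancel h
  · rw [h, pow_one, pow_succ, mul_assoc]

/-- The symbol of an operator which is divisible by `ℏⁿ`. -/
theorem exists_symbol {n : ℕ} (t : L →ₗ[k] L) (ht : ∀ y, t y ∈ D.hbarPow n)
    (hcomm : ∀ y, t (D.hbar * y) = D.hbar * t y) :
    ∃ τ : A₀ →ₗ[k] A₀, ∀ y w, t y = D.hbar ^ n * w → τ (D.red y) = D.red w := by
  choose u hu using fun y => D.mem_hbarPow.1 (ht y)
  -- An argument divisible by ℏ gives a value divisible by ℏⁿ⁺¹, so the symbol depends only on the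
  -- reduction of the argument.
  have hzero : ∀ y, D.red y = 0 → D.red (u y) = 0 := fun y hy => by
    obtain ⟨v, rfl⟩ := (D.red_eq_zero _).1 hy
    rw [← D.hbarPow_mul_mem_succ (n := n), ← hu, hcomm, hu v, ← mul_assoc, ← pow_succ']
    exact D.mem_hbarPow.2 ⟨_, rfl⟩
  have hadd : ∀ y z, u (y + z) = u y + u z := fun y z => D.hbar_pow_cancel (n := n) <| by
    rw [← hu, mul_add, ← hu, ← hu, map_add]
  have hsmul : ∀ (c : k) y, u (c • y) = c • u y := fun c y => D.hbar_pow_cancel (n := n) <| by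
    rw [← hu, mul_smul_comm, ← hu, map_smul]
  have heq : ∀ y z, D.red y = D.red z → D.red (u y) = D.red (u z) := fun y z h => by
    have h1 := hzero (y - z) (by rw [map_sub, h, sub_self])
    have h2 := hadd (y - z) z
    rw [sub_add_cancel] at h2
    rw [h2, map_add, h1, zero_add]
  choose s hs using D.red_surjective
  let τ : A₀ →ₗ[k] A₀ :=
    { toFun := fun q => D.red (u (s q))
      map_add' := fun p q => by
        rw [← map_add, ← hadd]
        exact heq _ _ (by rw [map_add, hs, hs, hs])
      map_smul' := fun c q => by
        rw [RingHom.id_apply, ← map_smul, ← hsmul]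
        exact heq _ _ (by rw [map_smul, hs, hs]) }
  refine ⟨τ, fun y w h => ?_⟩
  change D.red (u (s (D.red y))) = D.red w
  rw [heq _ _ (hs (D.red y)), D.hbar_pow_cancel ((hu y).symm.trans h)]

end HbarPow

/-! ### Triviality of the kernel modulo all powers of ℏ -/

variable {k L Q H : Type*} [Field k] [Ring L] [Algebra k L] [Field Q] [Algebra k Q] [Ring H]
  [HopfAlgebra k H] (D : Deformation k L Q) {γ : HopfAct k H L}

theorem exists_redAct (hγ : D.hbar ∈ γ.invariants) :
    ∃ β : HopfAct k H Q, ∀ h y, β.act h (D.red y) = D.red (γ.act h y) :=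
  γ.exists_descend D.red D.red_surjective fun h a ha => by
    obtain ⟨y, rfl⟩ := (D.red_eq_zero _).1 ha
    rw [γ.act_invariant_mul hγ, map_mul, D.red_hbar, zero_mul]

variable {D} {β : HopfAct k H Q} (hβ : ∀ h y, β.act h (D.red y) = D.red (γ.act h y))

include hβ

theorem redInvariants_le : D.redInvariants γ ≤ β.invariants := by
  rintro _ ⟨z, hz, rfl⟩ h
  change β.act h (D.red z) = counit (R := k) h • D.red z
  rw [hβ, γ.mem_invariants.1 hz, map_smul]

variable {P : Derivation k Q (Derivation k Q Q)}
  (hP : ∀ x y w, x * y - y * x = D.hbar * w → P (D.red x) (D.red y) = D.red w)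
  (hγ : D.hbar ∈ γ.invariants)

include hP hγ

/-- Lift z to an invariant of L: the action commutes with the commutator by that lift, and division
by ℏ respects this since ℏ is invariant. -/
theorem act_bracket {z : Q} (hz : z ∈ D.redInvariants γ) (h : H) (q : Q) :
    β.act h (P z q) = P z (β.act h q) := by
  obtain ⟨z, hz, rfl⟩ := hz
  obtain ⟨y, rfl⟩ := D.red_surjective q
  obtain ⟨w, hw⟩ := D.exists_commutator z y
  have h1 : z * γ.act h y - γ.act h y * z = D.hbar * γ.act h w := by
    rw [← γ.act_invariant_mul hγ, ← hw, map_sub, γ.act_invariant_mul hz, γ.act_mul_invariant hz]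
  change β.act h (P (D.red z) (D.red y)) = P (D.red z) (β.act h (D.red y))
  rw [hP _ _ _ hw, hβ, hβ, hP _ _ _ h1]

variable [CharZero k] [Algebra.IsAlgebraic (D.redInvariants γ) Q]
  (hskew : ∀ f g, P f g = - P g f) (hcenter : ∀ f, (∀ g, P f g = 0) → ∃ c : k, f = algebraMap k Q c)

include hskew hcenter

theorem operatorsIndependent : β.OperatorsIndependent := fun n T hT hind =>
  D.linearIndependent_of_commute γ P hskew hcenter T hind fun i z hz q => by
    obtain ⟨h, hh⟩ := hT i
    rw [← hh]
    exact act_bracket hβ hP hγ hz h q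

variable [FiniteDimensional k H] {B : Type*} [Ring B] [Bialgebra k B] {φ : H →ₐc[k] B}

/-- If the kernel of the action on the reduction is a coideal and no nonzero operator from `H`
is the symbol of an element of the kernel, then elements of the kernel act trivially modulo
every power of `ℏ`. -/
theorem act_mem_hbarPow (hφ : Function.Surjective φ) (hker : ∀ x, φ x = 0 ↔ β.act x = 0)
    (hdeg : ∀ n x h, 1 ≤ n → (∀ y, γ.act x y ∈ D.hbarPow n) →
      (∀ y w, γ.act x y = D.hbar ^ n * w → D.red w = β.act h (D.red y)) → β.act h = 0)
    {n : ℕ} (hn : 1 ≤ n) : ∀ x, φ x = 0 → ∀ y, γ.act x y ∈ D.hbarPow n := by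
  have hind := operatorsIndependent hβ hP hγ hskew hcenter
  have hone : ∀ x, φ x = 0 → ∀ y, γ.act x y ∈ D.hbarPow 1 := fun x hx y => by
    rw [mem_hbarPow_one, ← hβ, (hker x).1 hx, LinearMap.zero_apply]
  have hcounit : ∀ x, φ x = 0 → counit (R := k) x = 0 := fun x hx => by
    rw [← CoalgHomClass.counit_comp_apply φ x, hx, map_zero]
  have hinv : ∀ c, D.red c ∈ β.invariants → ∀ h, γ.act h c - counit (R := k) h • c ∈ D.hbarPow 1 :=
    fun c hc h => by
      rw [mem_hbarPow_one, map_sub, ← hβ, β.mem_invariants.1 hc, map_smul, sub_self]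
  induction n, hn using Nat.le_induction with
  | base => exact hone
  | succ n hn ih =>
    -- `R` and `L'` apply the counit to one tensor factor. Thus `M`, `T'` and `T` express x · (ab),
    -- (x · a)b and a(x · b) as linear maps evaluated at Δ(x), and their differences can be
    -- estimated on pure tensors.
    let R : H ⊗[k] H →ₗ[k] H := (TensorProduct.rid k H).toLinearMap ∘ₗ
      (counit (R := k) (A := H)).lTensor H
    let L' : H ⊗[k] H →ₗ[k] H := (TensorProduct.lid k H).toLinearMap ∘ₗ
      (counit (R := k) (A := H)).rTensor H
    have hR : ∀ x, R (comul (R := k) x) = x := fun x => by simp [R]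
    have hL : ∀ x, L' (comul (R := k) x) = x := fun x => by simp [L']
    let M : L → L → (H ⊗[k] H →ₗ[k] L) := fun a b => LinearMap.mul' k L ∘ₗ
      TensorProduct.map (γ.act.toLinearMap.flip a) (γ.act.toLinearMap.flip b)
    let T : L → L → (H ⊗[k] H →ₗ[k] L) := fun a b =>
      LinearMap.mulLeft k a ∘ₗ γ.act.toLinearMap.flip b ∘ₗ L'
    let T' : L → L → (H ⊗[k] H →ₗ[k] L) := fun a b =>
      LinearMap.mulRight k b ∘ₗ γ.act.toLinearMap.flip a ∘ₗ R
    have hM : ∀ a b x, M a b (comul (R := k) x) = γ.act x (a * b) := fun a b x =>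
      (γ.act_mul' x a b).symm
    have hT : ∀ a b x, T a b (comul (R := k) x) = a * γ.act x b := fun a b x => by
      simp [T, hL]
    have hT' : ∀ a b x, T' a b (comul (R := k) x) = γ.act x a * b := fun a b x => by
      simp [T', hR]
    have hMt : ∀ a b u v, M a b (u ⊗ₜ v) = γ.act u a * γ.act v b := fun a b u v => by simp [M]
    have hTt : ∀ a b u v, T a b (u ⊗ₜ v) = counit (R := k) u • a * γ.act v b :=
      fun a b u v => by simp [T, L']
    have hTt' : ∀ a b u v, T' a b (u ⊗ₜ v) = γ.act u a * counit (R := k) v • b :=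
      fun a b u v => by simp [T', R]
    -- Since Δ(x) lies in ker φ ⊗ H + H ⊗ ker φ, one factor contributes ℏⁿ by induction. The other
    -- acts on a lift of an invariant by the counit up to ℏ. So x is a derivation on such lifts
    -- modulo ℏⁿ⁺¹.
    have hleib : ∀ x, φ x = 0 → ∀ c b, D.red c ∈ β.invariants → D.red b ∈ β.invariants →
        γ.act x (c * b) - γ.act x c * b - c * γ.act x b ∈ D.hbarPow (n + 1) := by
      intro x hx c b hc hb
      rw [← hM, ← hT, ← hT']
      refine map_comul_mem_of_ker hφ (M c b - T' c b - T c b) _ (fun u v hu => ?_)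
        (fun u v hv => ?_) hx
      · simp only [LinearMap.sub_apply, hMt, hTt, hTt', hcounit u hu, zero_smul, zero_mul,
          sub_zero, ← mul_sub]
        exact D.mul_mem_hbarPow (ih u hu c) (hinv b hb v)
      · simp only [LinearMap.sub_apply, hMt, hTt, hTt', hcounit v hv, zero_smul, mul_zero,
          sub_zero, ← sub_mul]
        rw [add_comm]
        exact D.mul_mem_hbarPow (hinv c hc u) (ih v hv b)
    -- On Q^H the symbol is a derivation that vanishes on reductions of true invariants, where x
    -- acts by ε(x) = 0; since everything is algebraic over those, it vanishes on Q^H.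
    have hC : ∀ x, φ x = 0 → ∀ c, D.red c ∈ β.invariants → γ.act x c ∈ D.hbarPow (n + 1) := by
      intro x hx c hc
      obtain ⟨τ, hτ⟩ := D.exists_symbol (γ.act x) (ih x hx) fun y => γ.act_invariant_mul hγ x y
      obtain ⟨w, hw⟩ := D.mem_hbarPow.1 (ih x hx c)
      rw [hw, D.hbarPow_mul_mem_succ, ← hτ _ _ hw]
      refine leibniz_eq_zero_of_isAlgebraic (redInvariants_le hβ) τ (fun X hX Y hY => ?_) ?_ _ hc
      · obtain ⟨a, rfl⟩ := D.red_surjective X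
        obtain ⟨b, rfl⟩ := D.red_surjective Y
        obtain ⟨u, hu⟩ := D.mem_hbarPow.1 (ih x hx a)
        obtain ⟨v, hv⟩ := D.mem_hbarPow.1 (ih x hx b)
        obtain ⟨e, he⟩ := D.mem_hbarPow.1 (hleib x hx a b hX hY)
        have h1 : γ.act x (a * b) = D.hbar ^ n * (u * b + a * v + D.hbar * e) := by
          rw [mul_add, mul_add, ← mul_assoc _ D.hbar, ← pow_succ, ← he, ← mul_assoc _ u, ← hu,
            ← mul_assoc _ a, D.hbar_pow_comm, mul_assoc a, ← hv]
          abel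
        rw [← map_mul, hτ _ _ h1, hτ _ _ hu, hτ _ _ hv, map_add, map_add, map_mul, map_mul, map_mul,
          D.red_hbar]
        ring
      · rintro _ ⟨z, hz, rfl⟩
        have h1 : γ.act x z = D.hbar ^ n * 0 := by
          rw [γ.mem_invariants.1 hz, hcounit x hx, zero_smul, mul_zero]
        exact (hτ _ _ h1).trans (map_zero _)
    intro x hx
    obtain ⟨τ, hτ⟩ := D.exists_symbol (γ.act x) (ih x hx) fun y => γ.act_invariant_mul hγ x y
    -- The same estimate with only one factor a lift of an invariant: the extra term is divisible by
    -- ℏⁿ⁺¹ thanks to `hC`, so the symbol is linear over Q^H.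
    have hlin : ∀ c ∈ β.fixedField, ∀ q, τ (c * q) = c * τ q := by
      intro c hc q
      obtain ⟨a, rfl⟩ := D.red_surjective c
      obtain ⟨y, rfl⟩ := D.red_surjective q
      have h1 : γ.act x (a * y) - a * γ.act x y ∈ D.hbarPow (n + 1) := by
        rw [← hM, ← hT]
        refine map_comul_mem_of_ker hφ (M a y - T a y) _ (fun u v hu => ?_)
          (fun u v hv => ?_) hx
        · simp only [LinearMap.sub_apply, hMt, hTt, hcounit u hu, zero_smul, zero_mul, sub_zero]
          exact D.mul_mem_hbarPow (m := n + 1) (n := 0) (hC u hu a hc) (D.mem_hbarPow_zero _)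
        · simp only [LinearMap.sub_apply, hMt, hTt, ← sub_mul]
          rw [add_comm]
          exact D.mul_mem_hbarPow (hinv a hc u) (ih v hv y)
      obtain ⟨e, he⟩ := D.mem_hbarPow.1 h1
      obtain ⟨v, hv⟩ := D.mem_hbarPow.1 (ih x hx y)
      have h2 : γ.act x (a * y) = D.hbar ^ n * (a * v + D.hbar * e) := by
        rw [mul_add, ← mul_assoc _ D.hbar, ← pow_succ, ← he, ← mul_assoc _ a, D.hbar_pow_comm,
          mul_assoc a, ← hv]
        abel
      rw [← map_mul, hτ _ _ h2, hτ _ _ hv, map_add, map_mul, map_mul, D.red_hbar]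
      ring
    have hPτ : ∀ z ∈ D.redInvariants γ, ∀ q, τ (P z q) = P z (τ q) := by
      rintro _ ⟨z, hz, rfl⟩ q
      obtain ⟨y, rfl⟩ := D.red_surjective q
      obtain ⟨w, hw⟩ := D.exists_commutator z y
      obtain ⟨v, hv⟩ := D.mem_hbarPow.1 (ih x hx y)
      obtain ⟨e, he⟩ := D.exists_commutator z v
      have h1 : γ.act x w = D.hbar ^ n * e := by
        refine D.hbar_pow_cancel (n := 1) ?_
        rw [pow_one, ← γ.act_invariant_mul hγ, ← hw, map_sub, γ.act_invariant_mul hz,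
          γ.act_mul_invariant hz, hv, ← mul_assoc, ← D.hbar_pow_comm, mul_assoc, mul_assoc,
          ← mul_sub, he, ← mul_assoc, ← mul_assoc, D.comm]
      change τ (P (D.red z) (D.red y)) = P (D.red z) (τ (D.red y))
      rw [hP _ _ _ hw, hτ _ _ h1, hτ _ _ hv, hP _ _ _ he]
    obtain ⟨q, hq⟩ := hind.exists_eq_sum τ hlin
    let t := finBasis k β.operators
    have hPt : ∀ z ∈ D.redInvariants γ, ∀ i y, (t i : Q →ₗ[k] Q) (P z y) =
        P z ((t i : Q →ₗ[k] Q) y) := fun z hz i y => by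
      obtain ⟨h, hh⟩ := (t i).2
      rw [← hh]
      exact act_bracket hβ hP hγ hz h y
    have hti : LinearIndependent Q fun i => (t i : Q →ₗ[k] Q) :=
      hind _ _ (fun i => (t i).2) (Submodule.linearIndependent_coe_basis _ t)
    -- Both τ and the operators tᵢ commute with {z, ·}, so Leibniz leaves ∑ {z, qᵢ} tᵢ = 0, and
    -- independence over Q applies. The qᵢ are then constants, so τ lies in the k-span of the
    -- operators.
    have hPq : ∀ z ∈ D.redInvariants γ, ∀ i, P z (q i) = 0 := fun z hz => by
      refine Fintype.linearIndependent_iff.1 hti (fun i => P z (q i)) (LinearMap.ext fun y => ?_)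
      have h1 := hPτ z hz y
      simp only [hq, LinearMap.sum_apply, LinearMap.smul_apply, smul_eq_mul, map_sum,
        Derivation.leibniz] at h1
      change ∑ i, q i * (t i : Q →ₗ[k] Q) (P z y) = ∑ i, (q i * P z ((t i : Q →ₗ[k] Q) y) +
        (t i : Q →ₗ[k] Q) y * P z (q i)) at h1
      simp only [hPt z hz, Finset.sum_add_distrib, left_eq_add] at h1
      simpa [mul_comm] using h1
    choose c hc using fun i => D.exists_algebraMap_of_bracket_eq_zero γ P hcenter (f := q i)
      fun z hz => by rw [hskew, hPq z hz, neg_zero]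
    have hτo : τ ∈ β.operators := by
      have h1 : τ = ∑ i, c i • (t i : Q →ₗ[k] Q) := by
        rw [hq]
        refine Finset.sum_congr rfl fun i _ => ?_
        rw [hc, algebraMap_smul]
      rw [h1]
      exact Submodule.sum_mem _ fun i _ => Submodule.smul_mem _ _ (t i).2
    obtain ⟨h, hh⟩ := hτo
    have hh' : β.act h = τ := hh
    have h0 := hdeg n x h hn (ih x hx) fun y w hw => by rw [hh', hτ _ _ hw]
    intro y
    obtain ⟨w, hw⟩ := D.mem_hbarPow.1 (ih x hx y)
    rw [hw, D.hbarPow_mul_mem_succ, ← hτ _ _ hw, ← hh', h0, LinearMap.zero_apply]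

end Deformation

/-! ### The Rees algebra of a filtered algebra -/

namespace AlgFiltration

open Polynomial

variable {k A : Type*} [Field k] [Ring A] [Algebra k A] (F : AlgFiltration k A)

/-- The Rees algebra `⨁ Fⁿ Xⁿ`. -/
noncomputable def rees : Subalgebra k A[X] where
  carrier := {p | ∀ n, p.coeff n ∈ F.level n}
  mul_mem' {p q} hp hq n := by
    rw [coeff_mul]
    refine sum_mem fun ij h => ?_
    rw [← Finset.HasAntidiagonal.mem_antidiagonal.1 h]
    exact F.mul_mem (hp _) (hq _)
  add_mem' {p q} hp hq n := by
    rw [coeff_add]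
    exact add_mem (hp n) (hq n)
  algebraMap_mem' c n := by
    rw [Polynomial.algebraMap_apply, coeff_C]
    split_ifs with h
    · rw [Algebra.algebraMap_eq_smul_one]
      exact Submodule.smul_mem _ _ (F.mono (Nat.zero_le n) F.one_mem)
    · exact zero_mem _

theorem monomial_mem_rees {n : ℕ} {a : A} (ha : a ∈ F.level n) : monomial n a ∈ F.rees := by
  intro m
  rw [coeff_monomial]
  split_ifs with h
  · exact h ▸ ha
  · exact zero_mem _

/-- The element `a Xⁿ` of the Rees algebra, for `a ∈ Fⁿ`. -/
noncomputable def reesMonomial (n : ℕ) (a : F.level n) : F.rees :=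
  ⟨monomial n a.1, F.monomial_mem_rees a.2⟩

variable {F} in
theorem rees_induction {p : F.rees → Prop} (h0 : p 0) (hs : ∀ n a, p (F.reesMonomial n a))
    (hadd : ∀ x y, p x → p y → p (x + y)) (x : F.rees) : p x := by
  have h1 : x = ∑ n ∈ x.1.support, F.reesMonomial n ⟨x.1.coeff n, x.2 n⟩ := by
    apply Subtype.ext
    rw [AddSubmonoidClass.coe_finsetSum]
    exact x.1.as_sum_support
  rw [h1]
  exact Finset.sum_induction _ p hadd h0 fun n _ => hs n _

theorem reesMonomial_mul {m n : ℕ} (a : F.level m) (b : F.level n) :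
    F.reesMonomial m a * F.reesMonomial n b =
      F.reesMonomial (m + n) ⟨a.1 * b.1, F.mul_mem a.2 b.2⟩ :=
  Subtype.ext (monomial_mul_monomial m n a.1 b.1)

/-- The homogeneous components of elements of `gr A`. -/
def component (n : ℕ) : F.Gr →ₗ[k] F.Piece n := DirectSum.component k ℕ F.Piece n

variable {F} in
theorem gr_ext {x y : F.Gr} (h : ∀ n, F.component n x = F.component n y) : x = y :=
  DFinsupp.ext h

theorem component_sym (n : ℕ) (a : F.level n) : F.component n (F.sym n a) = F.toPiece n a :=
  DirectSum.component.lof_self k n (F.toPiece n a)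

theorem component_sym_of_ne {m n : ℕ} (h : m ≠ n) (a : F.level m) :
    F.component n (F.sym m a) = 0 :=
  DFinsupp.single_eq_of_ne h.symm

/-- Reduction of the Rees algebra modulo `X`, as a function. -/
noncomputable def reesRedFun (p : F.rees) : F.Gr :=
  DirectSum.mk F.Piece p.1.support fun n => F.toPiece n ⟨p.1.coeff n, p.2 n⟩

theorem component_reesRedFun (p : F.rees) (n : ℕ) :
    F.component n (F.reesRedFun p) = F.toPiece n ⟨p.1.coeff n, p.2 n⟩ := by
  change (DFinsupp.mk (β := F.Piece) p.1.support
    fun n => F.toPiece n ⟨p.1.coeff n, p.2 n⟩) n = _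
  rw [DFinsupp.mk_apply]
  split_ifs with h
  · rfl
  · rw [notMem_support_iff] at h
    have h1 : (⟨p.1.coeff n, p.2 n⟩ : F.level n) = 0 := Subtype.ext h
    rw [h1, map_zero]

/-- Reduction of the Rees algebra modulo `X`, as a linear map. -/
noncomputable def reesRedLinear : F.rees →ₗ[k] F.Gr where
  toFun := F.reesRedFun
  map_add' p q := gr_ext fun n => by
    rw [map_add, component_reesRedFun, component_reesRedFun, component_reesRedFun, ← map_add]
    congr 1
  map_smul' c p := gr_ext fun n => by
    rw [map_smul, component_reesRedFun, component_reesRedFun, RingHom.id_apply, ← map_smul]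
    congr 1

theorem component_reesRedLinear (p : F.rees) (n : ℕ) :
    F.component n (F.reesRedLinear p) = F.toPiece n ⟨p.1.coeff n, p.2 n⟩ :=
  F.component_reesRedFun p n

theorem reesRedLinear_monomial (n : ℕ) (a : F.level n) :
    F.reesRedLinear (F.reesMonomial n a) = F.sym n a := by
  refine gr_ext fun m => ?_
  rw [component_reesRedLinear]
  by_cases h : n = m
  · subst h
    rw [component_sym]
    congr 1
    exact Subtype.ext (coeff_monomial_same n a.1)
  · rw [component_sym_of_ne F h]
    refine F.toPiece_eq_zero _ ?_
    change (monomial n a.1).coeff m ∈ _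
    rw [coeff_monomial_of_ne _ (Ne.symm h)]
    exact zero_mem _

/-- Reduction of the Rees algebra modulo `X`. -/
noncomputable def reesRed : F.rees →ₐ[k] F.Gr :=
  AlgHom.ofLinearMap F.reesRedLinear
    (by
      have h1 : (1 : F.rees) = F.reesMonomial 0 ⟨1, F.one_mem⟩ := Subtype.ext monomial_zero_one.symm
      rw [h1, reesRedLinear_monomial]
      rfl)
    (fun x y => by
      induction x using rees_induction with
      | h0 => simp
      | hadd x x' hx hx' => rw [add_mul, map_add, map_add, add_mul, hx, hx']
      | hs m a =>
        induction y using rees_induction with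
        | h0 => simp
        | hadd y y' hy hy' => rw [mul_add, map_add, map_add, mul_add, hy, hy']
        | hs n b =>
          rw [reesMonomial_mul, reesRedLinear_monomial, reesRedLinear_monomial,
            reesRedLinear_monomial, sym_mul_sym])

theorem reesRed_monomial (n : ℕ) (a : F.level n) :
    F.reesRed (F.reesMonomial n a) = F.sym n a := F.reesRedLinear_monomial n a

theorem component_reesRed (p : F.rees) (n : ℕ) :
    F.component n (F.reesRed p) = F.toPiece n ⟨p.1.coeff n, p.2 n⟩ :=
  F.component_reesRedFun p n

theorem X_mem_rees : (X : A[X]) ∈ F.rees := fun n => by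
  rw [coeff_X]
  split_ifs with h
  · exact F.mono (Nat.zero_le n) F.one_mem
  · exact zero_mem _

/-- The Rees algebra as a deformation of the associated graded algebra. -/
noncomputable def reesDeformation [IsMulCommutative F.Gr] : Deformation k F.rees F.Gr where
  hbar := ⟨X, F.X_mem_rees⟩
  comm x := Subtype.ext (X_mul)
  reg x h := Subtype.ext (isRegular_X.left (by
    change X * x.1 = X * 0
    rw [mul_zero]
    exact congrArg Subtype.val h))
  red := F.reesRed
  red_surjective x := by
    induction x using gr_induction with
    | h0 => exact ⟨0, map_zero _⟩
    | hadd x y hx hy =>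
      obtain ⟨p, rfl⟩ := hx
      obtain ⟨q, rfl⟩ := hy
      exact ⟨p + q, map_add _ _ _⟩
    | hs n a => exact ⟨_, F.reesRed_monomial n a⟩
  red_eq_zero x := by
    constructor
    · intro h
      have h1 : ∀ n, x.1.coeff n ∈ F.below n := fun n => by
        have h2 := F.component_reesRed x n
        rw [h, map_zero] at h2
        exact (Submodule.Quotient.mk_eq_zero ((F.below n).submoduleOf (F.level n))).1 h2.symm
      -- A zero class puts the coefficient of degree n + 1 in Fⁿ, exactly what is needed after
      -- shifting down by one; in degree 0 it says that the coefficient is zero.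
      refine ⟨⟨divX x.1, fun n => ?_⟩, Subtype.ext ?_⟩
      · rw [coeff_divX]
        exact h1 (n + 1)
      · have h2 : x.1.coeff 0 = 0 := (Submodule.mem_bot k).1 (h1 0)
        have h3 := divX_mul_X_add x.1
        rw [h2, map_zero, add_zero] at h3
        change x.1 = X * divX x.1
        rw [X_mul, h3]
    · rintro ⟨y, rfl⟩
      rw [map_mul]
      have h1 : (⟨X, F.X_mem_rees⟩ : F.rees) = F.reesMonomial 1
        ⟨1, F.mono (Nat.zero_le 1) F.one_mem⟩ := Subtype.ext monomial_one_one_eq_X.symm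
      have h2 : F.sym 1 ⟨1, F.mono (Nat.zero_le 1) F.one_mem⟩ = 0 := by
        have h3 : (1 : A) ∈ F.below 1 := F.one_mem
        change DirectSum.lof k ℕ F.Piece 1 (F.toPiece 1 ⟨1, F.mono (Nat.zero_le 1) F.one_mem⟩) = 0
        rw [F.toPiece_eq_zero _ h3, map_zero]
      rw [h1, reesRed_monomial, h2, zero_mul]

end AlgFiltration

/-! ### Hopf actions and Poisson brackets on the Rees algebra -/

/-- Applying a linear map to the coefficients of a polynomial. -/
noncomputable def Polynomial.coeffMap {k A : Type*} [Field k] [Ring A] [Algebra k A]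
    (f : A →ₗ[k] A) : Polynomial A →ₗ[k] Polynomial A where
  toFun p := p.sum fun n a => Polynomial.monomial n (f a)
  map_add' p q := Polynomial.sum_add_index p q _ (by simp) (by simp)
  map_smul' c p := by
    rw [RingHom.id_apply, Polynomial.sum_smul_index' p c _ (by simp), Polynomial.smul_sum]
    simp only [Polynomial.smul_monomial, map_smul]

theorem Polynomial.coeffMap_coeff {k A : Type*} [Field k] [Ring A] [Algebra k A]
    (f : A →ₗ[k] A) (p : Polynomial A) (n : ℕ) :
    (Polynomial.coeffMap f p).coeff n = f (p.coeff n) := by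
  change (p.sum fun n a => Polynomial.monomial n (f a)).coeff n = _
  rw [Polynomial.sum_def, Polynomial.finsetSum_coeff]
  simp only [Polynomial.coeff_monomial, Finset.sum_ite_eq']
  split_ifs with h
  · rfl
  · rw [Polynomial.notMem_support_iff.1 h, map_zero]

namespace AlgFiltration

open Polynomial

variable {k A : Type*} [Field k] [Ring A] [Algebra k A] (F : AlgFiltration k A)

section Act

variable {H : Type*} [Ring H] [HopfAlgebra k H] (α : HopfAct k H A)
  (hα : ∀ (n : ℕ) (h : H) (a : A), a ∈ F.level n → α.act h a ∈ F.level n)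

/-- The coefficientwise action on the Rees algebra, as a linear map. -/
noncomputable def reesActLinear (h : H) : F.rees →ₗ[k] F.rees :=
  (coeffMap (α.act h)).restrict (p := Subalgebra.toSubmodule F.rees)
    (q := Subalgebra.toSubmodule F.rees) fun p hp n => by
      rw [coeffMap_coeff]
      exact hα n h _ (hp n)

theorem reesActLinear_coeff (h : H) (p : F.rees) (n : ℕ) :
    (F.reesActLinear α hα h p).1.coeff n = α.act h (p.1.coeff n) := coeffMap_coeff _ _ _

theorem reesActLinear_monomial (h : H) (n : ℕ) (a : F.level n) :
    F.reesActLinear α hα h (F.reesMonomial n a) =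
      F.reesMonomial n ⟨α.act h a.1, hα n h a.1 a.2⟩ := by
  refine Subtype.ext (Polynomial.ext fun m => ?_)
  rw [reesActLinear_coeff]
  change α.act h ((monomial n a.1).coeff m) = (monomial n (α.act h a.1)).coeff m
  rw [coeff_monomial, coeff_monomial]
  split_ifs
  · rfl
  · exact map_zero _

theorem reesActLinear_add (h h' : H) (p : F.rees) : F.reesActLinear α hα (h + h') p =
    F.reesActLinear α hα h p + F.reesActLinear α hα h' p :=
  Subtype.ext <| Polynomial.ext fun n => by
    rw [reesActLinear_coeff, map_add]
    change _ = (_ + _ : A[X]).coeff n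
    rw [coeff_add, reesActLinear_coeff, reesActLinear_coeff]; rfl

theorem reesActLinear_smul (c : k) (h : H) (p : F.rees) : F.reesActLinear α hα (c • h) p =
    c • F.reesActLinear α hα h p :=
  Subtype.ext <| Polynomial.ext fun n => by
    rw [reesActLinear_coeff, map_smul]
    change _ = (c • _ : A[X]).coeff n
    rw [coeff_smul, reesActLinear_coeff]; rfl

/-- The action on the Rees algebra. -/
noncomputable def reesAct : HopfAct k H F.rees where
  act := AlgHom.ofLinearMap
    { toFun := F.reesActLinear α hα
      map_add' := fun h h' => LinearMap.ext (F.reesActLinear_add α hα h h')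
      map_smul' := fun c h => LinearMap.ext (F.reesActLinear_smul α hα c h) }
    (LinearMap.ext fun p => Subtype.ext <| Polynomial.ext fun n => by
      change (F.reesActLinear α hα 1 p).1.coeff n = _
      rw [reesActLinear_coeff, map_one]; rfl)
    (fun h h' => LinearMap.ext fun p => Subtype.ext <| Polynomial.ext fun n => by
      change (F.reesActLinear α hα (h * h') p).1.coeff n =
        (F.reesActLinear α hα h (F.reesActLinear α hα h' p)).1.coeff n
      rw [reesActLinear_coeff, reesActLinear_coeff, reesActLinear_coeff, map_mul]; rfl)
  act_mul' h x y := by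
    let f : F.rees → H →ₗ[k] F.rees := fun x =>
      { toFun := fun h => F.reesActLinear α hα h x
        map_add' := fun h h' => F.reesActLinear_add α hα h h' x
        map_smul' := fun c h => F.reesActLinear_smul α hα c h x }
    have hf0 : f 0 = 0 := LinearMap.ext fun h => map_zero (F.reesActLinear α hα h)
    have hfa : ∀ x y, f (x + y) = f x + f y := fun x y =>
      LinearMap.ext fun h => map_add (F.reesActLinear α hα h) x y
    change F.reesActLinear α hα h (x * y) = LinearMap.mul' k F.rees
      (TensorProduct.map (f x) (f y) (Coalgebra.comul (R := k) h))
    induction x using rees_induction with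
    | h0 => rw [zero_mul, hf0, TensorProduct.map_zero_left]; simp
    | hadd x x' hx hx' =>
      rw [add_mul, map_add, hx, hx', hfa, TensorProduct.map_add_left, LinearMap.add_apply, map_add]
    | hs m a =>
      induction y using rees_induction with
      | h0 => rw [mul_zero, hf0, TensorProduct.map_zero_right]; simp
      | hadd y y' hy hy' =>
        rw [mul_add, map_add, hy, hy', hfa, TensorProduct.map_add_right, LinearMap.add_apply,
          map_add]
      | hs n b =>
        have h1 : ∀ t : H ⊗[k] H, (LinearMap.mul' k F.rees
            (TensorProduct.map (f (F.reesMonomial m a)) (f (F.reesMonomial n b)) t)).1 =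
            monomial (m + n) (LinearMap.mul' k A (TensorProduct.map
              (α.act.toLinearMap.flip a.1) (α.act.toLinearMap.flip b.1) t)) := fun t => by
          induction t with
          | zero => simp
          | add t t' ht ht' =>
            rw [map_add, map_add, map_add, map_add, map_add, ← ht, ← ht']; rfl
          | tmul u v =>
            change (F.reesActLinear α hα u (F.reesMonomial m a) *
              F.reesActLinear α hα v (F.reesMonomial n b)).1 = _
            rw [reesActLinear_monomial, reesActLinear_monomial, reesMonomial_mul]
            rfl
        rw [reesMonomial_mul, reesActLinear_monomial]
        refine Subtype.ext ?_
        rw [h1, ← α.act_mul']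
        rfl
  act_one h := by
    have h1 : (1 : F.rees) = F.reesMonomial 0 ⟨1, F.one_mem⟩ := Subtype.ext monomial_zero_one.symm
    change F.reesActLinear α hα h 1 = _
    rw [h1, reesActLinear_monomial]
    refine Subtype.ext ?_
    change monomial 0 (α.act h 1) = algebraMap k A[X] _
    rw [α.act_one, Polynomial.algebraMap_apply]
    rfl

theorem reesAct_monomial (h : H) (n : ℕ) (a : F.level n) :
    (F.reesAct α hα).act h (F.reesMonomial n a) =
      F.reesMonomial n ⟨α.act h a.1, hα n h a.1 a.2⟩ := F.reesActLinear_monomial α hα h n a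

theorem hbar_mem_invariants [IsMulCommutative F.Gr] :
    F.reesDeformation.hbar ∈ (F.reesAct α hα).invariants := by
  intro h
  have h1 : F.reesDeformation.hbar = F.reesMonomial 1
    ⟨1, F.mono (Nat.zero_le 1) F.one_mem⟩ := Subtype.ext monomial_one_one_eq_X.symm
  rw [h1, reesAct_monomial]
  refine Subtype.ext ?_
  change monomial 1 (α.act h 1) = Coalgebra.counit (R := k) h • monomial 1 (1 : A)
  rw [α.act_one, smul_monomial, Algebra.algebraMap_eq_smul_one]

end Act

section Bracket

variable [IsMulCommutative F.Gr]

theorem poisson_skew (x y : F.Gr) : F.poisson x y = - F.poisson y x := F.grBracket_skew x y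

/-- By bilinearity it is enough to treat monomials: the commutator of aXᵐ and bXⁿ is (ab − ba)Xᵐ⁺ⁿ,
and dividing by X puts ab − ba in degree m + n − 1, where the bracket places it. -/
theorem poisson_reesRed (x y w : F.rees) (h : x * y - y * x = F.reesDeformation.hbar * w) :
    F.poisson (F.reesRed x) (F.reesRed y) = F.reesRed w := by
  induction x using rees_induction generalizing w with
  | h0 =>
    rw [zero_mul, mul_zero, sub_zero] at h
    rw [F.reesDeformation.reg w h.symm]; simp
  | hadd x x' hx hx' =>
    obtain ⟨v, hv⟩ := F.reesDeformation.exists_commutator x y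
    obtain ⟨v', hv'⟩ := F.reesDeformation.exists_commutator x' y
    have h1 : w = v + v' := F.reesDeformation.hbar_pow_cancel (n := 1) <| by
      rw [pow_one, ← h, mul_add F.reesDeformation.hbar, ← hv, ← hv']; noncomm_ring
    rw [h1, map_add, map_add, map_add, ← hx v hv, ← hx' v' hv']; rfl
  | hs m a =>
    induction y using rees_induction generalizing w with
    | h0 =>
      rw [zero_mul, mul_zero, sub_zero] at h
      rw [F.reesDeformation.reg w h.symm]; simp
    | hadd y y' hy hy' =>
      obtain ⟨v, hv⟩ := F.reesDeformation.exists_commutator (F.reesMonomial m a) y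
      obtain ⟨v', hv'⟩ := F.reesDeformation.exists_commutator (F.reesMonomial m a) y'
      have h1 : w = v + v' := F.reesDeformation.hbar_pow_cancel (n := 1) <| by
        rw [pow_one, ← h, mul_add F.reesDeformation.hbar, ← hv, ← hv']; noncomm_ring
      rw [h1, map_add, map_add, map_add, ← hy v hv, ← hy' v' hv']
    | hs n b =>
      rw [reesRed_monomial, reesRed_monomial, poisson_sym]
      have h1 : monomial (m + n) (a.1 * b.1 - b.1 * a.1) = X * w.1 := by
        have h2 : monomial m a.1 * monomial n b.1 - monomial n b.1 * monomial m a.1 = X * w.1 :=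
          congrArg Subtype.val h
        rwa [monomial_mul_monomial, monomial_mul_monomial, add_comm n m, ← map_sub] at h2
      -- The degree m + n is generalized so that the case 0, where the commutator is zero by the
      -- convention F⁻¹ = 0, can be split off.
      suffices key : ∀ N c (hc : c ∈ F.below N), monomial N c = X * w.1 →
          F.symPred N ⟨c, hc⟩ = F.reesRed w from key _ _ _ h1
      intro N c hc h1
      cases N with
      | zero =>
        have hc0 : c = 0 := (Submodule.mem_bot k).1 hc
        rw [hc0, map_zero] at h1
        rw [F.reesDeformation.reg w (Subtype.ext h1.symm), map_zero]
        rfl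
      | succ j =>
        have h2 : w = F.reesMonomial j ⟨c, hc⟩ := by
          refine F.reesDeformation.hbar_pow_cancel (n := 1) (Subtype.ext ?_)
          rw [pow_one]
          change X * w.1 = X * monomial j c
          rw [← h1, X_mul_monomial]
        rw [h2, reesRed_monomial]
        rfl

end Bracket

end AlgFiltration

/-! ### Skew-symmetry and commutators for the extended bracket -/

section FractionField

variable {k R K : Type*} [Field k] [CommRing R] [IsDomain R] [Algebra k R] [Field K]
  [Algebra R K] [IsFractionRing R K] [Algebra k K] [IsScalarTower k R K]

variable (R) in
omit [Algebra k R] [IsScalarTower k R K] in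
theorem derivation_eq_zero_of_algebraMap (d : Derivation k K K)
    (h : ∀ a, d (algebraMap R K a) = 0) : d = 0 := by
  ext x
  obtain ⟨a, _, s, hs, hx, _⟩ := exists_common_denominator R x x
  have hs' : algebraMap R K s ≠ 0 := (map_ne_zero_iff _ (IsFractionRing.injective R K)).2 hs
  have h1 := congrArg d hx
  rw [d.leibniz, h, h, smul_zero, zero_add, smul_eq_mul] at h1
  exact (mul_eq_zero.1 h1).resolve_left hs'

/-- The biderivation with the arguments interchanged, for a fixed second argument. -/
def Derivation.flipApply (P : Derivation k K (Derivation k K K)) (g : K) : Derivation k K K :=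
  Derivation.mk'
    { toFun := fun f => P f g
      map_add' := fun f f' => by rw [map_add]; rfl
      map_smul' := fun c f => by rw [map_smul]; rfl }
    (fun f f' => by
      change P (f * f') g = f • P f' g + f' • P f g
      rw [P.leibniz]; rfl)

/-- The sum of the bracket and its flip is a derivation in each variable, and a derivation of K is
determined on R; this is applied to one variable at a time. -/
theorem fracBiderivation_skew (B : Derivation k R (Derivation k R R))
    (hB : ∀ a b, B a b = - B b a) (f g : K) :
    fracBiderivation K B f g = - fracBiderivation K B g f := by
  have h1 : ∀ (a : R) (g : K), fracBiderivation K B (algebraMap R K a) g =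
      - fracBiderivation K B g (algebraMap R K a) := fun a g => by
    have h2 := derivation_eq_zero_of_algebraMap R (fracBiderivation K B (algebraMap R K a) +
      (fracBiderivation K B).flipApply (algebraMap R K a)) fun b => by
        change fracBiderivation K B (algebraMap R K a) (algebraMap R K b) +
          fracBiderivation K B (algebraMap R K b) (algebraMap R K a) = 0
        rw [fracBiderivation_algebraMap, fracBiderivation_algebraMap, hB, map_neg, neg_add_cancel]
    exact eq_neg_of_add_eq_zero_left (DFunLike.congr_fun h2 g)
  have h3 := derivation_eq_zero_of_algebraMap R (fracBiderivation K B f +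
    (fracBiderivation K B).flipApply f) fun b => by
      change fracBiderivation K B f (algebraMap R K b) +
        fracBiderivation K B (algebraMap R K b) f = 0
      rw [h1, add_neg_cancel]
  exact eq_neg_of_add_eq_zero_left (DFunLike.congr_fun h3 g)

end FractionField

/-- A biderivation computing commutators of elements generating the fractions computes all
commutators. -/
theorem Deformation.bracket_of_generators {k L Q : Type*} [Field k] [Ring L] [Algebra k L]
    [Field Q] [Algebra k Q] (D : Deformation k L Q) {P : Derivation k Q (Derivation k Q Q)}
    (hskew : ∀ f g, P f g = - P g f) (S : Set L)
    (hS : ∀ q, ∃ s ∈ S, ∃ a ∈ S, D.red s ≠ 0 ∧ D.red s * q = D.red a)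
    (hP : ∀ x ∈ S, ∀ y ∈ S, ∀ w, x * y - y * x = D.hbar * w → P (D.red x) (D.red y) = D.red w)
    (x y w : L) (h : x * y - y * x = D.hbar * w) : P (D.red x) (D.red y) = D.red w := by
  have step : ∀ x, (∀ y ∈ S, ∀ w, x * y - y * x = D.hbar * w → P (D.red x) (D.red y) = D.red w) →
      ∀ y w, x * y - y * x = D.hbar * w → P (D.red x) (D.red y) = D.red w := by
    intro x hx y w h
    -- In L one has sy = a + ℏz with s and a among the generators. Taking the commutator with x,
    -- dividing by ℏ and reducing gives a Leibniz identity that determines {x, y} because s has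
    -- nonzero reduction.
    obtain ⟨s, hs, a, ha, hs0, hsa⟩ := hS (D.red y)
    obtain ⟨z, hz⟩ := (D.red_eq_zero (s * y - a)).1 (by rw [map_sub, map_mul, hsa, sub_self])
    obtain ⟨v, hv⟩ := D.exists_commutator x s
    obtain ⟨u, hu⟩ := D.exists_commutator x a
    obtain ⟨t, ht⟩ := D.exists_commutator x z
    have h1 : v * y + s * w = u + D.hbar * t := by
      refine D.hbar_pow_cancel (n := 1) ?_
      have e1 : D.hbar * (s * w) = s * (D.hbar * w) := by
        rw [← mul_assoc, D.comm, mul_assoc]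
      have e2 : x * (D.hbar * z) = D.hbar * (x * z) := by
        rw [← mul_assoc, ← D.comm, mul_assoc]
      have e3 : s * y = a + D.hbar * z := by rw [← hz]; abel
      rw [pow_one, mul_add, mul_add, e1, ← mul_assoc, ← hv, ← h, ← hu, ← ht]
      have e4 : (x * s - s * x) * y + s * (x * y - y * x) = x * (s * y) - s * y * x := by
        noncomm_ring
      rw [e4, e3, mul_add, e2, add_mul, mul_assoc, mul_sub]
      abel
    have h2 := congrArg D.red h1
    rw [map_add, map_add, map_mul, map_mul, map_mul, D.red_hbar, zero_mul, add_zero,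
      ← hx s hs v hv, ← hx a ha u hu, ← hsa, Derivation.leibniz, smul_eq_mul, smul_eq_mul] at h2
    refine mul_left_cancel₀ hs0 ?_
    linear_combination -h2
  have swap : ∀ x y w, x * y - y * x = D.hbar * w → y * x - x * y = D.hbar * (-w) :=
    fun x y w h => by rw [mul_neg, ← h, neg_sub]
  refine step x (fun y hy w h => ?_) y w h
  rw [hskew, step y (fun x hx => hP y hy x hx) x (-w) (swap x y w h), map_neg, neg_neg]

/-- A module algebra as a Hopf action. -/
noncomputable def IsModuleAlgebra.hopfAct {k H A : Type*} [Field k] [Ring H] [HopfAlgebra k H]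
    [Ring A] [Algebra k A] [Module H A] [IsScalarTower k H A] (hact : IsModuleAlgebra k H A) :
    HopfAct k H A where
  act := Algebra.lsmul k k A
  act_mul' h a b := hact.smul_mul h a b
  act_one h := hact.smul_one h

/-! ### Assembly of the proof for filtered algebras -/

namespace AlgFiltration

open Module

variable {k H A : Type*} [Field k] [IsAlgClosed k] [CharZero k] [Ring H] [HopfAlgebra k H]
  [FiniteDimensional k H] [Ring A] [Algebra k A]

/-- A Hopf action preserving a filtration whose associated graded algebra is a commutative domain
with trivial Poisson center factors through a group action. -/
theorem exists_group_of_poissonCenterTrivial (α : HopfAct k H A) (F : AlgFiltration k A)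
    [IsMulCommutative F.Gr] [IsDomain F.Gr]
    (hα : ∀ (n : ℕ) (h : H) (a : A), a ∈ F.level n → α.act h a ∈ F.level n)
    (hcenter : F.PoissonCenterTrivial) :
    ∃ (G : Type) (_ : Group G) (_ : Finite G) (φ : H →ₐc[k] MonoidAlgebra k G),
      Function.Surjective φ ∧ ∀ x, φ x = 0 → α.act x = 0 := by
  let D₀ := F.reesDeformation
  let Q := FractionRing F.Gr
  let P := fracBiderivation Q F.poisson
  have hskew : ∀ f g, P f g = - P g f := fracBiderivation_skew F.poisson F.poisson_skew
  let D := D₀.completionDeformation Q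
  obtain ⟨γ, hγ⟩ := D₀.exists_completionAct (F.hbar_mem_invariants α hα)
  have hred : ∀ r, D.red (D₀.toCompletion r) = algebraMap F.Gr Q (F.reesRed r) :=
    D₀.completion_red_toCompletion Q
  have hbar : D.hbar ∈ γ.invariants := fun h => by
    change γ.act h (D₀.toCompletion D₀.hbar) = _ • D₀.toCompletion D₀.hbar
    rw [hγ, (F.reesAct α hα).mem_invariants.1 (F.hbar_mem_invariants α hα), map_smul]
  have halg : Algebra.IsAlgebraic (D.redInvariants γ) Q :=
    D.isAlgebraic_redInvariants γ hbar (fun x hx => D₀.completion_exists_pow_mul Q hx)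
      fun x hx => D₀.completion_isUnit Q hx
  have hP : ∀ x y w, x * y - y * x = D.hbar * w → P (D.red x) (D.red y) = D.red w := by
    refine D.bracket_of_generators hskew (Set.range D₀.toCompletion) (fun q => ?_) ?_
    · obtain ⟨a, _, s, hs, hq, -⟩ := exists_common_denominator F.Gr q q
      obtain ⟨s, rfl⟩ := D₀.red_surjective s
      obtain ⟨a, rfl⟩ := D₀.red_surjective a
      refine ⟨_, ⟨s, rfl⟩, _, ⟨a, rfl⟩, ?_, ?_⟩
      · rw [hred]
        exact (map_ne_zero_iff _ (IsFractionRing.injective F.Gr Q)).2 hs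
      · rw [hred, hred, mul_comm]
        exact hq
    · rintro _ ⟨x, rfl⟩ _ ⟨y, rfl⟩ w h
      obtain ⟨v, hv⟩ := D₀.exists_commutator x y
      have h1 : w = D₀.toCompletion v := by
        refine D.hbar_pow_cancel (n := 1) ?_
        rw [pow_one, ← h, ← map_mul, ← map_mul, ← map_sub, hv, map_mul]
        rfl
      rw [h1, hred, hred, hred]
      exact (fracBiderivation_algebraMap _ _ _).trans
        (congrArg _ (F.poisson_reesRed x y v hv))
  obtain ⟨β, hβ⟩ := D.exists_redAct hbar
  have hind := D.operatorsIndependent hβ hP hbar hskew hcenter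
  obtain ⟨G, iG, iG', σ, φ, hσ, hφ, hφβ⟩ := hind.exists_group
  have hker : ∀ x, φ x = 0 ↔ β.act x = 0 := fun x => by
    rw [← hφβ, map_eq_zero_iff _ (groupOperator_injective hσ)]
  have hmon : ∀ x m (a : F.level m), γ.act x (D₀.toCompletion (F.reesMonomial m a)) =
      D₀.toCompletion (F.reesMonomial m ⟨α.act x a.1, hα m x a.1 a.2⟩) := fun x m a => by
    rw [hγ, reesAct_monomial]
  have hdiv : ∀ n m (a : F.level m), D₀.toCompletion (F.reesMonomial m a) ∈ D.hbarPow n →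
      ∃ y : F.rees, D₀.toCompletion (F.reesMonomial m a) = D.hbar ^ n * D₀.toCompletion y ∧
        Polynomial.monomial m a.1 = Polynomial.X ^ n * y.1 := fun n m a h => by
    obtain ⟨w, hw⟩ := D.mem_hbarPow.1 h
    obtain ⟨y, hy⟩ := D₀.exists_of_toCompletion_eq Q hw
    refine ⟨y, ?_, congrArg Subtype.val hy⟩
    rw [hy, map_mul, map_pow]
    rfl
  -- The grading enters here: x and h both preserve Rees degree, while dividing by ℏⁿ lowers it by n
  -- ≥ 1.
  have hdeg : ∀ n x h, 1 ≤ n → (∀ y, γ.act x y ∈ D.hbarPow n) →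
      (∀ y w, γ.act x y = D.hbar ^ n * w → D.red w = β.act h (D.red y)) → β.act h = 0 := by
    intro n x h hn h1 h2
    have h3 : ∀ b : F.Gr, β.act h (algebraMap F.Gr Q b) = 0 := fun b => by
      induction b using gr_induction with
      | h0 => rw [map_zero, map_zero]
      | hadd b b' hb hb' => rw [map_add, map_add, hb, hb', add_zero]
      | hs m a =>
        have h4 := h1 (D₀.toCompletion (F.reesMonomial m a))
        rw [hmon] at h4
        obtain ⟨y, hy, hc⟩ := hdiv _ _ _ h4
        have h5 := h2 (D₀.toCompletion (F.reesMonomial m a)) (D₀.toCompletion y)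
          (by rw [hmon, hy])
        rw [hβ, hmon, hred, hred, reesRed_monomial] at h5
        have h6 := IsFractionRing.injective F.Gr Q h5
        have h7 := congrArg (F.component m) h6
        -- Since Xⁿy is a monomial of degree m, the coefficient of y in degree m is that of the
        -- monomial in degree n + m, which is zero.
        have h8 : (⟨y.1.coeff m, y.2 m⟩ : F.level m) = 0 := Subtype.ext <| by
          change y.1.coeff m = 0
          rw [← Polynomial.coeff_X_pow_mul y.1 n m, ← hc,
            Polynomial.coeff_monomial_of_ne _ (by omega)]
        rw [component_reesRed, h8, map_zero, component_sym] at h7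
        have h9 : F.sym m ⟨α.act h a.1, hα m h a.1 a.2⟩ = 0 :=
          (congrArg (DirectSum.lof k ℕ F.Piece m) h7).symm.trans (map_zero _)
        rw [← F.reesRed_monomial, ← hred, hβ, hmon, hred, reesRed_monomial, h9, map_zero]
    -- The operator of h is not multiplicative, so vanishing on A₀ does not pass to fractions
    -- directly. Instead, distinct automorphisms of Q stay distinct on A₀ and are independent there,
    -- so all coefficients of φ(h) vanish.
    let f : G → F.Gr →* Q := fun g => (σ g : Q →* Q).comp (algebraMap F.Gr Q : F.Gr →* Q)
    have hf : Function.Injective f := fun g g' hgg => hσ <| AlgEquiv.ext fun q => by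
      obtain ⟨a, _, s, hs, hq, -⟩ := exists_common_denominator F.Gr q q
      have hs' : algebraMap F.Gr Q s ≠ 0 :=
        (map_ne_zero_iff _ (IsFractionRing.injective F.Gr Q)).2 hs
      have e : ∀ b, σ g (algebraMap F.Gr Q b) = σ g' (algebraMap F.Gr Q b) :=
        fun b => DFunLike.congr_fun hgg b
      have e1 := congrArg (σ g) hq
      have e2 := congrArg (σ g') hq
      rw [map_mul, e, e] at e1
      rw [map_mul, ← e1] at e2
      exact (mul_right_cancel₀ ((map_ne_zero_iff _ (σ g').injective).2 hs') e2).symm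
    have h4 : LinearIndependent k fun g (b : F.Gr) => f g b := linearIndependent_monoidHom_comp hf
    refine (hker h).1 (MonoidAlgebra.ext (linearIndependent_iff.1 h4 _ (funext fun b => ?_)))
    have h5 := h3 b
    rw [← hφβ, groupOperator_apply, Finsupp.sum] at h5
    rw [Finsupp.linearCombination_apply, Finsupp.sum, Finset.sum_apply]
    exact h5
  refine ⟨G, iG, iG', φ, hφ, fun x hx => LinearMap.ext fun a => ?_⟩
  obtain ⟨m, ha⟩ := F.exhaustive a
  -- The exponent m + 1 exceeds the degree of the monomial (x · a)Xᵐ, so divisibility by that power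
  -- of X forces x · a = 0.
  have h1 := D.act_mem_hbarPow hβ hP hbar hskew hcenter hφ hker hdeg (n := m + 1) (by omega) x hx
    (D₀.toCompletion (F.reesMonomial m ⟨a, ha⟩))
  rw [hmon] at h1
  obtain ⟨y, -, hy⟩ := hdiv _ _ _ h1
  have h2 := congrArg (fun p => p.coeff m) hy
  simpa [Polynomial.coeff_X_pow_mul'] using h2

end AlgFiltration

theorem corollary3p4 {k H A : Type*} [Field k] [IsAlgClosed k] [CharZero k]
    [Ring H] [HopfAlgebra k H] [FiniteDimensional k H]
    [Ring A] [Algebra k A] [Module H A] [IsScalarTower k H A]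
    (hact : IsModuleAlgebra k H A)
    (F : AlgFiltration k A) [IsMulCommutative F.Gr] [IsDomain F.Gr]
    (hpres : ∀ (n : ℕ) (h : H) (a : A), a ∈ F.level n → h • a ∈ F.level n)
    (hcenter : F.PoissonCenterTrivial) :
    FactorsThroughGroupAction k H A := by
  obtain ⟨G, iG, iG', φ, hφ, hker⟩ :=
    F.exists_group_of_poissonCenterTrivial hact.hopfAct hpres hcenter
  obtain ⟨ρ, hρ⟩ := hact.hopfAct.exists_group_act hφ hker
  exact ⟨G, iG, iG', ρ, φ, hφ, hρ⟩
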